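/- Let $(X^{2n},\omega)$ be a closed (compact, without boundary) symplectic manifold, and let $\{f_t\}_{t\in[0,1]}$ be a Hamiltonian $S^1$-action on $X$, $S^1=\mathbb{R}/\mathbb{Z}$, generated by a Hamiltonian function $F:X\to\mathbb{R}$. Let $z_0\in X$ be a Maslov-zero fixed point of the action, i.e. a fixed point such that the loop $\{d_{z_0}f_t\}_{t\in[0,1]}\subset Sp(T_{z_0}X,\omega)$ has Maslov index $0$, and suppose that $$\int_X F\,\omega^n\neq \mathrm{Vol}(X)\cdot F(z_0),\qquad \mathrm{Vol}(X):=\int_X\omega^n .$$ Then there is an open neighbourhood $B$ of $z_0$ and, in the open manifold $M=X\setminus\overline{B}$, a compactly supported Hamiltonian loop $\{h_t\}_{t\in[0,1]}$, $h_0=h_1=\mathrm{Id}$, that is, the flow of a smooth time-dependent Hamiltonian function $\{H_t\}_{t\in[0,1]}$ with compact support in $M$, such that its Calabi invariant is non-zero: $$\mathrm{Cal}([\{h_t\}_{t\in[0,1]}])=\int_0^1\int_M H_t\,\omega^n\,dt\neq 0 ,$$ and such that (after extending each $h_t$ by the identity to $X$) the loop $\{h_t\}_{t\in[0,1]}$ is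 homotopic to $\{f_t\}_{t\in[0,1]}$ in the group $Ham(X)$ of Hamiltonian diffeomorphisms of $X$, through loops based at the identity. -/

import Mathlib

open Set MeasureTheory Matrix
open scoped Manifold ContDiff

noncomputable section

namespace HamLoop

/-- The model space `ℝ^{2n}`. -/
abbrev Model (n : ℕ) : Type := EuclideanSpace ℝ (Fin (2 * n))

section Forms

variable {n : ℕ} {X : Type*} [TopologicalSpace X] [ChartedSpace (Model n) X]

/-- The coordinate expression of a 2-form on `X` in the preferred chart at `x₀`, i.e. its pullback
under the inverse of the chart. It is meaningful on the target of the chart. -/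
def formInChart (η : ∀ x : X, (TangentSpace (𝓡 (2 * n)) x) [⋀^Fin 2]→L[ℝ] ℝ) (x₀ : X)
    (y : Model n) : Model n [⋀^Fin 2]→L[ℝ] ℝ :=
  (η ((extChartAt (𝓡 (2 * n)) x₀).symm y)).compContinuousLinearMap
    (mfderiv (𝓡 (2 * n)) (𝓡 (2 * n)) (extChartAt (𝓡 (2 * n)) x₀).symm y)

/-- The value `(η ∧ ⋯ ∧ η)(v₁, …, v₂ₙ)` of the `n`-th exterior power of an alternating 2-form. -/
def wedgePower {V : Type*} [AddCommGroup V] [Module ℝ V] [TopologicalSpace V]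
    (η : V [⋀^Fin 2]→L[ℝ] ℝ) (v : Fin (2 * n) → V) : ℝ :=
  (1 / 2 : ℝ) ^ n * ∑ σ : Equiv.Perm (Fin (2 * n)), ((Equiv.Perm.sign σ : ℤ) : ℝ) *
    ∏ i : Fin n, η ![v (σ ⟨2 * i.1, by omega⟩), v (σ ⟨2 * i.1 + 1, by omega⟩)]

end Forms

/-- A symplectic form on the `2n`-dimensional manifold `X`: a smooth, closed, nondegenerate
2-form. A symplectic form is called `Ω` in code (and `ω` in formulas in comments). -/
structure SymplecticForm (n : ℕ) (X : Type*) [TopologicalSpace X] [ChartedSpace (Model n) X] where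
  /-- the underlying 2-form -/
  form : ∀ x : X, (TangentSpace (𝓡 (2 * n)) x) [⋀^Fin 2]→L[ℝ] ℝ
  smooth : ∀ x₀ : X, ContDiffOn ℝ ∞ (formInChart form x₀) (extChartAt (𝓡 (2 * n)) x₀).target
  closed : ∀ x₀ : X, ∀ y ∈ (extChartAt (𝓡 (2 * n)) x₀).target,
    extDeriv (formInChart form x₀) y = 0
  nondegenerate : ∀ (x : X) (v : TangentSpace (𝓡 (2 * n)) x),
    (∀ w : TangentSpace (𝓡 (2 * n)) x, form x ![v, w] = 0) → v = 0

section Symplectic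

variable {n : ℕ} {X : Type*} [TopologicalSpace X] [ChartedSpace (Model n) X]

/-- The measure on the domain of the preferred chart at `x₀` given by integration of `ω^n`. The
absolute value accounts for the orientation of `X`, which is the one defined by `ω^n`. -/
def chartVolume [MeasurableSpace X] (Ω : SymplecticForm n X) (x₀ : X) : Measure X :=
  (((volume : Measure (Model n)).restrict (extChartAt (𝓡 (2 * n)) x₀).target).withDensity
    (fun y => ENNReal.ofReal
      |wedgePower (formInChart Ω.form x₀ y) (fun i => EuclideanSpace.single i (1 : ℝ))|)).map
    (extChartAt (𝓡 (2 * n)) x₀).symm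

/-- The measure `A ↦ ∫_A ω^n` on `X`. The measures `chartVolume ω x₀` are its restrictions to the
chart domains, so that it is their supremum: the least measure dominating all of them. -/
def symplecticVolume [MeasurableSpace X] (Ω : SymplecticForm n X) : Measure X :=
  ⨆ x₀ : X, chartVolume Ω x₀

/-- The velocity at time `t ∈ [0,1]` of the path `τ ↦ h τ x`, `τ ∈ [0,1]`. -/
def velocity (h : ℝ → X → X) (t : ℝ) (x : X) : TangentSpace (𝓡 (2 * n)) (h t x) :=
  mfderivWithin 𝓘(ℝ, ℝ) (𝓡 (2 * n)) (fun τ => h τ x) (Icc (0 : ℝ) 1) t (1 : ℝ)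

/-- `{h_t}`, `t ∈ [0,1]`, is a smooth path of maps of `X` starting at the identity, and it is the
flow of the smooth time-dependent Hamiltonian `{H_t}`, `t ∈ [0,1]`: the time derivative of `h_t` is
the vector field `X_{H_t}` along `h_t`, where `ω(X_{H_t}, ·) = -dH_t`. -/
structure IsHamiltonianFlow (Ω : SymplecticForm n X) (H : ℝ → X → ℝ) (h : ℝ → X → X) : Prop where
  smooth_ham : ContMDiffOn (𝓘(ℝ, ℝ).prod (𝓡 (2 * n))) 𝓘(ℝ, ℝ) ∞
    (fun p : ℝ × X => H p.1 p.2) (Icc (0 : ℝ) 1 ×ˢ univ)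
  smooth_flow : ContMDiffOn (𝓘(ℝ, ℝ).prod (𝓡 (2 * n))) (𝓡 (2 * n)) ∞
    (fun p : ℝ × X => h p.1 p.2) (Icc (0 : ℝ) 1 ×ˢ univ)
  start : ∀ x, h 0 x = x
  flow : ∀ t ∈ Icc (0 : ℝ) 1, ∀ x, ∀ w : TangentSpace (𝓡 (2 * n)) (h t x),
    Ω.form (h t x) ![velocity h t x, w] = - mfderiv (𝓡 (2 * n)) 𝓘(ℝ, ℝ) (H t) (h t x) w

/-- `{H_t}`, `t ∈ [0,1]`, is compactly supported in the set `M`, i.e. all `H_t` vanish off one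
compact subset of `M`. For `M` open, such functions on `X` are the compactly supported
functions on the manifold `M`, extended by zero. -/
def IsCompactlySupportedIn (M : Set X) (H : ℝ → X → ℝ) : Prop :=
  ∃ K : Set X, IsCompact K ∧ K ⊆ M ∧ ∀ t ∈ Icc (0 : ℝ) 1, ∀ x, x ∉ K → H t x = 0

/-- `{h_t}`, `t ∈ [0,1]`, is a compactly supported Hamiltonian loop in the open subset `M` of `X`
(based at the identity), generated by the compactly supported Hamiltonian `{H_t}`. Each `h_t` is
the identity off a compact subset of `M`; it is identified with its restriction to `M`. -/
structure IsHamiltonianLoopIn (Ω : SymplecticForm n X) (M : Set X) (H : ℝ → X → ℝ)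
    (h : ℝ → X → X) : Prop where
  compactly_supported : IsCompactlySupportedIn M H
  flow : IsHamiltonianFlow Ω H h
  loop : ∀ x, h 1 x = x

/-- The Calabi invariant `∫₀¹ ∫_M H_t ω^n dt` of the Hamiltonian path in `M` generated by the
compactly supported Hamiltonian `{H_t}`. -/
def calabi [MeasurableSpace X] (Ω : SymplecticForm n X) (M : Set X) (H : ℝ → X → ℝ) : ℝ :=
  ∫ t in (0 : ℝ)..1, ∫ x in M, H t x ∂(symplecticVolume Ω)

/-- The loops `{f_t}` and `{h_t}`, `t ∈ [0,1]`, are homotopic in `Ham(X)`, `X` compact: they are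
joined by a smooth family of loops `{k_{s,t}}` based at the identity, each of which is a
Hamiltonian loop of `X` (so that all `k_{s,t}` lie in `Ham(X)`). -/
def HomotopicInHam (Ω : SymplecticForm n X) (f h : ℝ → X → X) : Prop :=
  ∃ k : ℝ → ℝ → X → X,
    ContMDiffOn (𝓘(ℝ, ℝ).prod (𝓘(ℝ, ℝ).prod (𝓡 (2 * n)))) (𝓡 (2 * n)) ∞
      (fun p : ℝ × ℝ × X => k p.1 p.2.1 p.2.2) (Icc (0 : ℝ) 1 ×ˢ Icc (0 : ℝ) 1 ×ˢ univ) ∧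
    (∀ s ∈ Icc (0 : ℝ) 1, ∃ H : ℝ → X → ℝ, IsHamiltonianLoopIn Ω univ H (k s)) ∧
    (∀ t ∈ Icc (0 : ℝ) 1, ∀ x, k 0 t x = f t x) ∧
    (∀ t ∈ Icc (0 : ℝ) 1, ∀ x, k 1 t x = h t x)

/-- `{f_t}` is a Hamiltonian action of `S¹ = ℝ/ℤ` on `X`, generated by `F : X → ℝ`. -/
structure IsHamiltonianCircleAction (Ω : SymplecticForm n X) (F : X → ℝ) (f : ℝ → X → X) :
    Prop where
  smooth : ContMDiff (𝓘(ℝ, ℝ).prod (𝓡 (2 * n))) (𝓡 (2 * n)) ∞ (fun p : ℝ × X => f p.1 p.2)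
  add : ∀ s t x, f (s + t) x = f s (f t x)
  period : ∀ x, f 1 x = x
  flow : IsHamiltonianFlow Ω (fun _ => F) f

end Symplectic

section Maslov

variable {n : ℕ}

/-- For a real matrix with blocks `[X, -Y; Y, X]`, i.e. one commuting with the standard complex
structure, the determinant of the complex matrix `X + iY`. -/
def complexDet (U : Matrix (Fin n ⊕ Fin n) (Fin n ⊕ Fin n) ℝ) : ℂ :=
  Matrix.det (U.toBlocks₁₁.map (algebraMap ℝ ℂ) + Complex.I • U.toBlocks₂₁.map (algebraMap ℝ ℂ))

/-- The loop `{A_t}`, `t ∈ [0,1]`, in `Sp(2n, ℝ)` has Maslov index `m`: if `A_t = P_t U_t` is the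
polar decomposition, with `P_t` symmetric positive definite and `U_t` orthogonal, so that
`U_t ∈ Sp(2n, ℝ) ∩ O(2n) = U(n)`, then `m` is the degree of the loop `t ↦ det_ℂ U_t` in the unit
circle. -/
def HasMaslovIndex (A : ℝ → Matrix (Fin n ⊕ Fin n) (Fin n ⊕ Fin n) ℝ) (m : ℤ) : Prop :=
  (∀ t ∈ Icc (0 : ℝ) 1, A t ∈ Matrix.symplecticGroup (Fin n) ℝ) ∧
  ContinuousOn A (Icc (0 : ℝ) 1) ∧ A 0 = A 1 ∧
  ∃ (P U : ℝ → Matrix (Fin n ⊕ Fin n) (Fin n ⊕ Fin n) ℝ) (θ : ℝ → ℝ),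
    (∀ t ∈ Icc (0 : ℝ) 1, (P t).PosDef ∧ U t ∈ Matrix.orthogonalGroup (Fin n ⊕ Fin n) ℝ ∧
      A t = P t * U t) ∧
    ContinuousOn θ (Icc (0 : ℝ) 1) ∧
    (∀ t ∈ Icc (0 : ℝ) 1,
      complexDet (U t) = Complex.exp (2 * Real.pi * Complex.I * (θ t : ℂ))) ∧
    θ 1 - θ 0 = m

variable {X : Type*} [TopologicalSpace X] [ChartedSpace (Model n) X]

/-- A symplectic (Darboux) basis of `T_z X`. -/
def IsSymplecticBasis (Ω : SymplecticForm n X) (z : X)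
    (b : Module.Basis (Fin n ⊕ Fin n) ℝ (TangentSpace (𝓡 (2 * n)) z)) : Prop :=
  (∀ i j, Ω.form z ![b (Sum.inl i), b (Sum.inl j)] = 0) ∧
  (∀ i j, Ω.form z ![b (Sum.inr i), b (Sum.inr j)] = 0) ∧
  (∀ i j, Ω.form z ![b (Sum.inl i), b (Sum.inr j)] = if i = j then 1 else 0)

/-- The differential at `z` of a map `g` fixing `z`, as an endomorphism of `T_z X`. -/
def differentialAtFixedPoint (g : X → X) (z : X) (hz : g z = z) :
    TangentSpace (𝓡 (2 * n)) z →L[ℝ] TangentSpace (𝓡 (2 * n)) z :=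
  hz ▸ mfderiv (𝓡 (2 * n)) (𝓡 (2 * n)) g z

/-- `z` is a Maslov-zero fixed point of `{f_t}`: it is fixed by all `f_t`, and the loop of
differentials `d_z f_t` in `Sp(T_z X, ω)`, expressed in a symplectic basis, has Maslov index `0`
(which does not depend on the basis). -/
def IsMaslovZeroFixedPoint (Ω : SymplecticForm n X) (f : ℝ → X → X) (z : X) : Prop :=
  ∃ hz : ∀ t, f t z = z,
    ∃ b : Module.Basis (Fin n ⊕ Fin n) ℝ (TangentSpace (𝓡 (2 * n)) z),
      IsSymplecticBasis Ω z b ∧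
      HasMaslovIndex
        (fun t => LinearMap.toMatrix b b (differentialAtFixedPoint (f t) z (hz t)).toLinearMap) 0

end Maslov

end HamLoop

end

noncomputable section

set_option linter.unusedSectionVars false

namespace HamLoop

section Superposition

universe u

open Topology

variable {K : Type*} [TopologicalSpace K] [CompactSpace K]
variable {E F : Type u} [NormedAddCommGroup E] [NormedSpace ℝ E]
  [NormedAddCommGroup F] [NormedSpace ℝ F]

open Classical in
/-- The superposition operator `α ↦ G ∘ α` on continuous functions (zero if `G ∘ α` is not
continuous). -/
def superposition (G : E → F) (α : C(K, E)) : C(K, F) :=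
  if h : Continuous (fun t => G (α t)) then ⟨fun t => G (α t), h⟩ else 0

lemma superposition_apply {G : E → F} {U : Set E} (hG : ContinuousOn G U) {α : C(K, E)}
    (hα : ∀ t, α t ∈ U) (t : K) : superposition G α t = G (α t) := by
  have h : Continuous (fun t => G (α t)) := hG.comp_continuous α.continuous hα
  simp [superposition, h]

/-- Pointwise application of operators, as a continuous bilinear map. -/
def pointwiseApply (K : Type*) [TopologicalSpace K] [CompactSpace K] (E F : Type u)
    [NormedAddCommGroup E] [NormedSpace ℝ E] [NormedAddCommGroup F] [NormedSpace ℝ F] :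
    C(K, E →L[ℝ] F) →L[ℝ] C(K, E) →L[ℝ] C(K, F) :=
  LinearMap.mkContinuous₂
    (LinearMap.mk₂ ℝ (fun (A : C(K, E →L[ℝ] F)) (β : C(K, E)) =>
        (⟨fun t => A t (β t), A.continuous.clm_apply β.continuous⟩ : C(K, F)))
      (fun _ _ _ => by ext; simp) (fun _ _ _ => by ext; simp)
      (fun _ _ _ => by ext; simp) (fun _ _ _ => by ext; simp)) 1
    (fun A β => by
      rw [ContinuousMap.norm_le _ (by positivity)]
      intro t
      calc ‖A t (β t)‖ ≤ ‖A t‖ * ‖β t‖ := (A t).le_opNorm _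
        _ ≤ 1 * ‖A‖ * ‖β‖ := by
          rw [one_mul]
          gcongr
          exacts [A.norm_coe_le_norm t, β.norm_coe_le_norm t])

@[simp] lemma pointwiseApply_apply (A : C(K, E →L[ℝ] F)) (β : C(K, E)) (t : K) :
    pointwiseApply K E F A β t = A t (β t) := rfl

lemma isOpen_forall_mem {U : Set E} (hU : IsOpen U) : IsOpen {α : C(K, E) | ∀ t, α t ∈ U} := by
  simpa [MapsTo] using ContinuousMap.isOpen_setOfPred_mapsTo (isCompact_univ (X := K)) hU

lemma hasFDerivAt_superposition {G : E → F} {U : Set E} (hU : IsOpen U)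
    (hG : ContDiffOn ℝ 1 G U) {α : C(K, E)} (hα : ∀ t, α t ∈ U) :
    HasFDerivAt (superposition (K := K) G)
      (pointwiseApply K E F (superposition (fderiv ℝ G) α)) α := by
  have hcD : ContinuousOn (fderiv ℝ G) U := hG.continuousOn_fderiv_of_isOpen hU le_rfl
  have hcomp : IsCompact (range α) := isCompact_range α.continuous
  obtain ⟨δ₁, hδ₁, hsub⟩ := hcomp.exists_thickening_subset_open hU (by rintro _ ⟨t, rfl⟩; exact hα t)
  rw [hasFDerivAt_iff_isLittleO, Asymptotics.isLittleO_iff]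
  intro ε hε
  have hunif := hcomp.uniformContinuousAt_of_continuousAt (fderiv ℝ G)
    (by rintro _ ⟨t, rfl⟩; exact hcD.continuousAt (hU.mem_nhds (hα t))) (Metric.dist_mem_uniformity hε)
  obtain ⟨δ₂, hδ₂, hclose⟩ := Metric.mem_uniformity_dist.1 hunif
  have hδ : 0 < min δ₁ δ₂ := lt_min hδ₁ hδ₂
  filter_upwards [Metric.ball_mem_nhds α hδ] with γ hγ
  have hptd : ∀ t, γ t ∈ Metric.ball (α t) (min δ₁ δ₂) := fun t =>
    lt_of_le_of_lt (ContinuousMap.dist_apply_le_dist t) hγ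
  have hball : ∀ t, Metric.ball (α t) (min δ₁ δ₂) ⊆ U := fun t y hy =>
    hsub (Metric.mem_thickening_iff.2 ⟨α t, ⟨t, rfl⟩, lt_of_lt_of_le hy (min_le_left _ _)⟩)
  rw [ContinuousMap.norm_le _ (by positivity)]
  intro t
  simp only [ContinuousMap.sub_apply, pointwiseApply_apply]
  rw [superposition_apply hG.continuousOn hα, superposition_apply hcD hα,
    superposition_apply hG.continuousOn (fun t => hball t (hptd t))]
  have := (convex_ball (α t) (min δ₁ δ₂)).norm_image_sub_le_of_norm_fderiv_le' (𝕜 := ℝ) (f := G)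
    (φ := fderiv ℝ G (α t)) (C := ε) (x := α t) (y := γ t)
    (fun y hy => (hG.differentiableOn one_ne_zero).differentiableAt (hU.mem_nhds (hball t hy)))
    (fun y hy => by
      have := @hclose (α t) y (by
        rw [dist_comm]; exact lt_of_lt_of_le hy (min_le_right _ _)) ⟨t, rfl⟩
      rw [mem_ofPred_eq, dist_comm, dist_eq_norm] at this
      exact this.le) (Metric.mem_ball_self hδ) (hptd t)
  refine this.trans ?_
  gcongr
  exact (γ - α).norm_coe_le_norm t

lemma contDiffOn_superposition {G : E → F} {U : Set E} (hU : IsOpen U)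
    (hG : ContDiffOn ℝ ∞ G U) :
    ContDiffOn ℝ ∞ (superposition (K := K) G) {α | ∀ t, α t ∈ U} := by
  rw [contDiffOn_infty]
  intro k
  induction k generalizing F with
  | zero =>
    refine contDiffOn_zero.2 fun α hα => ?_
    exact ((hasFDerivAt_superposition hU (hG.of_le (by simp)) hα).continuousAt).continuousWithinAt
  | succ k ih =>
    have hO := isOpen_forall_mem (K := K) hU
    have hd : ∀ α ∈ {α : C(K, E) | ∀ t, α t ∈ U}, HasFDerivAt (superposition (K := K) G)
      (pointwiseApply K E F (superposition (fderiv ℝ G) α)) α := fun α hα =>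
        hasFDerivAt_superposition hU (hG.of_le (by simp)) hα
    have := (contDiffOn_succ_iff_fderiv_of_isOpen (𝕜 := ℝ) (n := (k : WithTop ℕ∞))
      (f := superposition (K := K) G) hO).2
    refine this ⟨fun α hα => (hd α hα).differentiableAt.differentiableWithinAt, by simp, ?_⟩
    have h2 := ih (G := fderiv ℝ G) ((contDiffOn_infty_iff_fderiv_of_isOpen hU).1 hG).2
    refine ContDiffOn.congr ((pointwiseApply K E F).contDiff.comp_contDiffOn h2) ?_
    intro α hα
    exact (hd α hα).fderiv

end Superposition

section Primitive

open unitInterval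

variable {E : Type*} [NormedAddCommGroup E] [NormedSpace ℝ E] [CompleteSpace E]

/-- The extension of a continuous function on the unit interval to `ℝ`, constant on both sides. -/
def extendI (α : C(I, E)) : ℝ → E := IccExtend zero_le_one α

lemma continuous_extendI (α : C(I, E)) : Continuous (extendI α) := α.continuous.Icc_extend'

lemma extendI_apply (α : C(I, E)) {t : ℝ} (ht : t ∈ Icc (0 : ℝ) 1) : extendI α t = α ⟨t, ht⟩ :=
  IccExtend_of_mem _ _ ht

lemma extendI_coe (α : C(I, E)) (t : I) : extendI α t = α t := extendI_apply α t.2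

lemma norm_extendI_le (α : C(I, E)) (t : ℝ) : ‖extendI α t‖ ≤ ‖α‖ := α.norm_coe_le_norm _

lemma hasDerivAt_integral_extendI (α : C(I, E)) (t : ℝ) :
    HasDerivAt (fun t => ∫ s in (0 : ℝ)..t, extendI α s) (extendI α t) t :=
  intervalIntegral.integral_hasDerivAt_right ((continuous_extendI α).intervalIntegrable _ _)
    (continuous_extendI α).stronglyMeasurable.stronglyMeasurableAtFilter
    (continuous_extendI α).continuousAt

/-- The operator `α ↦ (t ↦ ∫₀ᵗ α)`. -/
def primitive (E : Type*) [NormedAddCommGroup E] [NormedSpace ℝ E] [CompleteSpace E] :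
    C(I, E) →L[ℝ] C(I, E) :=
  LinearMap.mkContinuous
    { toFun := fun α => ⟨fun t => ∫ s in (0 : ℝ)..t, extendI α s, by
        have : Continuous fun t : ℝ => ∫ s in (0 : ℝ)..t, extendI α s :=
          continuous_iff_continuousAt.2 fun t => (hasDerivAt_integral_extendI α t).continuousAt
        exact this.comp continuous_subtype_val⟩
      map_add' := fun α β => by
        ext t
        have : extendI (α + β) = fun s => extendI α s + extendI β s := rfl
        simp only [this, ContinuousMap.coe_mk, ContinuousMap.add_apply]
        exact intervalIntegral.integral_add ((continuous_extendI α).intervalIntegrable _ _)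
          ((continuous_extendI β).intervalIntegrable _ _)
      map_smul' := fun c α => by
        ext t
        have : extendI (c • α) = fun s => c • extendI α s := rfl
        simp only [this, ContinuousMap.coe_mk, ContinuousMap.smul_apply, RingHom.id_apply]
        exact intervalIntegral.integral_smul _ _ } 1
    (fun α => by
      rw [ContinuousMap.norm_le _ (by positivity)]
      intro t
      refine (intervalIntegral.norm_integral_le_of_norm_le_const
        (C := ‖α‖) fun s _ => norm_extendI_le α s).trans ?_
      rw [sub_zero, abs_of_nonneg t.2.1, one_mul]
      exact mul_le_of_le_one_right (norm_nonneg _) t.2.2)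

lemma primitive_apply (α : C(I, E)) (t : I) :
    primitive E α t = ∫ s in (0 : ℝ)..t, extendI α s := rfl

lemma hasDerivWithinAt_extendI_primitive (α : C(I, E)) {t : ℝ} (ht : t ∈ Icc (0 : ℝ) 1) :
    HasDerivWithinAt (extendI (primitive E α)) (α ⟨t, ht⟩) (Icc 0 1) t := by
  rw [← extendI_apply α ht]
  refine (hasDerivAt_integral_extendI α t).hasDerivWithinAt.congr (fun s hs => ?_) ?_
  · rw [extendI_apply _ hs]; rfl
  · rw [extendI_apply _ ht]; rfl

/-- The operator `α ↦ ∫₀¹ α`. -/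
def integralI (E : Type*) [NormedAddCommGroup E] [NormedSpace ℝ E] [CompleteSpace E] :
    C(I, E) →L[ℝ] E :=
  (ContinuousMap.evalCLM ℝ (1 : I)).comp (primitive E)

lemma integralI_apply (α : C(I, E)) : integralI E α = ∫ s in (0 : ℝ)..1, extendI α s := rfl

end Primitive

section ParametricIntegral

universe u

open unitInterval Topology

variable {E F : Type u} [NormedAddCommGroup E] [NormedSpace ℝ E]
  [NormedAddCommGroup F] [NormedSpace ℝ F] [CompleteSpace F]

/-- The embedding of `E` as constant functions. -/
def constCLM (E : Type*) [NormedAddCommGroup E] [NormedSpace ℝ E] : E →L[ℝ] C(I, E) :=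
  LinearMap.mkContinuous
    { toFun := fun x => ContinuousMap.const I x
      map_add' := fun _ _ => rfl
      map_smul' := fun _ _ => rfl } 1
    (fun x => by
      rw [ContinuousMap.norm_le _ (by positivity)]
      intro t
      exact (one_mul ‖x‖).ge)

@[simp] lemma constCLM_apply (x : E) (t : I) : constCLM E x t = x := rfl

/-- The graph `t ↦ (t, α t)` of a continuous function. -/
def graphI (α : C(I, E)) : C(I, ℝ × E) := ⟨fun t => ((t : ℝ), α t), by fun_prop⟩

lemma graphI_eq (α : C(I, E)) : graphI α =
    graphI 0 + (ContinuousLinearMap.inr ℝ ℝ E).compLeftContinuous ℝ I α := by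
  ext t <;> simp [graphI]

lemma hasFDerivAt_graphI (α : C(I, E)) :
    HasFDerivAt graphI ((ContinuousLinearMap.inr ℝ ℝ E).compLeftContinuous ℝ I) α := by
  have : (graphI : C(I, E) → C(I, ℝ × E)) = fun α => graphI 0 +
    (ContinuousLinearMap.inr ℝ ℝ E).compLeftContinuous ℝ I α := funext graphI_eq
  rw [this]
  exact (ContinuousLinearMap.hasFDerivAt _).const_add _

lemma contDiff_graphI : ContDiff ℝ ∞ (graphI : C(I, E) → C(I, ℝ × E)) := by
  have : (graphI : C(I, E) → C(I, ℝ × E)) = fun α => graphI 0 +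
    (ContinuousLinearMap.inr ℝ ℝ E).compLeftContinuous ℝ I α := funext graphI_eq
  rw [this]
  exact contDiff_const.add (ContinuousLinearMap.contDiff _)

/-- Parametric integrals depend smoothly on the parameter. -/
lemma contDiffAt_parametric_integral {G : ℝ × E → F} {U : Set (ℝ × E)} (hU : IsOpen U)
    (hG : ContDiffOn ℝ ∞ G U) {x₀ : E} (hx : ∀ t ∈ Icc (0 : ℝ) 1, (t, x₀) ∈ U) :
    ContDiffAt ℝ ∞ (fun x => ∫ t in (0 : ℝ)..1, G (t, x)) x₀ ∧
    ∀ u, fderiv ℝ (fun x => ∫ t in (0 : ℝ)..1, G (t, x)) x₀ u =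
      ∫ t in (0 : ℝ)..1, fderiv ℝ G (t, x₀) (0, u) := by
  have hmem : graphI (constCLM E x₀) ∈ {α : C(I, ℝ × E) | ∀ t, α t ∈ U} := fun t => hx t t.2
  have hO := isOpen_forall_mem (K := I) hU
  have hcont : Continuous fun x : E => graphI (constCLM E x) :=
    (contDiff_graphI (E := E)).continuous.comp (constCLM E).continuous
  have hev : (fun x => ∫ t in (0 : ℝ)..1, G (t, x)) =ᶠ[𝓝 x₀]
      fun x => integralI F (superposition G (graphI (constCLM E x))) := by
    filter_upwards [hcont.continuousAt.preimage_mem_nhds (hO.mem_nhds hmem)] with x hxU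
    rw [integralI_apply]
    refine intervalIntegral.integral_congr fun t ht => ?_
    rw [uIcc_of_le zero_le_one] at ht
    rw [extendI_apply _ ht, superposition_apply hG.continuousOn hxU]
    rfl
  have hd := (hasFDerivAt_superposition hU (hG.of_le (by simp)) hmem).comp x₀
    ((hasFDerivAt_graphI (constCLM E x₀)).comp x₀ (constCLM E).hasFDerivAt)
  have hd2 := (integralI F).hasFDerivAt.comp x₀ hd
  refine ⟨ContDiffAt.congr_of_eventuallyEq ?_ hev, fun u => ?_⟩
  · have h1 : ContDiffAt ℝ ∞ (superposition G) (graphI (constCLM E x₀)) :=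
      (contDiffOn_superposition hU hG).contDiffAt (hO.mem_nhds hmem)
    have h2 : ContDiffAt ℝ ∞ (fun x => graphI (constCLM E x)) x₀ :=
      ((contDiff_graphI (E := E)).comp (constCLM E).contDiff).contDiffAt
    have h3 : ContDiffAt ℝ ∞ (fun x => superposition G (graphI (constCLM E x))) x₀ :=
      ContDiffAt.comp x₀ (g := superposition G) (f := fun x => graphI (constCLM E x)) h1 h2
    exact (integralI F).contDiff.contDiffAt.comp x₀ h3
  · rw [hev.fderiv_eq]
    refine (congrArg (fun L => L u) hd2.fderiv).trans ?_
    simp only [ContinuousLinearMap.comp_apply]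
    rw [integralI_apply]
    refine intervalIntegral.integral_congr fun t ht => ?_
    rw [uIcc_of_le zero_le_one] at ht
    rw [extendI_apply _ ht, pointwiseApply_apply, superposition_apply
      (hG.continuousOn_fderiv_of_isOpen hU (by simp)) hmem]
    rfl

end ParametricIntegral

set_option maxSynthPendingDepth 3

section InverseFunction

open Topology

variable {E F : Type*} [NormedAddCommGroup E] [NormedSpace ℝ E] [CompleteSpace E]
  [NormedAddCommGroup F] [NormedSpace ℝ F]

/-- The inverse function theorem for smooth maps on open sets. -/
lemma exists_smooth_localInverse {f : E → F} {U : Set E} (hU : IsOpen U)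
    (hf : ContDiffOn ℝ ∞ f U) {x₀ : E} (hx₀ : x₀ ∈ U) {f' : E ≃L[ℝ] F}
    (hf' : HasFDerivAt f (f' : E →L[ℝ] F) x₀) :
    ∃ e : OpenPartialHomeomorph E F, x₀ ∈ e.source ∧ e.source ⊆ U ∧ (∀ x, e x = f x) ∧
      ContDiffOn ℝ ∞ e.symm e.target := by
  have hat : ContDiffAt ℝ ∞ f x₀ := hf.contDiffAt (hU.mem_nhds hx₀)
  have hn : (∞ : WithTop ℕ∞) ≠ 0 := by simp
  set e₀ := hat.toOpenPartialHomeomorph f hf' hn with he₀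
  have hcD : ContinuousOn (fderiv ℝ f) U := hf.continuousOn_fderiv_of_isOpen hU (by simp)
  set S : Set E := U ∩ fderiv ℝ f ⁻¹' range ((↑) : (E ≃L[ℝ] F) → E →L[ℝ] F) with hS
  have hSo : IsOpen S := hcD.isOpen_inter_preimage hU (ContinuousLinearEquiv.isOpen)
  refine ⟨e₀.restrOpen S hSo, ?_, ?_, fun x => rfl, ?_⟩
  · refine ⟨hat.mem_toOpenPartialHomeomorph_source hf' hn, hx₀, f', ?_⟩
    exact hf'.fderiv.symm
  · rintro x ⟨_, hx, _⟩
    exact hx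
  · intro y hy
    have hys := (e₀.restrOpen S hSo).map_target hy
    obtain ⟨_, hxU, g', hg'⟩ := hys
    have hd : HasFDerivAt f (g' : E →L[ℝ] F) ((e₀.restrOpen S hSo).symm y) := by
      rw [hg']
      exact ((hf.differentiableOn (by simp)).differentiableAt (hU.mem_nhds hxU)).hasFDerivAt
    exact ((e₀.restrOpen S hSo).contDiffAt_symm hy hd
      (hf.contDiffAt (hU.mem_nhds hxU))).contDiffWithinAt

end InverseFunction

section Pullback

open Topology

variable {W : Type*} [NormedAddCommGroup W] [NormedSpace ℝ W]

/-- The derivative of a family of skew-symmetric forms takes skew-symmetric values. -/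
lemma skew_of_hasFDerivAt {E : Type*} [NormedAddCommGroup E] [NormedSpace ℝ E]
    {Ω : E → W →L[ℝ] W →L[ℝ] ℝ} {Ω' : E →L[ℝ] W →L[ℝ] W →L[ℝ] ℝ} {p : E}
    (h : HasFDerivAt Ω Ω' p) (hs : ∀ᶠ q in 𝓝 p, ∀ u v, Ω q u v = - Ω q v u) (a : E) (u v : W) :
    Ω' a u v = - Ω' a v u := by
  have e1 : HasFDerivAt (fun q => Ω q u v) ((Ω'.flip u).flip v) p := by
    refine ((h.clm_apply (hasFDerivAt_const u p)).clm_apply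
      (hasFDerivAt_const v p)).congr_fderiv ?_
    ext; simp
  have e2 : HasFDerivAt (fun q => - Ω q v u) (-(Ω'.flip v).flip u) p := by
    refine ((h.clm_apply (hasFDerivAt_const v p)).clm_apply
      (hasFDerivAt_const u p)).neg.congr_fderiv ?_
    ext; simp
  have e3 := e1.unique (e2.congr_of_eventuallyEq (hs.mono fun q hq => hq u v))
  simpa using congrArg (fun L => L a) e3

/-- If `c` is an integral curve of the time-dependent vector field `V` and `U₁`, `U₂` solve the
linearized equation along `c`, then `Ω(U₁, U₂)` is constant, when `Ω` is a path of closed 2-forms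
such that the Lie derivative of `Ω` along `V` cancels its time derivative. -/
lemma form_constant_along_flow {N : Set (ℝ × W)} (hN : IsOpen N)
    {Ω : ℝ × W → W →L[ℝ] W →L[ℝ] ℝ} {V : ℝ × W → W} {β : ℝ × W → W →L[ℝ] ℝ}
    (hΩ : DifferentiableOn ℝ Ω N) (hV : DifferentiableOn ℝ V N) (hβ : DifferentiableOn ℝ β N)
    (hskew : ∀ p ∈ N, ∀ u v, Ω p u v = - Ω p v u)
    (hcon : ∀ p ∈ N, Ω p (V p) = - β p)
    (hclosed : ∀ p ∈ N, ∀ a b c, fderiv ℝ Ω p (0, a) b c + fderiv ℝ Ω p (0, b) c a +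
      fderiv ℝ Ω p (0, c) a b = 0)
    (hdβ : ∀ p ∈ N, ∀ u v, fderiv ℝ β p (0, u) v - fderiv ℝ β p (0, v) u =
      fderiv ℝ Ω p (1, 0) u v)
    {c U₁ U₂ : ℝ → W} (hcN : ∀ s ∈ Icc (0 : ℝ) 1, (s, c s) ∈ N)
    (hc : ∀ s ∈ Icc (0 : ℝ) 1, HasDerivWithinAt c (V (s, c s)) (Icc 0 1) s)
    (hU₁ : ∀ s ∈ Icc (0 : ℝ) 1,
      HasDerivWithinAt U₁ (fderiv ℝ V (s, c s) (0, U₁ s)) (Icc 0 1) s)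
    (hU₂ : ∀ s ∈ Icc (0 : ℝ) 1,
      HasDerivWithinAt U₂ (fderiv ℝ V (s, c s) (0, U₂ s)) (Icc 0 1) s) :
    Ω (1, c 1) (U₁ 1) (U₂ 1) = Ω (0, c 0) (U₁ 0) (U₂ 0) := by
  have key : ∀ s ∈ Icc (0 : ℝ) 1,
      HasDerivWithinAt (fun s => Ω (s, c s) (U₁ s) (U₂ s)) 0 (Icc 0 1) s := by
    intro s hs
    set p : ℝ × W := (s, c s) with hp
    have hpN : N ∈ 𝓝 p := hN.mem_nhds (hcN s hs)
    have dΩ := (hΩ.differentiableAt hpN).hasFDerivAt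
    have dV := (hV.differentiableAt hpN).hasFDerivAt
    have dβ := (hβ.differentiableAt hpN).hasFDerivAt
    have d1 : HasDerivWithinAt (fun s => Ω (s, c s)) (fderiv ℝ Ω p (1, V p)) (Icc 0 1) s := by
      have d0 : HasDerivWithinAt (fun s => ((s, c s) : ℝ × W)) (1, V p) (Icc 0 1) s :=
        (hasDerivWithinAt_id s _).prodMk (hc s hs)
      exact HasFDerivAt.comp_hasDerivWithinAt (f := fun s => ((s, c s) : ℝ × W)) (l := Ω)
        (l' := fderiv ℝ Ω p) s dΩ d0
    have d2 := (d1.clm_apply (hU₁ s hs)).clm_apply (hU₂ s hs)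
    refine d2.congr_deriv ?_
    have hsk := skew_of_hasFDerivAt dΩ (Filter.eventually_of_mem hpN hskew)
    have hd : ∀ a, fderiv ℝ Ω p a (V p) + Ω p (fderiv ℝ V p a) = - fderiv ℝ β p a := by
      intro a
      have e1 := (dΩ.clm_apply dV).unique (dβ.neg.congr_of_eventuallyEq
        (Filter.eventually_of_mem hpN hcon))
      have := congrArg (fun L => L a) e1
      simp only [_root_.add_apply, ContinuousLinearMap.comp_apply,
        ContinuousLinearMap.flip_apply, _root_.neg_apply] at this
      rw [← this, add_comm]
    have h1 := congrArg (fun L => L (U₂ s)) (hd (0, U₁ s))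
    have h2 := congrArg (fun L => L (U₁ s)) (hd (0, U₂ s))
    have h3 := hclosed p (hcN s hs) (V p) (U₁ s) (U₂ s)
    have h4 := hdβ p (hcN s hs) (U₁ s) (U₂ s)
    have h5 := hsk (0, U₁ s) (U₂ s) (V p)
    have h6 := hskew p (hcN s hs) (U₁ s) (fderiv ℝ V p (0, U₂ s))
    have h7 : fderiv ℝ Ω p (1, V p) = fderiv ℝ Ω p (1, 0) + fderiv ℝ Ω p (0, V p) := by
      rw [← map_add]; simp
    simp only [_root_.add_apply, _root_.neg_apply] at h1 h2
    rw [h7]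
    simp only [_root_.add_apply]
    linarith
  have := constant_of_derivWithin_zero (f := fun s => Ω (s, c s) (U₁ s) (U₂ s)) (a := 0) (b := 1)
    (fun s hs => (key s hs).differentiableWithinAt)
    (fun s hs => (key s ⟨hs.1, hs.2.le⟩).derivWithin
      ((uniqueDiffOn_Icc zero_lt_one) s ⟨hs.1, hs.2.le⟩)) 1 (right_mem_Icc.2 zero_le_one)
  exact this

end Pullback

section Poincare

open Topology

universe u
variable {W : Type u} [NormedAddCommGroup W] [NormedSpace ℝ W]

/-- The integrand `(t, x) ↦ t (η(tx) - η(0))(x, ·)` of the radial primitive of `η - η(0)`. -/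
def radialIntegrand (η : W → W →L[ℝ] W →L[ℝ] ℝ) (p : ℝ × W) : W →L[ℝ] ℝ :=
  p.1 • ((η (p.1 • p.2) - η 0) p.2)

/-- The radial primitive of the 2-form `η - η(0)`. -/
def radialPrimitive (η : W → W →L[ℝ] W →L[ℝ] ℝ) (x : W) : W →L[ℝ] ℝ :=
  ∫ t in (0 : ℝ)..1, radialIntegrand η (t, x)

variable {η : W → W →L[ℝ] W →L[ℝ] ℝ} {R : ℝ}

lemma smul_mem_ball {x : W} (hx : x ∈ Metric.ball (0 : W) R) {t : ℝ} (ht : t ∈ Icc (0 : ℝ) 1) :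
    t • x ∈ Metric.ball (0 : W) R := by
  rw [mem_ball_zero_iff] at *
  rw [norm_smul, Real.norm_of_nonneg ht.1]
  exact (mul_le_of_le_one_left (norm_nonneg _) ht.2).trans_lt hx

lemma contDiffOn_radialIntegrand (hη : ContDiffOn ℝ ∞ η (Metric.ball 0 R)) :
    ContDiffOn ℝ ∞ (radialIntegrand η) ((fun p : ℝ × W => p.1 • p.2) ⁻¹' Metric.ball 0 R) := by
  have h1 : ContDiff ℝ ∞ (fun p : ℝ × W => p.1 • p.2) := contDiff_fst.smul contDiff_snd
  exact contDiff_fst.contDiffOn.smul (((hη.comp h1.contDiffOn fun p hp => hp).sub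
    contDiffOn_const).clm_apply contDiff_snd.contDiffOn)

lemma isOpen_smul_preimage_ball :
    IsOpen ((fun p : ℝ × W => p.1 • p.2) ⁻¹' Metric.ball (0 : W) R) :=
  Metric.isOpen_ball.preimage (continuous_fst.smul continuous_snd)

lemma fderiv_radialIntegrand (hη : ContDiffOn ℝ ∞ η (Metric.ball 0 R)) {t : ℝ} {x : W}
    (hx : t • x ∈ Metric.ball (0 : W) R) (u : W) :
    fderiv ℝ (radialIntegrand η) (t, x) (0, u) =
      t • ((t • fderiv ℝ η (t • x) u) x + (η (t • x) - η 0) u) := by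
  have d1 : HasFDerivAt (fun p : ℝ × W => p.1 • p.2)
      (t • ContinuousLinearMap.snd ℝ ℝ W + (ContinuousLinearMap.fst ℝ ℝ W).smulRight x) (t, x) :=
    HasFDerivAt.smul (x := (t, x)) (ContinuousLinearMap.fst ℝ ℝ W).hasFDerivAt
      (ContinuousLinearMap.snd ℝ ℝ W).hasFDerivAt
  have d2 : HasFDerivAt η (fderiv ℝ η (t • x)) (t • x) :=
    ((hη.differentiableOn (by simp)).differentiableAt
      (Metric.isOpen_ball.mem_nhds hx)).hasFDerivAt
  have d3 : HasFDerivAt (fun p : ℝ × W => η (p.1 • p.2)) _ (t, x) :=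
    HasFDerivAt.comp (t, x) (g := η) (f := fun p : ℝ × W => p.1 • p.2) d2 d1
  have d4 := ((d3.sub_const (η 0)).clm_apply (ContinuousLinearMap.snd ℝ ℝ W).hasFDerivAt)
  have d5 : HasFDerivAt (radialIntegrand η) _ (t, x) :=
    (ContinuousLinearMap.fst ℝ ℝ W).hasFDerivAt.smul d4
  rw [d5.fderiv]
  simp [add_comm]

lemma contDiffOn_radialPrimitive (hη : ContDiffOn ℝ ∞ η (Metric.ball 0 R)) :
    ContDiffOn ℝ ∞ (radialPrimitive η) (Metric.ball 0 R) := fun _ hx =>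
  (contDiffAt_parametric_integral isOpen_smul_preimage_ball (contDiffOn_radialIntegrand hη)
    (fun _ ht => smul_mem_ball hx ht)).1.contDiffWithinAt

lemma fderiv_radialPrimitive (hη : ContDiffOn ℝ ∞ η (Metric.ball 0 R)) {x : W}
    (hx : x ∈ Metric.ball (0 : W) R) (u : W) :
    fderiv ℝ (radialPrimitive η) x u =
      ∫ t in (0 : ℝ)..1, t • ((t • fderiv ℝ η (t • x) u) x + (η (t • x) - η 0) u) := by
  have := (contDiffAt_parametric_integral isOpen_smul_preimage_ball
    (contDiffOn_radialIntegrand hη) (fun _ ht => smul_mem_ball hx ht)).2 u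
  refine this.trans (intervalIntegral.integral_congr fun t ht => ?_)
  rw [uIcc_of_le zero_le_one] at ht
  exact fderiv_radialIntegrand hη (smul_mem_ball hx ht) u

lemma radialPrimitive_zero : radialPrimitive η 0 = 0 := by
  simp [radialPrimitive, radialIntegrand]

lemma fderiv_radialPrimitive_zero (hR : 0 < R) (hη : ContDiffOn ℝ ∞ η (Metric.ball 0 R)) :
    fderiv ℝ (radialPrimitive η) 0 = 0 := by
  ext1 u
  rw [fderiv_radialPrimitive hη (Metric.mem_ball_self hR)]
  simp

/-- The Poincaré lemma for 2-forms on a ball. -/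
lemma antisymm_fderiv_radialPrimitive (hη : ContDiffOn ℝ ∞ η (Metric.ball 0 R))
    (hskew : ∀ x ∈ Metric.ball (0 : W) R, ∀ u v, η x u v = - η x v u)
    (hclosed : ∀ x ∈ Metric.ball (0 : W) R, ∀ a b c, fderiv ℝ η x a b c + fderiv ℝ η x b c a +
      fderiv ℝ η x c a b = 0) {x : W} (hx : x ∈ Metric.ball (0 : W) R) (u v : W) :
    fderiv ℝ (radialPrimitive η) x u v - fderiv ℝ (radialPrimitive η) x v u =
      η x u v - η 0 u v := by
  have hR : 0 < R := (norm_nonneg x).trans_lt (mem_ball_zero_iff.1 hx)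
  have hdiff : ∀ y ∈ Metric.ball (0 : W) R, HasFDerivAt η (fderiv ℝ η y) y := fun y hy =>
    ((hη.differentiableOn (by simp)).differentiableAt
      (Metric.isOpen_ball.mem_nhds hy)).hasFDerivAt
  have hcη : ∀ u, ContinuousOn (fun t : ℝ => η (t • x) u) (Icc 0 1) := fun u =>
    (hη.continuousOn.comp (by fun_prop) fun t ht => smul_mem_ball hx ht).clm_apply
      continuousOn_const
  have hcD : ∀ u, ContinuousOn (fun t : ℝ => fderiv ℝ η (t • x) u x) (Icc 0 1) := fun u =>
    (((hη.continuousOn_fderiv_of_isOpen Metric.isOpen_ball (by simp)).comp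
      (f := fun t : ℝ => t • x) (by fun_prop)
      fun t ht => smul_mem_ball hx ht).clm_apply continuousOn_const).clm_apply continuousOn_const
  have hcη' : ∀ u v, ContinuousOn (fun t : ℝ => η (t • x) u v) (Icc 0 1) := fun u v =>
    (hcη u).clm_apply continuousOn_const
  have hcD' : ∀ u v, ContinuousOn (fun t : ℝ => fderiv ℝ η (t • x) u x v) (Icc 0 1) := fun u v =>
    (hcD u).clm_apply continuousOn_const
  have hcont : ∀ u : W, ContinuousOn
      (fun t : ℝ => t • ((t • fderiv ℝ η (t • x) u) x + (η (t • x) - η 0) u)) (uIcc 0 1) := by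
    intro u
    rw [uIcc_of_le zero_le_one]
    exact continuousOn_id.smul ((continuousOn_id.smul (hcD u)).add
      ((hcη u).sub continuousOn_const))
  have happ : ∀ u v : W, fderiv ℝ (radialPrimitive η) x u v =
      ∫ t in (0 : ℝ)..1, t * (t * fderiv ℝ η (t • x) u x v + (η (t • x) u v - η 0 u v)) := by
    intro u v
    rw [fderiv_radialPrimitive hη hx, ContinuousLinearMap.intervalIntegral_apply
      (hcont u).intervalIntegrable]
    simp [mul_add]
  have hci : ∀ u v : W, ContinuousOn (fun t : ℝ => t * (t * fderiv ℝ η (t • x) u x v +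
      (η (t • x) u v - η 0 u v))) (uIcc 0 1) := by
    intro u v
    rw [uIcc_of_le zero_le_one]
    exact continuousOn_id.mul ((continuousOn_id.mul (hcD' u v)).add
      ((hcη' u v).sub continuousOn_const))
  rw [happ, happ, ← intervalIntegral.integral_sub (hci u v).intervalIntegrable
    (hci v u).intervalIntegrable]
  have hD : ∀ t ∈ Icc (0 : ℝ) 1, HasDerivAt (fun t : ℝ => t ^ 2 * (η (t • x) u v - η 0 u v))
      (2 * t * (η (t • x) u v - η 0 u v) + t ^ 2 * fderiv ℝ η (t • x) x u v) t := by
    intro t ht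
    have d1 : HasDerivAt (fun t : ℝ => t • x) x t := by
      simpa using (hasDerivAt_id t).smul_const x
    have d2 : HasDerivAt (fun t : ℝ => η (t • x)) (fderiv ℝ η (t • x) x) t :=
      HasFDerivAt.comp_hasDerivAt (l := η) (l' := fderiv ℝ η (t • x)) (f := fun t : ℝ => t • x) t
        (hdiff _ (smul_mem_ball hx ht)) d1
    have d3 : HasDerivAt (fun t : ℝ => η (t • x) u v) (fderiv ℝ η (t • x) x u v) t := by
      have := (d2.clm_apply (hasDerivAt_const t u)).clm_apply (hasDerivAt_const t v)
      simpa using this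
    have d4 : HasDerivAt (fun t : ℝ => t ^ 2 * (η (t • x) u v - η 0 u v)) _ t :=
      (hasDerivAt_pow 2 t).mul (d3.sub_const (η 0 u v))
    exact d4.congr_deriv (by norm_num)
  have hskD : ∀ y ∈ Metric.ball (0 : W) R, ∀ a b c, fderiv ℝ η y a b c = - fderiv ℝ η y a c b :=
    fun y hy => skew_of_hasFDerivAt (hdiff y hy) (Filter.eventually_of_mem
      (Metric.isOpen_ball.mem_nhds hy) hskew)
  have hint : IntervalIntegrable (fun t : ℝ => 2 * t * (η (t • x) u v - η 0 u v) +
      t ^ 2 * fderiv ℝ η (t • x) x u v) volume 0 1 := by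
    apply ContinuousOn.intervalIntegrable
    rw [uIcc_of_le zero_le_one]
    have h1 : ContinuousOn (fun t : ℝ => fderiv ℝ η (t • x) x u v) (Icc 0 1) :=
      (((hη.continuousOn_fderiv_of_isOpen Metric.isOpen_ball (by simp)).comp
        (f := fun t : ℝ => t • x) (by fun_prop)
        fun t ht => smul_mem_ball hx ht).clm_apply continuousOn_const).clm_apply
          continuousOn_const |>.clm_apply continuousOn_const
    exact ((continuousOn_const.mul continuousOn_id).mul ((hcη' u v).sub continuousOn_const)).add
      ((continuousOn_id.pow 2).mul h1)
  have hFTC := intervalIntegral.integral_eq_sub_of_hasDerivAt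
    (fun t ht => hD t (by rwa [uIcc_of_le zero_le_one] at ht)) hint
  have hfin : (1 : ℝ) ^ 2 * (η ((1 : ℝ) • x) u v - η 0 u v) -
    0 ^ 2 * (η ((0 : ℝ) • x) u v - η 0 u v) = η x u v - η 0 u v := by simp
  rw [← hfin, ← hFTC]
  refine intervalIntegral.integral_congr fun t ht => ?_
  rw [uIcc_of_le zero_le_one] at ht
  have hm := smul_mem_ball hx ht
  have h1 := hclosed _ hm x u v
  have h2 := hskD _ hm u x v
  have h3 := hskew _ hm u v
  have h4 := hskew 0 (Metric.mem_ball_self hR) u v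
  have h5 : fderiv ℝ η (t • x) x u v = fderiv ℝ η (t • x) u x v - fderiv ℝ η (t • x) v x u := by
    linarith
  rw [h5, h3, h4]
  ring

end Poincare

section Moser

open Topology unitInterval

universe u
variable {W : Type u} [NormedAddCommGroup W] [NormedSpace ℝ W] [CompleteSpace W]

/-- The segment between the constant form `η(0)` and `η`. -/
def formSegment (η : W → W →L[ℝ] W →L[ℝ] ℝ) (p : ℝ × W) : W →L[ℝ] W →L[ℝ] ℝ :=
  η 0 + p.1 • (η p.2 - η 0)

/-- The domain of the Moser vector field. -/
def moserDomain (η : W → W →L[ℝ] W →L[ℝ] ℝ) (R : ℝ) : Set (ℝ × W) :=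
  (univ ×ˢ Metric.ball 0 R) ∩
    formSegment η ⁻¹' range ((↑) : (W ≃L[ℝ] (W →L[ℝ] ℝ)) → W →L[ℝ] (W →L[ℝ] ℝ))

/-- The Moser vector field. -/
def moserField (η : W → W →L[ℝ] W →L[ℝ] ℝ) (p : ℝ × W) : W :=
  - (formSegment η p).inverse (radialPrimitive η p.2)

variable {η : W → W →L[ℝ] W →L[ℝ] ℝ} {R : ℝ}

lemma contDiffOn_formSegment (hη : ContDiffOn ℝ ∞ η (Metric.ball 0 R)) :
    ContDiffOn ℝ ∞ (formSegment η) (univ ×ˢ Metric.ball 0 R) :=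
  contDiffOn_const.add (contDiff_fst.contDiffOn.smul
    ((hη.comp contDiff_snd.contDiffOn fun _ hp => hp.2).sub contDiffOn_const))

lemma isOpen_moserDomain (hη : ContDiffOn ℝ ∞ η (Metric.ball 0 R)) :
    IsOpen (moserDomain η R) :=
  (contDiffOn_formSegment hη).continuousOn.isOpen_inter_preimage
    (isOpen_univ.prod Metric.isOpen_ball) ContinuousLinearEquiv.isOpen

lemma contDiffOn_moserField (hη : ContDiffOn ℝ ∞ η (Metric.ball 0 R)) :
    ContDiffOn ℝ ∞ (moserField η) (moserDomain η R) := by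
  rintro p ⟨hp, e, he⟩
  have h1 : ContDiffAt ℝ ∞ (formSegment η) p :=
    (contDiffOn_formSegment hη).contDiffAt ((isOpen_univ.prod Metric.isOpen_ball).mem_nhds hp)
  have h2 : ContDiffAt ℝ ∞ (fun q : ℝ × W => radialPrimitive η q.2) p :=
    ContDiffAt.comp p ((contDiffOn_radialPrimitive hη).contDiffAt
      (Metric.isOpen_ball.mem_nhds hp.2)) contDiffAt_snd
  have h3 : ContDiffAt ℝ ∞ ContinuousLinearMap.inverse (formSegment η p) := by
    rw [← he]; exact contDiffAt_map_inverse e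
  have h4 : ContDiffAt ℝ ∞ (fun q => (formSegment η q).inverse) p :=
    ContDiffAt.comp p (g := ContinuousLinearMap.inverse) h3 h1
  exact (h4.clm_apply h2).neg.contDiffWithinAt

lemma formSegment_moserField {p : ℝ × W} (hp : p ∈ moserDomain η R) :
    formSegment η p (moserField η p) = - radialPrimitive η p.2 := by
  obtain ⟨_, e, he⟩ := hp
  simp only [moserField, ← he, ContinuousLinearMap.inverse_equiv, map_neg]
  simp

lemma mem_moserDomain_zero (hR : 0 < R) {e : W ≃L[ℝ] (W →L[ℝ] ℝ)}
    (he : (e : W →L[ℝ] (W →L[ℝ] ℝ)) = η 0) (s : ℝ) : (s, (0 : W)) ∈ moserDomain η R :=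
  ⟨⟨trivial, Metric.mem_ball_self hR⟩, e, by simp [formSegment, he]⟩

lemma moserField_zero (s : ℝ) : moserField η (s, 0) = 0 := by
  simp [moserField, radialPrimitive_zero]

lemma fderiv_moserField_zero (hη : ContDiffOn ℝ ∞ η (Metric.ball 0 R)) (hR : 0 < R)
    {e : W ≃L[ℝ] (W →L[ℝ] ℝ)} (he : (e : W →L[ℝ] (W →L[ℝ] ℝ)) = η 0) (s : ℝ) :
    fderiv ℝ (moserField η) (s, 0) = 0 := by
  have hp : (s, (0 : W)) ∈ univ ×ˢ Metric.ball (0 : W) R := ⟨trivial, Metric.mem_ball_self hR⟩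
  have h1 : ContDiffAt ℝ ∞ (formSegment η) (s, 0) :=
    (contDiffOn_formSegment hη).contDiffAt ((isOpen_univ.prod Metric.isOpen_ball).mem_nhds hp)
  have h2 : HasFDerivAt (radialPrimitive η) (0 : W →L[ℝ] W →L[ℝ] ℝ) 0 := by
    rw [← fderiv_radialPrimitive_zero hR hη]
    exact (((contDiffOn_radialPrimitive hη).differentiableOn (by simp)).differentiableAt
      (Metric.ball_mem_nhds _ hR)).hasFDerivAt
  have h2' : HasFDerivAt (fun q : ℝ × W => radialPrimitive η q.2) _ (s, (0 : W)) :=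
    HasFDerivAt.comp (s, (0 : W)) (g := radialPrimitive η) h2 hasFDerivAt_snd
  have h3 : ContDiffAt ℝ ∞ ContinuousLinearMap.inverse (formSegment η (s, 0)) := by
    have : formSegment η (s, 0) = e := by simp [formSegment, he]
    rw [this]; exact contDiffAt_map_inverse e
  have h4 : ContDiffAt ℝ ∞ (fun q => (formSegment η q).inverse) (s, 0) :=
    ContDiffAt.comp _ (g := ContinuousLinearMap.inverse) h3 h1
  have h5 := ((h4.differentiableAt (by simp)).hasFDerivAt.clm_apply h2').neg
  have h6 : HasFDerivAt (moserField η) _ (s, 0) := h5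
  rw [h6.fderiv]
  ext <;> simp [radialPrimitive_zero]

/-- The integral operator whose fixed points are the integral curves of the Moser vector field. -/
def moserOperator (η : W → W →L[ℝ] W →L[ℝ] ℝ) (α : C(I, W)) : C(I, W) :=
  α - primitive W (superposition (moserField η) (graphI α))

/-- The curves whose graph lies in the domain of the Moser vector field. -/
def moserCurves (η : W → W →L[ℝ] W →L[ℝ] ℝ) (R : ℝ) : Set (C(I, W)) :=
  {α | ∀ t, graphI α t ∈ moserDomain η R}

lemma isOpen_moserCurves (hη : ContDiffOn ℝ ∞ η (Metric.ball 0 R)) :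
    IsOpen (moserCurves η R) :=
  (isOpen_forall_mem (isOpen_moserDomain hη)).preimage (contDiff_graphI (E := W)).continuous

lemma contDiffOn_moserOperator (hη : ContDiffOn ℝ ∞ η (Metric.ball 0 R)) :
    ContDiffOn ℝ ∞ (moserOperator η) (moserCurves η R) := by
  refine contDiffOn_id.sub ((primitive W).contDiff.comp_contDiffOn ?_)
  exact ContDiffOn.comp (g := superposition (moserField η)) (f := graphI)
    (contDiffOn_superposition (isOpen_moserDomain hη) (contDiffOn_moserField hη))
    (contDiff_graphI (E := W)).contDiffOn (fun α hα => hα)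

lemma hasFDerivAt_moserOperator (hη : ContDiffOn ℝ ∞ η (Metric.ball 0 R)) {α : C(I, W)}
    (hα : α ∈ moserCurves η R) :
    HasFDerivAt (moserOperator η) (ContinuousLinearMap.id ℝ _ - (primitive W).comp
      ((pointwiseApply I (ℝ × W) W (superposition (fderiv ℝ (moserField η)) (graphI α))).comp
        ((ContinuousLinearMap.inr ℝ ℝ W).compLeftContinuous ℝ I))) α := by
  refine (hasFDerivAt_id α).sub ((primitive W).hasFDerivAt.comp α ?_)
  exact HasFDerivAt.comp α (g := superposition (moserField η)) (f := graphI)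
    (hasFDerivAt_superposition (isOpen_moserDomain hη)
    ((contDiffOn_moserField hη).of_le (by simp)) hα) (hasFDerivAt_graphI α)

lemma superposition_fderiv_moserField (hη : ContDiffOn ℝ ∞ η (Metric.ball 0 R)) {α : C(I, W)}
    (hα : α ∈ moserCurves η R) (t : I) :
    superposition (fderiv ℝ (moserField η)) (graphI α) t =
      fderiv ℝ (moserField η) ((t : ℝ), α t) :=
  superposition_apply ((contDiffOn_moserField hη).continuousOn_fderiv_of_isOpen
    (isOpen_moserDomain hη) (by simp)) hα t

/-- A smooth family of integral curves of the Moser vector field, on the time interval `[0,1]`. -/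
lemma exists_moser_curves (hη : ContDiffOn ℝ ∞ η (Metric.ball 0 R)) (hR : 0 < R)
    {e : W ≃L[ℝ] (W →L[ℝ] ℝ)} (he : (e : W →L[ℝ] (W →L[ℝ] ℝ)) = η 0) :
    ∃ Γ : OpenPartialHomeomorph C(I, W) C(I, W), (0 : C(I, W)) ∈ Γ.source ∧
      Γ.source ⊆ moserCurves η R ∧ (∀ α, Γ α = moserOperator η α) ∧
      ContDiffOn ℝ ∞ Γ.symm Γ.target ∧ Γ 0 = 0 ∧
      HasFDerivAt Γ.symm (ContinuousLinearMap.id ℝ C(I, W)) 0 := by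
  have h0 : (0 : C(I, W)) ∈ moserCurves η R := fun t => mem_moserDomain_zero hR he t
  have hd := hasFDerivAt_moserOperator hη h0
  have hid : ContinuousLinearMap.id ℝ C(I, W) - (primitive W).comp
      ((pointwiseApply I (ℝ × W) W (superposition (fderiv ℝ (moserField η)) (graphI 0))).comp
        ((ContinuousLinearMap.inr ℝ ℝ W).compLeftContinuous ℝ I)) =
      ContinuousLinearMap.id ℝ C(I, W) := by
    have : superposition (fderiv ℝ (moserField η)) (graphI (0 : C(I, W))) = 0 := by
      ext1 t
      rw [superposition_fderiv_moserField hη h0]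
      exact fderiv_moserField_zero hη hR he t
    rw [this]
    ext; simp
  rw [hid] at hd
  obtain ⟨Γ, h1, h2, h3, h4⟩ := exists_smooth_localInverse (isOpen_moserCurves hη)
    (contDiffOn_moserOperator hη) h0 (f' := ContinuousLinearEquiv.refl ℝ C(I, W)) hd
  have hz : Γ 0 = 0 := by
    rw [h3]
    have : superposition (moserField η) (graphI (0 : C(I, W))) = 0 := by
      ext1 t
      rw [superposition_apply (contDiffOn_moserField hη).continuousOn h0]
      exact moserField_zero (t : ℝ)
    simp [moserOperator, this]
  refine ⟨Γ, h1, h2, h3, h4, hz, ?_⟩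
  have ht : (0 : C(I, W)) ∈ Γ.target := by rw [← hz]; exact Γ.map_source h1
  have hs : Γ.symm 0 = 0 := by
    conv_lhs => rw [← hz]
    exact Γ.left_inv h1
  have hΓd : HasFDerivAt Γ ((ContinuousLinearEquiv.refl ℝ C(I, W) : C(I, W) ≃L[ℝ] C(I, W)) :
      C(I, W) →L[ℝ] C(I, W)) (Γ.symm 0) := by
    rw [hs, show (Γ : C(I, W) → C(I, W)) = moserOperator η from funext h3]
    exact hd
  exact Γ.hasFDerivAt_symm ht hΓd

end Moser

section Moser

open Topology unitInterval

universe u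
variable {W : Type u} [NormedAddCommGroup W] [NormedSpace ℝ W] [CompleteSpace W]
variable {η : W → W →L[ℝ] W →L[ℝ] ℝ} {R : ℝ}

lemma mem_ball_of_mem_moserDomain {p : ℝ × W} (hp : p ∈ moserDomain η R) :
    p.2 ∈ Metric.ball (0 : W) R := hp.1.2

lemma fderiv_comp_snd {F : Type*} [NormedAddCommGroup F] [NormedSpace ℝ F] {g : W → F}
    {p : ℝ × W} (hg : DifferentiableAt ℝ g p.2) (a : ℝ × W) :
    fderiv ℝ (fun q : ℝ × W => g q.2) p a = fderiv ℝ g p.2 a.2 := by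
  have : HasFDerivAt (fun q : ℝ × W => g q.2) _ p :=
    HasFDerivAt.comp p (g := g) hg.hasFDerivAt hasFDerivAt_snd
  rw [this.fderiv]
  rfl

lemma hasFDerivAt_formSegment (hη : ContDiffOn ℝ ∞ η (Metric.ball 0 R)) {p : ℝ × W}
    (hp : p.2 ∈ Metric.ball (0 : W) R) :
    HasFDerivAt (formSegment η) (p.1 • (fderiv ℝ η p.2).comp (ContinuousLinearMap.snd ℝ ℝ W) +
      (ContinuousLinearMap.fst ℝ ℝ W).smulRight (η p.2 - η 0)) p := by
  have hd : HasFDerivAt η (fderiv ℝ η p.2) p.2 :=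
    ((hη.differentiableOn (by simp)).differentiableAt
      (Metric.isOpen_ball.mem_nhds hp)).hasFDerivAt
  have h1 : HasFDerivAt (fun q : ℝ × W => η q.2) _ p :=
    HasFDerivAt.comp p (g := η) hd hasFDerivAt_snd
  have h2 : HasFDerivAt (fun q : ℝ × W => q.1 • (η q.2 - η 0)) _ p :=
    HasFDerivAt.smul (ContinuousLinearMap.fst ℝ ℝ W).hasFDerivAt (h1.sub_const (η 0))
  exact h2.const_add (η 0)

lemma formSegment_constant_along_moser (hη : ContDiffOn ℝ ∞ η (Metric.ball 0 R))
    (hskew : ∀ x ∈ Metric.ball (0 : W) R, ∀ u v, η x u v = - η x v u)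
    (hclosed : ∀ x ∈ Metric.ball (0 : W) R, ∀ a b c, fderiv ℝ η x a b c + fderiv ℝ η x b c a +
      fderiv ℝ η x c a b = 0)
    {c U₁ U₂ : ℝ → W} (hcN : ∀ s ∈ Icc (0 : ℝ) 1, (s, c s) ∈ moserDomain η R)
    (hc : ∀ s ∈ Icc (0 : ℝ) 1, HasDerivWithinAt c (moserField η (s, c s)) (Icc 0 1) s)
    (hU₁ : ∀ s ∈ Icc (0 : ℝ) 1,
      HasDerivWithinAt U₁ (fderiv ℝ (moserField η) (s, c s) (0, U₁ s)) (Icc 0 1) s)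
    (hU₂ : ∀ s ∈ Icc (0 : ℝ) 1,
      HasDerivWithinAt U₂ (fderiv ℝ (moserField η) (s, c s) (0, U₂ s)) (Icc 0 1) s) :
    η (c 1) (U₁ 1) (U₂ 1) = η 0 (U₁ 0) (U₂ 0) := by
  have hsub : moserDomain η R ⊆ univ ×ˢ Metric.ball (0 : W) R := inter_subset_left
  have hdprim : ∀ p ∈ moserDomain η R, DifferentiableAt ℝ (radialPrimitive η) p.2 := fun p hp =>
    ((contDiffOn_radialPrimitive hη).differentiableOn (by simp)).differentiableAt
      (Metric.isOpen_ball.mem_nhds (mem_ball_of_mem_moserDomain hp))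
  have h := form_constant_along_flow (isOpen_moserDomain hη) (Ω := formSegment η)
    (V := moserField η) (β := fun p => radialPrimitive η p.2)
    (((contDiffOn_formSegment hη).mono hsub).differentiableOn (by simp))
    ((contDiffOn_moserField hη).differentiableOn (by simp))
    (fun p hp => ((hdprim p hp).comp p differentiableAt_snd).differentiableWithinAt)
    (fun p hp u v => by
      have hm := mem_ball_of_mem_moserDomain hp
      have hR : 0 < R := (norm_nonneg _).trans_lt (mem_ball_zero_iff.1 hm)
      have h1 := hskew _ hm u v
      have h2 := hskew 0 (Metric.mem_ball_self hR) u v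
      simp only [formSegment, _root_.add_apply, _root_.smul_apply,
        _root_.sub_apply, h1, h2, smul_eq_mul]
      ring)
    (fun p hp => formSegment_moserField hp)
    (fun p hp a b c => by
      have hm := mem_ball_of_mem_moserDomain hp
      rw [(hasFDerivAt_formSegment hη hm).fderiv]
      have := congrArg (fun z => p.1 * z) (hclosed _ hm a b c)
      simpa [mul_add] using this)
    (fun p hp u v => by
      have hm := mem_ball_of_mem_moserDomain hp
      rw [(hasFDerivAt_formSegment hη hm).fderiv, fderiv_comp_snd (hdprim p hp),
        fderiv_comp_snd (hdprim p hp)]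
      simpa using antisymm_fderiv_radialPrimitive hη hskew hclosed hm u v)
    hcN hc hU₁ hU₂
  simpa [formSegment] using h

section Equivariance

variable {D : W ≃ₗᵢ[ℝ] W}
  (hD : ∀ x ∈ Metric.ball (0 : W) R, ∀ u v, η (D x) (D u) (D v) = η x u v)

include hD

lemma formSegment_equivariant {p : ℝ × W} (hp : p.2 ∈ Metric.ball (0 : W) R) (u v : W) :
    formSegment η (p.1, D p.2) (D u) (D v) = formSegment η p u v := by
  have hR : 0 < R := (norm_nonneg _).trans_lt (mem_ball_zero_iff.1 hp)
  have h0 := hD 0 (Metric.mem_ball_self hR) u v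
  rw [map_zero] at h0
  simp [formSegment, h0, hD _ hp]

lemma radialPrimitive_equivariant (hη : ContDiffOn ℝ ∞ η (Metric.ball 0 R)) {x : W}
    (hx : x ∈ Metric.ball (0 : W) R) (v : W) :
    radialPrimitive η (D x) (D v) = radialPrimitive η x v := by
  have hci : ∀ y ∈ Metric.ball (0 : W) R,
      IntervalIntegrable (fun t : ℝ => radialIntegrand η (t, y)) volume 0 1 := by
    intro y hy
    apply ContinuousOn.intervalIntegrable
    rw [uIcc_of_le zero_le_one]
    exact (contDiffOn_radialIntegrand hη).continuousOn.comp (by fun_prop)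
      fun t ht => smul_mem_ball hy ht
  have hDx : D x ∈ Metric.ball (0 : W) R := by simpa using hx
  unfold radialPrimitive
  rw [ContinuousLinearMap.intervalIntegral_apply (hci _ hDx),
    ContinuousLinearMap.intervalIntegral_apply (hci _ hx)]
  refine intervalIntegral.integral_congr fun t ht => ?_
  rw [uIcc_of_le zero_le_one] at ht
  have hR : 0 < R := (norm_nonneg _).trans_lt (mem_ball_zero_iff.1 hx)
  have h0 := hD 0 (Metric.mem_ball_self hR) x v
  rw [map_zero] at h0
  have h1 := hD _ (smul_mem_ball hx ht) x v
  rw [map_smul] at h1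
  simp [radialIntegrand, h0, h1]

lemma moserDomain_equivariant {p : ℝ × W} (hp : p ∈ moserDomain η R) :
    (p.1, D p.2) ∈ moserDomain η R := by
  obtain ⟨⟨_, hp2⟩, e, he⟩ := hp
  refine ⟨⟨trivial, by simpa using hp2⟩, (D.symm.toContinuousLinearEquiv.trans e).trans
    (D.toContinuousLinearEquiv.arrowCongr (ContinuousLinearEquiv.refl ℝ ℝ)), ?_⟩
  ext u v
  have := formSegment_equivariant hD hp2 (D.symm u) (D.symm v)
  rw [D.apply_symm_apply, D.apply_symm_apply] at this
  rw [this, ← he]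
  rfl

lemma moserField_equivariant (hη : ContDiffOn ℝ ∞ η (Metric.ball 0 R)) {p : ℝ × W}
    (hp : p ∈ moserDomain η R) :
    moserField η (p.1, D p.2) = D (moserField η p) := by
  have hp' := moserDomain_equivariant hD hp
  have hm := mem_ball_of_mem_moserDomain hp
  have hinj : Function.Injective (formSegment η (p.1, D p.2)) := by
    obtain ⟨_, e, he⟩ := hp'
    rw [← he]; exact e.injective
  apply hinj
  rw [formSegment_moserField hp']
  ext v
  have h1 := formSegment_equivariant hD hm (moserField η p) (D.symm v)
  have h2 := radialPrimitive_equivariant hD hη hm (D.symm v)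
  rw [D.apply_symm_apply] at h1 h2
  rw [h1, formSegment_moserField hp]
  simp [h2]

lemma moserOperator_equivariant (hη : ContDiffOn ℝ ∞ η (Metric.ball 0 R)) {α : C(I, W)}
    (hα : α ∈ moserCurves η R) :
    moserOperator η ((D : W →L[ℝ] W).compLeftContinuous ℝ I α) =
      (D : W →L[ℝ] W).compLeftContinuous ℝ I (moserOperator η α) := by
  have hα' : (D : W →L[ℝ] W).compLeftContinuous ℝ I α ∈ moserCurves η R := fun t =>
    moserDomain_equivariant hD (hα t)
  have hc := (contDiffOn_moserField hη).continuousOn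
  have h1 : superposition (moserField η) (graphI ((D : W →L[ℝ] W).compLeftContinuous ℝ I α)) =
      (D : W →L[ℝ] W).compLeftContinuous ℝ I (superposition (moserField η) (graphI α)) := by
    ext1 t
    rw [superposition_apply hc hα']
    refine (moserField_equivariant hD hη (hα t)).trans ?_
    rw [← superposition_apply hc hα]
    rfl
  ext1 t
  simp only [moserOperator, h1, map_sub]
  refine congrArg (fun z => (D : W →L[ℝ] W).compLeftContinuous ℝ I α t - z) ?_
  exact ContinuousLinearMap.intervalIntegral_comp_comm (D : W →L[ℝ] W)
    ((continuous_extendI _).intervalIntegrable _ _)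

end Equivariance

/-- Moser's theorem, equivariant under a family of linear isometries: near the origin, a symplectic
form is equivalent to a constant one. -/
theorem exists_equivariant_darboux (hη : ContDiffOn ℝ ∞ η (Metric.ball 0 R)) (hR : 0 < R)
    {e : W ≃L[ℝ] (W →L[ℝ] ℝ)} (he : (e : W →L[ℝ] (W →L[ℝ] ℝ)) = η 0)
    (hskew : ∀ x ∈ Metric.ball (0 : W) R, ∀ u v, η x u v = - η x v u)
    (hclosed : ∀ x ∈ Metric.ball (0 : W) R, ∀ a b c, fderiv ℝ η x a b c + fderiv ℝ η x b c a +
      fderiv ℝ η x c a b = 0)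
    {ι : Type*} {D : ι → W ≃ₗᵢ[ℝ] W}
    (hD : ∀ i, ∀ x ∈ Metric.ball (0 : W) R, ∀ u v, η (D i x) (D i u) (D i v) = η x u v) :
    ∃ ψ : OpenPartialHomeomorph W W, ψ 0 = 0 ∧ ContDiffOn ℝ ∞ ψ ψ.source ∧
      ContDiffOn ℝ ∞ ψ.symm ψ.target ∧ ψ.target ⊆ Metric.ball 0 R ∧
      (∀ x ∈ ψ.source, ∀ u v, η (ψ x) (fderiv ℝ ψ x u) (fderiv ℝ ψ x v) = η 0 u v) ∧
      ∃ r > 0, Metric.ball 0 r ⊆ ψ.source ∧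
        ∀ i, ∀ x ∈ Metric.ball (0 : W) r, ψ (D i x) = D i (ψ x) := by
  obtain ⟨Γ, hΓ0, hΓs, hΓ, hΓc, hΓz, hΓd⟩ := exists_moser_curves hη hR he
  set sol : W → C(I, W) := fun x => Γ.symm (constCLM W x) with hsol
  set P : Set W := constCLM W ⁻¹' Γ.target with hP
  have hPo : IsOpen P := Γ.open_target.preimage (constCLM W).continuous
  have h0P : (0 : W) ∈ P := by
    rw [hP, mem_preimage, map_zero, ← hΓz]
    exact Γ.map_source hΓ0
  have hsolc : ContDiffOn ℝ ∞ sol P :=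
    hΓc.comp (constCLM W).contDiff.contDiffOn fun x hx => hx
  have hsol0 : sol 0 = 0 := by
    simp only [hsol, map_zero]
    conv_lhs => rw [← hΓz]
    exact Γ.left_inv hΓ0
  have hsold : HasFDerivAt sol (constCLM W) 0 := by
    have : HasFDerivAt Γ.symm (ContinuousLinearMap.id ℝ C(I, W)) (constCLM W 0) := by
      rw [map_zero]; exact hΓd
    exact this.comp (0 : W) (constCLM W).hasFDerivAt
  have hmem : ∀ x ∈ P, sol x ∈ moserCurves η R := fun x hx => hΓs (Γ.map_target hx)
  have hfix : ∀ x ∈ P, moserOperator η (sol x) = constCLM W x := fun x hx => by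
    rw [← hΓ]; exact Γ.right_inv hx
  set ev : C(I, W) →L[ℝ] W := ContinuousMap.evalCLM ℝ (1 : I) with hev
  set ψ₀ : W → W := fun x => sol x 1 with hψ₀
  have hψc : ContDiffOn ℝ ∞ ψ₀ P :=
    ev.contDiff.comp_contDiffOn hsolc
  have hψd : HasFDerivAt ψ₀ ((ContinuousLinearEquiv.refl ℝ W : W ≃L[ℝ] W) : W →L[ℝ] W) 0 :=
    ev.hasFDerivAt.comp (0 : W) hsold
  have hform : ∀ x ∈ P, ∀ u v, η (ψ₀ x) (fderiv ℝ ψ₀ x u) (fderiv ℝ ψ₀ x v) = η 0 u v := by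
    intro x hx u v
    have hα := hmem x hx
    have hsx : HasFDerivAt sol (fderiv ℝ sol x) x :=
      ((hsolc.differentiableOn (by simp)).differentiableAt (hPo.mem_nhds hx)).hasFDerivAt
    have hψx : fderiv ℝ ψ₀ x = ev.comp (fderiv ℝ sol x) :=
      (ev.hasFDerivAt.comp x hsx).fderiv
    have hsolx : sol x = constCLM W x +
        primitive W (superposition (moserField η) (graphI (sol x))) := by
      rw [← hfix x hx]; simp [moserOperator]
    have hvar : ∀ w, fderiv ℝ sol x w = constCLM W w + primitive W
        (pointwiseApply I (ℝ × W) W (superposition (fderiv ℝ (moserField η)) (graphI (sol x)))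
          ((ContinuousLinearMap.inr ℝ ℝ W).compLeftContinuous ℝ I (fderiv ℝ sol x w))) := by
      intro w
      have e1 := (hasFDerivAt_moserOperator hη hα).comp x hsx
      have e2 : HasFDerivAt (moserOperator η ∘ sol) (constCLM W) x :=
        (constCLM W).hasFDerivAt.congr_of_eventuallyEq
          (Filter.eventually_of_mem (hPo.mem_nhds hx) hfix)
      have e3 := congrArg (fun L => L w) (e1.unique e2)
      simp only [ContinuousLinearMap.comp_apply, _root_.sub_apply,
        ContinuousLinearMap.id_apply] at e3
      rw [← e3]
      abel
    have hder : ∀ (x₀ : W) (γ : C(I, W)) (t : ℝ) (ht : t ∈ Icc (0 : ℝ) 1),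
        HasDerivWithinAt (extendI (constCLM W x₀ + primitive W γ)) (γ ⟨t, ht⟩) (Icc 0 1) t := by
      intro x₀ γ t ht
      exact (hasDerivWithinAt_extendI_primitive γ ht).const_add x₀
    have hU : ∀ w, ∀ s ∈ Icc (0 : ℝ) 1, HasDerivWithinAt (extendI (fderiv ℝ sol x w))
        (fderiv ℝ (moserField η) (s, extendI (sol x) s) (0, extendI (fderiv ℝ sol x w) s))
        (Icc 0 1) s := by
      intro w s hs
      have := hder w (pointwiseApply I (ℝ × W) W
        (superposition (fderiv ℝ (moserField η)) (graphI (sol x)))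
        ((ContinuousLinearMap.inr ℝ ℝ W).compLeftContinuous ℝ I (fderiv ℝ sol x w))) s hs
      rw [← hvar w] at this
      refine this.congr_deriv ?_
      rw [pointwiseApply_apply, superposition_fderiv_moserField hη hα, extendI_apply _ hs,
        extendI_apply _ hs]
      rfl
    have key := formSegment_constant_along_moser hη hskew hclosed (c := extendI (sol x))
      (U₁ := extendI (fderiv ℝ sol x u)) (U₂ := extendI (fderiv ℝ sol x v))
      (fun s hs => by rw [extendI_apply _ hs]; exact hα ⟨s, hs⟩)
      (fun s hs => by
        have := hder x (superposition (moserField η) (graphI (sol x))) s hs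
        rw [← hsolx] at this
        refine this.congr_deriv ?_
        rw [superposition_apply (contDiffOn_moserField hη).continuousOn hα, extendI_apply _ hs]
        rfl)
      (hU u) (hU v)
    have h1 : ∀ γ : C(I, W), extendI γ 1 = γ 1 := fun γ => extendI_coe γ 1
    have h0 : ∀ γ : C(I, W), extendI γ 0 = γ 0 := fun γ => extendI_coe γ 0
    have hU0 : ∀ w, fderiv ℝ sol x w 0 = w := by
      intro w
      rw [hvar w, ContinuousMap.add_apply, primitive_apply]
      simp
    rw [h1, h1, h1, h0, h0, hU0, hU0] at key
    rw [hψx]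
    exact key
  obtain ⟨ψ, h1, h2, h3, h4⟩ := exists_smooth_localInverse hPo hψc h0P hψd
  have hψe : (ψ : W → W) = ψ₀ := funext h3
  refine ⟨ψ, ?_, ?_, h4, ?_, ?_, ?_⟩
  · rw [h3, hψ₀]; simp [hsol0]
  · rw [hψe]; exact hψc.mono h2
  · intro y hy
    have := hmem _ (h2 (ψ.map_target hy)) 1
    have h5 := mem_ball_of_mem_moserDomain this
    have h6 : y = sol (ψ.symm y) 1 := by
      have := ψ.right_inv hy
      rw [h3] at this
      exact this.symm
    rw [h6]
    exact h5
  · intro x hx u v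
    rw [hψe]
    exact hform x (h2 hx) u v
  · obtain ⟨ε, hε, hεs⟩ := Metric.isOpen_iff.1 Γ.open_source 0 hΓ0
    have hcont : ContinuousAt sol 0 := hsold.continuousAt
    have hn : ψ.source ∩ sol ⁻¹' Metric.ball 0 ε ∈ 𝓝 (0 : W) :=
      Filter.inter_mem (ψ.open_source.mem_nhds h1)
        (hcont.preimage_mem_nhds (by rw [hsol0]; exact Metric.ball_mem_nhds _ hε))
    obtain ⟨r, hr, hrs⟩ := Metric.mem_nhds_iff.1 hn
    refine ⟨r, hr, fun x hx => (hrs hx).1, fun i x hx => ?_⟩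
    have hxP := h2 (hrs hx).1
    have hα := hmem x hxP
    rw [h3, h3]
    have hin : ((D i : W →L[ℝ] W).compLeftContinuous ℝ I (sol x)) ∈ Γ.source := by
      apply hεs
      rw [mem_ball_zero_iff]
      refine lt_of_le_of_lt ?_ (mem_ball_zero_iff.1 (hrs hx).2)
      rw [ContinuousMap.norm_le _ (norm_nonneg _)]
      intro t
      exact ((D i).norm_map _).le.trans ((sol x).norm_coe_le_norm t)
    have hG : Γ ((D i : W →L[ℝ] W).compLeftContinuous ℝ I (sol x)) = constCLM W (D i x) := by
      rw [hΓ, moserOperator_equivariant (hD i) hη hα, hfix x hxP]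
      rfl
    have : sol (D i x) = (D i : W →L[ℝ] W).compLeftContinuous ℝ I (sol x) := by
      rw [hsol]
      simp only
      rw [← hG]
      exact Γ.left_inv hin
    simp only [hψ₀, this]
    rfl

end Moser

section SkewPairs

/-- Two commuting skew-adjoint operators, the first of which is injective, can be brought
simultaneously to a normal form in an orthonormal basis. -/
lemma exists_orthonormal_pairs (m : ℕ) : ∀ (E : Type) [NormedAddCommGroup E]
    [InnerProductSpace ℝ E] [FiniteDimensional ℝ E] (B L : E →ₗ[ℝ] E),
    Module.finrank ℝ E = 2 * m →
    (∀ x y, inner ℝ (B x) y = - inner ℝ x (B y)) → (∀ x y, inner ℝ (L x) y = - inner ℝ x (L y)) →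
    (∀ x, B (L x) = L (B x)) → Function.Injective B →
    ∃ (u v : Fin m → E) (α β : Fin m → ℝ), (∀ j, 0 < β j) ∧
      (∀ j, B (u j) = β j • v j) ∧ (∀ j, B (v j) = -(β j • u j)) ∧
      (∀ j, L (u j) = α j • v j) ∧ (∀ j, L (v j) = -(α j • u j)) ∧
      (∀ i j, inner ℝ (u i) (u j) = if i = j then (1 : ℝ) else 0) ∧
      (∀ i j, inner ℝ (v i) (v j) = if i = j then (1 : ℝ) else 0) ∧
      (∀ i j, inner ℝ (u i) (v j) = (0 : ℝ)) := by
  induction m with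
  | zero =>
    intro E _ _ _ B L _ _ _ _ _
    exact ⟨Fin.elim0, Fin.elim0, Fin.elim0, Fin.elim0, fun j => j.elim0, fun j => j.elim0,
      fun j => j.elim0, fun j => j.elim0, fun j => j.elim0, fun j => j.elim0, fun j => j.elim0,
      fun j => j.elim0⟩
  | succ m ih =>
    intro E _ _ _ B L hdim hB hL hBL hinj
    have hnt : Nontrivial E := Module.nontrivial_of_finrank_pos (R := ℝ) (by omega)
    have hs1 : (B ∘ₗ B).IsSymmetric := fun x y => by
      change inner ℝ (B (B x)) y = inner ℝ x (B (B y))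
      rw [hB, hB, neg_neg]
    have hs2 : (L ∘ₗ B).IsSymmetric := fun x y => by
      change inner ℝ (L (B x)) y = inner ℝ x (L (B y))
      rw [hL, hB, neg_neg, hBL]
    have hcomm : Commute (B ∘ₗ B) (L ∘ₗ B) := by
      ext x
      simp [hBL]
    obtain ⟨w, hw, lam, mu, hw1, hw2⟩ : ∃ w : E, w ≠ 0 ∧ ∃ lam mu : ℝ, B (B w) = lam • w ∧
        L (B w) = mu • w := by
      by_contra hcon
      push Not at hcon
      have htop := hs1.iSup_iSup_eigenspace_inf_eigenspace_eq_top_of_commute hs2 hcomm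
      have hbot : (⨆ α, ⨆ γ, Module.End.eigenspace (B ∘ₗ B) α ⊓
          Module.End.eigenspace (L ∘ₗ B) γ) = ⊥ := by
        simp only [iSup_eq_bot]
        intro α γ
        rw [Submodule.eq_bot_iff]
        rintro x ⟨hx1, hx2⟩
        by_contra hx
        exact hcon x hx α γ (Module.End.mem_eigenspace_iff.1 hx1)
          (Module.End.mem_eigenspace_iff.1 hx2)
      exact bot_ne_top (hbot.symm.trans htop)
    set u : E := (‖w‖⁻¹ : ℝ) • w with hu
    have hun : inner ℝ u u = (1 : ℝ) := by
      rw [real_inner_self_eq_norm_sq, hu, norm_smul, norm_inv, norm_norm,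
        inv_mul_cancel₀ (norm_ne_zero_iff.2 hw), one_pow]
    have hu1 : B (B u) = lam • u := by rw [hu, map_smul, map_smul, hw1, smul_comm]
    have hu2 : L (B u) = mu • u := by rw [hu, map_smul, map_smul, hw2, smul_comm]
    clear_value u
    have hlam : inner ℝ (B u) (B u) = - lam := by
      have := hB (B u) u
      rw [hu1, inner_smul_left, hun, conj_trivial, mul_one] at this
      linarith
    have hBu : B u ≠ 0 := fun h => by
      have h0 : u = 0 := hinj (by rw [h, map_zero])
      rw [h0, inner_zero_left] at hun
      exact zero_ne_one hun
    have hlam_neg : 0 < - lam := by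
      rw [← hlam]
      exact real_inner_self_pos.2 hBu
    set b : ℝ := Real.sqrt (-lam) with hb
    have hb0 : 0 < b := Real.sqrt_pos.2 hlam_neg
    have hb2 : b * b = - lam := Real.mul_self_sqrt hlam_neg.le
    have hlam' : lam = -(b * b) := by linarith
    set v : E := b⁻¹ • B u with hv
    set a : ℝ := -(mu * b⁻¹) with ha
    have hBuv : B u = b • v := by rw [hv, smul_inv_smul₀ hb0.ne']
    have hBv : B v = -(b • u) := by
      rw [hv, map_smul, hu1, hlam', smul_smul, ← neg_smul]
      congr 1
      field_simp
    have hLv : L v = -(a • u) := by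
      rw [hv, map_smul, hu2, smul_smul, ← neg_smul, ha]
      congr 1
      ring
    have hLu : L u = a • v := by
      apply hinj
      rw [hBL, hu2, map_smul, hBv, ha, smul_neg, ← neg_smul, smul_smul]
      congr 1
      field_simp
    have hvn : inner ℝ v v = (1 : ℝ) := by
      rw [hv, inner_smul_left, inner_smul_right, hlam, ← hb2]
      simp only [conj_trivial]
      field_simp
    have huv : inner ℝ u v = (0 : ℝ) := by
      have h1 := hB u u
      rw [real_inner_comm] at h1
      rw [hv, inner_smul_right]
      have : inner ℝ u (B u) = (0 : ℝ) := by linarith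
      rw [this, mul_zero]
    have hvu : inner ℝ v u = (0 : ℝ) := by rw [real_inner_comm]; exact huv
    set S : Submodule ℝ E := Submodule.span ℝ (range ![u, v]) with hS
    have hon : Orthonormal ℝ ![u, v] := by
      rw [orthonormal_iff_ite]
      intro i j
      fin_cases i <;> fin_cases j <;> simp [hun, hvn, huv, hvu, -inner_self_eq_norm_sq_to_K]
    have hSdim : Module.finrank ℝ S = 2 := by
      rw [hS, finrank_span_eq_card hon.linearIndependent, Fintype.card_fin]
    have hKdim : Module.finrank ℝ Sᗮ = 2 * m := by
      have := S.finrank_add_finrank_orthogonal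
      omega
    have hmemK : ∀ x, x ∈ Sᗮ ↔ inner ℝ u x = (0 : ℝ) ∧ inner ℝ v x = (0 : ℝ) := by
      intro x
      constructor
      · intro hx
        exact ⟨hx u (Submodule.subset_span ⟨0, rfl⟩), hx v (Submodule.subset_span ⟨1, rfl⟩)⟩
      · rintro ⟨h1, h2⟩ y hy
        induction hy using Submodule.span_induction with
        | mem y hy =>
          obtain ⟨i, rfl⟩ := hy
          fin_cases i
          exacts [h1, h2]
        | zero => exact inner_zero_left _
        | add y z _ _ hy hz => rw [inner_add_left, hy, hz, add_zero]
        | smul c y _ hy => rw [inner_smul_left, hy, mul_zero]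
    have hBK : ∀ x ∈ Sᗮ, B x ∈ Sᗮ := by
      intro x hx
      obtain ⟨h1, h2⟩ := (hmemK x).1 hx
      refine (hmemK _).2 ⟨?_, ?_⟩
      · have := hB u x
        rw [hBuv, inner_smul_left, h2, mul_zero] at this
        linarith
      · have := hB v x
        rw [hBv, inner_neg_left, inner_smul_left, h1, mul_zero] at this
        linarith
    have hLK : ∀ x ∈ Sᗮ, L x ∈ Sᗮ := by
      intro x hx
      obtain ⟨h1, h2⟩ := (hmemK x).1 hx
      refine (hmemK _).2 ⟨?_, ?_⟩
      · have := hL u x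
        rw [hLu, inner_smul_left, h2, mul_zero] at this
        linarith
      · have := hL v x
        rw [hLv, inner_neg_left, inner_smul_left, h1, mul_zero] at this
        linarith
    obtain ⟨u', v', α', β', hβ, h1, h2, h3, h4, h5, h6, h7⟩ :=
      ih Sᗮ (B.restrict hBK) (L.restrict hLK) hKdim
        (fun x y => hB x y) (fun x y => hL x y) (fun x => Subtype.ext (hBL x))
        (fun x y hxy => Subtype.ext (hinj (congrArg Subtype.val hxy)))
    have ou : ∀ j, inner ℝ u (u' j : E) = (0 : ℝ) := fun j => ((hmemK _).1 (u' j).2).1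
    have ov : ∀ j, inner ℝ v (u' j : E) = (0 : ℝ) := fun j => ((hmemK _).1 (u' j).2).2
    have ou' : ∀ j, inner ℝ u (v' j : E) = (0 : ℝ) := fun j => ((hmemK _).1 (v' j).2).1
    have ov' : ∀ j, inner ℝ v (v' j : E) = (0 : ℝ) := fun j => ((hmemK _).1 (v' j).2).2
    refine ⟨Fin.cons u fun j => (u' j : E), Fin.cons v fun j => (v' j : E), Fin.cons a α',
      Fin.cons b β', ?_, ?_, ?_, ?_, ?_, ?_, ?_, ?_⟩
    · exact Fin.cases hb0 hβ
    · exact Fin.cases hBuv fun j => congrArg Subtype.val (h1 j)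
    · exact Fin.cases hBv fun j => congrArg Subtype.val (h2 j)
    · exact Fin.cases hLu fun j => congrArg Subtype.val (h3 j)
    · exact Fin.cases hLv fun j => congrArg Subtype.val (h4 j)
    · refine Fin.cases (Fin.cases ?_ fun j => ?_) fun i => Fin.cases ?_ fun j => ?_
      · simpa using hun
      · simpa [(Fin.succ_ne_zero j).symm] using ou j
      · simpa [real_inner_comm] using ou i
      · simpa using h5 i j
    · refine Fin.cases (Fin.cases ?_ fun j => ?_) fun i => Fin.cases ?_ fun j => ?_
      · simpa using hvn
      · simpa [(Fin.succ_ne_zero j).symm] using ov' j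
      · simpa [real_inner_comm] using ov' i
      · simpa using h6 i j
    · refine Fin.cases (Fin.cases ?_ fun j => ?_) fun i => Fin.cases ?_ fun j => ?_
      · simpa using huv
      · simpa using ou' j
      · simpa [real_inner_comm] using ov i
      · simpa using h7 i j

end SkewPairs

section MatrixDerivative

variable {l m k : Type*} [Fintype m]

/-- The matrix-valued function `P` has the entrywise derivative `P'` at `t`. -/
def HasMatrixDerivAt (P : ℝ → Matrix l m ℝ) (P' : Matrix l m ℝ) (t : ℝ) : Prop :=
  ∀ i j, HasDerivAt (fun t => P t i j) (P' i j) t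

lemma HasMatrixDerivAt.mul {P : ℝ → Matrix l m ℝ} {Q : ℝ → Matrix m k ℝ} {P' : Matrix l m ℝ}
    {Q' : Matrix m k ℝ} {t : ℝ} (hP : HasMatrixDerivAt P P' t) (hQ : HasMatrixDerivAt Q Q' t) :
    HasMatrixDerivAt (fun t => P t * Q t) (P' * Q t + P t * Q') t := by
  intro i j
  have h := HasDerivAt.fun_sum (u := Finset.univ) (fun x _ => (hP i x).mul (hQ x j))
  simpa [Matrix.mul_apply, Finset.sum_add_distrib] using h

lemma hasMatrixDerivAt_const (P : Matrix l m ℝ) (t : ℝ) : HasMatrixDerivAt (fun _ => P) 0 t :=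
  fun i j => hasDerivAt_const t (P i j)

lemma HasMatrixDerivAt.transpose {P : ℝ → Matrix l m ℝ} {P' : Matrix l m ℝ} {t : ℝ}
    (hP : HasMatrixDerivAt P P' t) : HasMatrixDerivAt (fun t => (P t)ᵀ) P'ᵀ t :=
  fun i j => hP j i

lemma HasMatrixDerivAt.unique {P : ℝ → Matrix l m ℝ} {P' P'' : Matrix l m ℝ} {t : ℝ}
    (h : HasMatrixDerivAt P P' t) (h' : HasMatrixDerivAt P P'' t) : P' = P'' := by
  ext i j
  exact (h i j).unique (h' i j)

end MatrixDerivative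

section MatrixSqrt

open scoped MatrixOrder Matrix.Norms.L2Operator

variable {ι : Type*} [Fintype ι] [DecidableEq ι]

lemma exists_symm_sqrt {G : Matrix ι ι ℝ} (hG : G.PosDef) :
    ∃ M : Matrix ι ι ℝ, Mᵀ = M ∧ M * M = G := by
  refine ⟨CFC.sqrt G, ?_, CFC.sqrt_mul_sqrt_self G hG.posSemidef.nonneg⟩
  have h : IsSelfAdjoint (CFC.sqrt G) := (CFC.sqrt_nonneg G).isSelfAdjoint
  rw [← Matrix.conjTranspose_eq_transpose_of_trivial]
  exact h

lemma eq_of_mul_self_eq {P Q : Matrix ι ι ℝ} (hP : P.PosDef) (hQ : Q.PosDef)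
    (h : P * P = Q * Q) : P = Q := by
  rw [← CFC.sqrt_unique h hP.posSemidef.nonneg, CFC.sqrt_mul_self Q hQ.posSemidef.nonneg]

end MatrixSqrt

section NormalForm

variable {n : ℕ}

/-- The block matrix of the rotations by the angles `θ j` in the planes spanned by the `j`-th and
the `(n+j)`-th basis vectors. -/
def rotationMatrix (θ : Fin n → ℝ) : Matrix (Fin n ⊕ Fin n) (Fin n ⊕ Fin n) ℝ :=
  Matrix.fromBlocks (diagonal fun j => Real.cos (θ j)) (-diagonal fun j => Real.sin (θ j))
    (diagonal fun j => Real.sin (θ j)) (diagonal fun j => Real.cos (θ j))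

/-- The infinitesimal generator of the rotations `rotationMatrix (α t)`. -/
def rotationGenerator (α : Fin n → ℝ) : Matrix (Fin n ⊕ Fin n) (Fin n ⊕ Fin n) ℝ :=
  Matrix.fromBlocks 0 (-diagonal α) (diagonal α) 0

lemma rotationMatrix_zero : rotationMatrix (fun _ : Fin n => 0) = 1 := by
  simp [rotationMatrix, ← fromBlocks_one]

lemma hasMatrixDerivAt_rotationMatrix (α : Fin n → ℝ) (t : ℝ) :
    HasMatrixDerivAt (fun t => rotationMatrix fun j => α j * t)
      (rotationGenerator α * rotationMatrix fun j => α j * t) t := by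
  have hd : ∀ j, HasDerivAt (fun t => α j * t) (α j) t := fun j => by
    simpa using (hasDerivAt_id t).const_mul (α j)
  have hc : ∀ j, HasDerivAt (fun t => Real.cos (α j * t)) (-(α j * Real.sin (α j * t))) t :=
    fun j => by simpa [mul_comm] using (hd j).cos
  have hs : ∀ j, HasDerivAt (fun t => Real.sin (α j * t)) (α j * Real.cos (α j * t)) t :=
    fun j => by simpa [mul_comm] using (hd j).sin
  have e : (rotationGenerator α * rotationMatrix fun j => α j * t) =
      fromBlocks (-diagonal fun j => α j * Real.sin (α j * t))
        (-diagonal fun j => α j * Real.cos (α j * t))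
        (diagonal fun j => α j * Real.cos (α j * t))
        (-diagonal fun j => α j * Real.sin (α j * t)) := by
    simp [rotationGenerator, rotationMatrix, fromBlocks_multiply]
  rw [e]
  rintro (i | i) (j | j) <;> by_cases hij : i = j
  all_goals first
    | (subst hij; simpa [rotationMatrix] using hc i)
    | (subst hij; simpa [rotationMatrix] using hs i)
    | (subst hij; simpa [rotationMatrix] using (hs i).fun_neg)
    | simpa [rotationMatrix, hij] using hasDerivAt_const t (0 : ℝ)

lemma integral_matrix_mul_mul {ι : Type*} [Fintype ι] {X : ℝ → Matrix ι ι ℝ}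
    (hX : ∀ i j, Continuous fun s => X s i j) (P Q : Matrix ι ι ℝ) (i j : ι) :
    ∫ s in (0 : ℝ)..1, (P * X s * Q) i j =
      (P * (Matrix.of fun k l => ∫ s in (0 : ℝ)..1, X s k l) * Q) i j := by
  simp only [Matrix.mul_apply, Matrix.of_apply, Finset.sum_mul]
  rw [intervalIntegral.integral_finsetSum fun k _ => (by fun_prop : Continuous _).intervalIntegrable
    _ _]
  refine Finset.sum_congr rfl fun k _ => ?_
  rw [intervalIntegral.integral_finsetSum fun k _ => (by fun_prop : Continuous _).intervalIntegrable
    _ _]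
  refine Finset.sum_congr rfl fun l _ => ?_
  rw [intervalIntegral.integral_mul_const, intervalIntegral.integral_const_mul]

/-- A one-parameter group of period `1` of matrices preserves a scalar product. -/
lemma exists_invariant_scalar_product {ι : Type*} [Fintype ι] [DecidableEq ι]
    {A : ℝ → Matrix ι ι ℝ}
    (hadd : ∀ s t, A (s + t) = A s * A t) (h0 : A 0 = 1) (h1 : A 1 = 1)
    (hc : ∀ i j, Continuous fun s => A s i j) :
    ∃ G : Matrix ι ι ℝ, G.PosDef ∧ ∀ t, (A t)ᵀ * G * A t = G := by
  have hX : ∀ i j, Continuous fun s => ((A s)ᵀ * A s) i j := fun i j => by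
    simp only [Matrix.mul_apply, transpose_apply]
    fun_prop
  set G : Matrix ι ι ℝ := Matrix.of fun k l => ∫ s in (0 : ℝ)..1, ((A s)ᵀ * A s) k l with hG
  refine ⟨G, ?_, fun t => ?_⟩
  · refine PosDef.of_dotProduct_mulVec_pos ?_ fun x hx => ?_
    · ext k l
      simp only [conjTranspose_apply, hG, Matrix.of_apply, star_trivial]
      refine intervalIntegral.integral_congr fun s _ => ?_
      simp only [Matrix.mul_apply, transpose_apply]
      exact Finset.sum_congr rfl fun _ _ => mul_comm _ _
    · have e := integral_matrix_mul_mul hX (Matrix.of fun (_ : ι) k => x k)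
        (Matrix.of fun k (_ : ι) => x k)
      obtain ⟨i, hi⟩ : ∃ i, x i ≠ 0 := by
        by_contra h
        push Not at h
        exact hx (funext h)
      have e1 := e i i
      have e2 : ∀ N : Matrix ι ι ℝ, ((Matrix.of fun (_ : ι) k => x k) * N *
          (Matrix.of fun k (_ : ι) => x k)) i i = x ⬝ᵥ N *ᵥ x := by
        intro N
        rw [Matrix.mul_assoc]
        rfl
      rw [e2, ← hG] at e1
      rw [star_trivial, ← e1]
      refine intervalIntegral.intervalIntegral_pos_of_pos ?_ (fun s => ?_) zero_lt_one
      · refine Continuous.intervalIntegrable ?_ _ _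
        simp only [Matrix.mul_apply (M := _ * _), Matrix.mul_apply (N := (A _)ᵀ * A _), Matrix.of_apply]
        fun_prop
      · rw [e2, ← Matrix.mulVec_mulVec, Matrix.dotProduct_mulVec, Matrix.vecMul_transpose]
        have hne : A s *ᵥ x ≠ 0 := by
          intro h
          apply hx
          have h2 : A (-s) * A s = 1 := by rw [← hadd, neg_add_cancel, h0]
          rw [← Matrix.one_mulVec x, ← h2, ← Matrix.mulVec_mulVec, h, Matrix.mulVec_zero]
        simpa using (Matrix.dotProduct_star_self_pos_iff (v := A s *ᵥ x)).2 hne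
  · ext i j
    rw [hG, ← integral_matrix_mul_mul hX]
    have e : ∀ s, (A t)ᵀ * ((A s)ᵀ * A s) * A t = (A (s + t))ᵀ * A (s + t) := by
      intro s
      rw [hadd, transpose_mul]
      simp only [Matrix.mul_assoc]
    simp only [e]
    have hper : Function.Periodic (fun s => ((A s)ᵀ * A s) i j) 1 := fun s => by
      simp only [hadd s 1, h1, Matrix.mul_one]
    have e3 : ∫ s in (0 : ℝ)..1, ((A (s + t))ᵀ * A (s + t)) i j =
        ∫ s in (0 + t)..(1 + t), ((A s)ᵀ * A s) i j :=
      intervalIntegral.integral_comp_add_right (a := 0) (b := 1)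
        (fun s => ((A s)ᵀ * A s) i j) t
    rw [e3, zero_add, add_comm 1 t, hper.intervalIntegral_add_eq t 0, zero_add, Matrix.of_apply]

/-- A circle of symplectic matrices is conjugate, in the symplectic group, to a circle of block
rotations. -/
theorem symplectic_circle_normal_form {A : ℝ → Matrix (Fin n ⊕ Fin n) (Fin n ⊕ Fin n) ℝ}
    (hadd : ∀ s t, A (s + t) = A s * A t) (h0 : A 0 = 1) (h1 : A 1 = 1)
    {L : Matrix (Fin n ⊕ Fin n) (Fin n ⊕ Fin n) ℝ} (hL : HasMatrixDerivAt A L 0)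
    (hsp : ∀ t, A t ∈ Matrix.symplecticGroup (Fin n) ℝ) :
    ∃ C ∈ Matrix.symplecticGroup (Fin n) ℝ, ∃ α : Fin n → ℝ,
      ∀ t, A t * C = C * rotationMatrix fun j => α j * t := by
  have hA : ∀ t, HasMatrixDerivAt A (A t * L) t := by
    intro t
    have e1 : HasMatrixDerivAt (fun s => A (s - t)) L t := fun i j =>
      HasDerivAt.comp_sub_const t t (by simpa using hL i j)
    have e2 := (hasMatrixDerivAt_const (A t) t).mul e1
    have e3 : (fun s => A t * A (s - t)) = A := by
      ext1 s
      rw [← hadd, add_sub_cancel]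
    rw [e3] at e2
    simpa using e2
  have hc : ∀ i j, Continuous fun s => A s i j := fun i j =>
    continuous_iff_continuousAt.2 fun t => (hA t i j).continuousAt
  obtain ⟨G, hG, hGA⟩ := exists_invariant_scalar_product hadd h0 h1 hc
  obtain ⟨M, hMt, hMM⟩ := exists_symm_sqrt hG
  have hMdet : IsUnit M.det := by
    have : IsUnit (M * M) := by rw [hMM]; exact hG.isUnit
    rw [Matrix.isUnit_iff_isUnit_det, Matrix.det_mul] at this
    exact isUnit_of_mul_isUnit_left this
  have hMi : M * M⁻¹ = 1 := Matrix.mul_nonsing_inv M hMdet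
  have hiM : M⁻¹ * M = 1 := Matrix.nonsing_inv_mul M hMdet
  have hMit : (M⁻¹)ᵀ = M⁻¹ := by rw [Matrix.transpose_nonsing_inv, hMt]
  have hLG : Lᵀ * G + G * L = 0 := by
    have e1 := ((hL.transpose.mul (hasMatrixDerivAt_const G 0)).mul hL)
    have e2 : (fun t => (A t)ᵀ * G * A t) = fun _ => G := funext hGA
    rw [e2] at e1
    have := e1.unique (hasMatrixDerivAt_const G 0)
    simpa [h0] using this
  have hLJ : Lᵀ * J (Fin n) ℝ + J (Fin n) ℝ * L = 0 := by
    have e1 := ((hL.transpose.mul (hasMatrixDerivAt_const (J (Fin n) ℝ) 0)).mul hL)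
    have e2 : (fun t => (A t)ᵀ * J (Fin n) ℝ * A t) = fun _ => J (Fin n) ℝ :=
      funext fun t => SymplecticGroup.mem_iff'.1 (hsp t)
    rw [e2] at e1
    have := e1.unique (hasMatrixDerivAt_const (J (Fin n) ℝ) 0)
    simpa [h0] using this
  set J' := M⁻¹ * J (Fin n) ℝ * M⁻¹ with hJ'
  set L' := M * L * M⁻¹ with hL'
  have hJ't : J'ᵀ = -J' := by
    rw [hJ', transpose_mul, transpose_mul, hMit, Matrix.J_transpose]
    simp [Matrix.mul_assoc]
  have hL't : L'ᵀ = -L' := by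
    have e : M⁻¹ * (Lᵀ * G + G * L) * M⁻¹ = L'ᵀ + L' := by
      rw [hL', transpose_mul, transpose_mul, hMit, hMt, ← hMM, Matrix.mul_add, Matrix.add_mul]
      congr 1
      · rw [Matrix.mul_assoc, Matrix.mul_assoc, Matrix.mul_assoc, hMi, Matrix.mul_one]
      · rw [← Matrix.mul_assoc, ← Matrix.mul_assoc, hiM, Matrix.one_mul]
    rw [hLG] at e
    simp only [Matrix.mul_zero, Matrix.zero_mul] at e
    exact eq_neg_of_add_eq_zero_left e.symm
  have hcomm : J' * L' = L' * J' := by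
    have e1 : J' * L' = M⁻¹ * (J (Fin n) ℝ * L) * M⁻¹ := by
      rw [hJ', hL']
      simp only [Matrix.mul_assoc]
      rw [← Matrix.mul_assoc M⁻¹ M, hiM, Matrix.one_mul]
    have e2 : L'ᵀ * J' = M⁻¹ * (Lᵀ * J (Fin n) ℝ) * M⁻¹ := by
      rw [hJ', hL', transpose_mul, transpose_mul, hMit, hMt]
      simp only [Matrix.mul_assoc]
      rw [← Matrix.mul_assoc M M⁻¹, hMi, Matrix.one_mul]
    have e3 : J (Fin n) ℝ * L = - (Lᵀ * J (Fin n) ℝ) := eq_neg_of_add_eq_zero_right hLJ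
    rw [e1, e3, Matrix.mul_neg, Matrix.neg_mul, ← e2, hL't, Matrix.neg_mul, neg_neg]
  have hJJ : (M * J (Fin n) ℝ * M) * J' = -1 := by
    rw [hJ']
    simp only [Matrix.mul_assoc]
    rw [← Matrix.mul_assoc M M⁻¹, hMi, Matrix.one_mul, ← Matrix.mul_assoc (J (Fin n) ℝ),
      Matrix.J_squared, Matrix.neg_mul, Matrix.one_mul, Matrix.mul_neg, hMi]
  have hadj : ∀ (N : Matrix (Fin n ⊕ Fin n) (Fin n ⊕ Fin n) ℝ), Nᵀ = -N →
      ∀ x y : EuclideanSpace ℝ (Fin n ⊕ Fin n),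
      inner ℝ (toEuclideanLin N x) y = - inner ℝ x (toEuclideanLin N y) := by
    intro N hN x y
    rw [EuclideanSpace.inner_eq_star_dotProduct, EuclideanSpace.inner_eq_star_dotProduct,
      star_trivial, star_trivial]
    simp only [Matrix.ofLp_toLpLin, Matrix.toLin'_apply]
    rw [Matrix.dotProduct_mulVec, ← Matrix.mulVec_transpose, hN, Matrix.neg_mulVec,
      neg_dotProduct]
  obtain ⟨u, v, α, β, hβ, hBu, hBv, hLu, hLv, huu, hvv, huv⟩ :=
    exists_orthonormal_pairs n (EuclideanSpace ℝ (Fin n ⊕ Fin n)) (toEuclideanLin J')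
      (toEuclideanLin L') (by simp [two_mul]) (hadj J' hJ't) (hadj L' hL't)
      (fun x => by
        have h := congrArg (fun N => WithLp.toLp 2 (N *ᵥ x.ofLp)) hcomm
        simpa [Matrix.toLpLin_apply] using h)
      (fun x y hxy => by
        have h := congrArg (fun z : EuclideanSpace ℝ (Fin n ⊕ Fin n) =>
          (M * J (Fin n) ℝ * M) *ᵥ z.ofLp) hxy
        simp only [Matrix.ofLp_toLpLin, Matrix.toLin'_apply, Matrix.mulVec_mulVec, hJJ,
          Matrix.neg_mulVec, Matrix.one_mulVec, neg_inj] at h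
        exact WithLp.ofLp_injective 2 h)
  set w : Fin n ⊕ Fin n → EuclideanSpace ℝ (Fin n ⊕ Fin n) :=
    Sum.elim (fun j => (Real.sqrt (β j))⁻¹ • u j) (fun j => (Real.sqrt (β j))⁻¹ • v j) with hw
  set X : Matrix (Fin n ⊕ Fin n) (Fin n ⊕ Fin n) ℝ := Matrix.of fun i q => w q i with hX
  have hmulX : ∀ (N : Matrix (Fin n ⊕ Fin n) (Fin n ⊕ Fin n) ℝ) i q,
      (N * X) i q = (toEuclideanLin N (w q)) i := fun N i q => by
    simp only [Matrix.ofLp_toLpLin, Matrix.toLin'_apply]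
    rfl
  have hβ' : ∀ j, (Real.sqrt (β j))⁻¹ * (β j * (Real.sqrt (β j))⁻¹) = 1 := fun j => by
    have h1 := Real.sqrt_pos.2 (hβ j)
    have h2 := Real.mul_self_sqrt (hβ j).le
    field_simp
    nlinarith
  have hvu : ∀ i j, inner ℝ (v i) (u j) = (0 : ℝ) := fun i j => by
    rw [real_inner_comm]; exact huv j i
  have hXJ : Xᵀ * J' * X = J (Fin n) ℝ := by
    have e : ∀ p q, (Xᵀ * J' * X) p q = inner ℝ (w p) (toEuclideanLin J' (w q)) := by
      intro p q
      rw [Matrix.mul_assoc, Matrix.mul_apply, EuclideanSpace.inner_eq_star_dotProduct,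
        star_trivial]
      refine Finset.sum_congr rfl fun i _ => ?_
      rw [hmulX, mul_comm]
      rfl
    ext p q
    rw [e]
    rcases p with i | i <;> rcases q with j | j
    · simp [hw, hBu, inner_smul_left, inner_smul_right, huv, J]
    · by_cases hij : i = j
      · subst hij
        simp [hw, hBv, inner_smul_left, inner_smul_right, huu, J, hβ',
          -inner_self_eq_norm_sq_to_K]
      · simp [hw, hBv, inner_smul_left, inner_smul_right, huu, J, hij]
    · by_cases hij : i = j
      · subst hij
        simp [hw, hBu, inner_smul_left, inner_smul_right, hvv, J, hβ',
          -inner_self_eq_norm_sq_to_K]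
      · simp [hw, hBu, inner_smul_left, inner_smul_right, hvv, J, hij]
    · simp [hw, hBv, inner_smul_left, inner_smul_right, hvu, J]
  have hXL : L' * X = X * rotationGenerator α := by
    ext i q
    rw [hmulX, Matrix.mul_apply, Fintype.sum_sum_type]
    rcases q with j | j
    · simp [hw, hLu, hX, rotationGenerator, diagonal_apply]
      ring
    · simp [hw, hLv, hX, rotationGenerator, diagonal_apply]
      ring
  refine ⟨M⁻¹ * X, ?_, α, fun t => ?_⟩
  · rw [SymplecticGroup.mem_iff', transpose_mul, hMit]
    refine Eq.trans ?_ hXJ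
    rw [hJ']
    simp only [Matrix.mul_assoc]
  · set C := M⁻¹ * X with hC
    have hLC : L * C = C * rotationGenerator α := by
      rw [hC, Matrix.mul_assoc, ← hXL, hL']
      simp only [← Matrix.mul_assoc]
      rw [hiM, Matrix.one_mul]
    have hN : ∀ t, HasMatrixDerivAt
        (fun t => A (-t) * (C * rotationMatrix fun j => α j * t)) 0 t := by
      intro t
      have e1 : HasMatrixDerivAt (fun t => A (-t)) (-(A (-t) * L)) t := fun i j => by
        have e : HasDerivAt (fun t => A (-t) i j) _ t := (hA (-t) i j).scomp t (hasDerivAt_neg t)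
        exact e.congr_deriv (by simp)
      have e2 := e1.mul ((hasMatrixDerivAt_const C t).mul (hasMatrixDerivAt_rotationMatrix α t))
      convert e2 using 1
      rw [Matrix.zero_mul, zero_add, ← Matrix.mul_assoc C, ← hLC, Matrix.neg_mul]
      simp only [Matrix.mul_assoc]
      exact (neg_add_cancel _).symm
    have hconst : A (-t) * (C * rotationMatrix fun j => α j * t) = C := by
      ext i j
      have := is_const_of_deriv_eq_zero (fun t => (hN t i j).differentiableAt)
        (fun t => (hN t i j).deriv) t 0
      simpa [h0, rotationMatrix_zero] using this
    calc A t * C = A t * (A (-t) * (C * rotationMatrix fun j => α j * t)) := by rw [hconst]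
      _ = C * rotationMatrix fun j => α j * t := by
        rw [← Matrix.mul_assoc, ← hadd, add_neg_cancel, h0, Matrix.one_mul]

end NormalForm

section ComplexParts

variable {n : ℕ}

/-- The complex-linear part of a real matrix acting on `ℂⁿ = ℝⁿ ⊕ iℝⁿ`. -/
def complexPart (N : Matrix (Fin n ⊕ Fin n) (Fin n ⊕ Fin n) ℝ) : Matrix (Fin n) (Fin n) ℂ :=
  Matrix.of fun i j => ⟨(N (.inl i) (.inl j) + N (.inr i) (.inr j)) / 2,
    (N (.inr i) (.inl j) - N (.inl i) (.inr j)) / 2⟩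

/-- The antilinear part of a real matrix acting on `ℂⁿ = ℝⁿ ⊕ iℝⁿ`. -/
def antilinearPart (N : Matrix (Fin n ⊕ Fin n) (Fin n ⊕ Fin n) ℝ) : Matrix (Fin n) (Fin n) ℂ :=
  Matrix.of fun i j => ⟨(N (.inl i) (.inl j) - N (.inr i) (.inr j)) / 2,
    (N (.inr i) (.inl j) + N (.inl i) (.inr j)) / 2⟩

lemma complexPart_mul (N M : Matrix (Fin n ⊕ Fin n) (Fin n ⊕ Fin n) ℝ) :
    complexPart (N * M) = complexPart N * complexPart M +
      antilinearPart N * (antilinearPart M).map star := by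
  ext i j
  apply Complex.ext <;>
  simp only [complexPart, antilinearPart, Matrix.mul_apply, Matrix.of_apply, Matrix.add_apply,
    Matrix.map_apply, Complex.re_sum, Complex.im_sum, Complex.add_re, Complex.add_im,
    Complex.mul_re, Complex.mul_im, Complex.star_def, Complex.conj_re, Complex.conj_im,
    Fintype.sum_sum_type, ← Finset.sum_add_distrib, ← Finset.sum_sub_distrib, Finset.sum_div] <;>
  exact Finset.sum_congr rfl fun k _ => by ring

lemma antilinearPart_mul (N M : Matrix (Fin n ⊕ Fin n) (Fin n ⊕ Fin n) ℝ) :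
    antilinearPart (N * M) = complexPart N * antilinearPart M +
      antilinearPart N * (complexPart M).map star := by
  ext i j
  apply Complex.ext <;>
  simp only [complexPart, antilinearPart, Matrix.mul_apply, Matrix.of_apply, Matrix.add_apply,
    Matrix.map_apply, Complex.re_sum, Complex.im_sum, Complex.add_re, Complex.add_im,
    Complex.mul_re, Complex.mul_im, Complex.star_def, Complex.conj_re, Complex.conj_im,
    Fintype.sum_sum_type, ← Finset.sum_add_distrib, ← Finset.sum_sub_distrib, Finset.sum_div] <;>
  exact Finset.sum_congr rfl fun k _ => by ring

lemma complexPart_one : complexPart (1 : Matrix (Fin n ⊕ Fin n) (Fin n ⊕ Fin n) ℝ) = 1 := by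
  ext i j
  by_cases h : i = j
  · subst h
    apply Complex.ext <;> simp [complexPart]
  · apply Complex.ext <;> simp [complexPart, Matrix.one_apply, h]

lemma complexPart_transpose (N : Matrix (Fin n ⊕ Fin n) (Fin n ⊕ Fin n) ℝ) :
    complexPart Nᵀ = (complexPart N)ᴴ := by
  ext i j
  apply Complex.ext <;> simp [complexPart, neg_div']

lemma antilinearPart_transpose (N : Matrix (Fin n ⊕ Fin n) (Fin n ⊕ Fin n) ℝ) :
    antilinearPart Nᵀ = (antilinearPart N)ᵀ := by
  ext i j
  apply Complex.ext <;> simp [antilinearPart, add_comm]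

lemma map_star_transpose (M : Matrix (Fin n) (Fin n) ℂ) : (Mᵀ).map star = Mᴴ := rfl

/-- The symplectic inverse. -/
def symplecticInv (C : Matrix (Fin n ⊕ Fin n) (Fin n ⊕ Fin n) ℝ) :
    Matrix (Fin n ⊕ Fin n) (Fin n ⊕ Fin n) ℝ := -(J (Fin n) ℝ * Cᵀ * J (Fin n) ℝ)

lemma mul_symplecticInv {C : Matrix (Fin n ⊕ Fin n) (Fin n ⊕ Fin n) ℝ}
    (hC : C ∈ Matrix.symplecticGroup (Fin n) ℝ) : C * symplecticInv C = 1 := by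
  rw [SymplecticGroup.mem_iff] at hC
  rw [symplecticInv, Matrix.mul_neg, ← Matrix.mul_assoc, ← Matrix.mul_assoc, hC, Matrix.J_squared,
    neg_neg]

lemma symplecticInv_eq_fromBlocks (C : Matrix (Fin n ⊕ Fin n) (Fin n ⊕ Fin n) ℝ) :
    symplecticInv C = fromBlocks C.toBlocks₂₂ᵀ (-C.toBlocks₁₂ᵀ) (-C.toBlocks₂₁ᵀ) C.toBlocks₁₁ᵀ := by
  conv_lhs => rw [← Matrix.fromBlocks_toBlocks C]
  simp [symplecticInv, J, fromBlocks_transpose, fromBlocks_multiply, fromBlocks_neg]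

lemma complexPart_symplecticInv (C : Matrix (Fin n ⊕ Fin n) (Fin n ⊕ Fin n) ℝ) :
    complexPart (symplecticInv C) = (complexPart C)ᴴ := by
  rw [symplecticInv_eq_fromBlocks]
  ext i j
  apply Complex.ext <;> simp [complexPart, toBlocks₁₁, toBlocks₁₂, toBlocks₂₁, toBlocks₂₂] <;> ring

lemma antilinearPart_symplecticInv (C : Matrix (Fin n ⊕ Fin n) (Fin n ⊕ Fin n) ℝ) :
    antilinearPart (symplecticInv C) = -(antilinearPart C)ᵀ := by
  rw [symplecticInv_eq_fromBlocks]
  ext i j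
  apply Complex.ext <;>
    simp [antilinearPart, toBlocks₁₁, toBlocks₁₂, toBlocks₂₁, toBlocks₂₂] <;> ring

lemma complexPart_rotationMatrix (θ : Fin n → ℝ) :
    complexPart (rotationMatrix θ) = diagonal fun j => Complex.exp (θ j * Complex.I) := by
  ext i j
  by_cases h : i = j
  · subst h
    apply Complex.ext <;> simp [complexPart, rotationMatrix, Complex.exp_ofReal_mul_I_re,
      Complex.exp_ofReal_mul_I_im]
  · apply Complex.ext <;> simp [complexPart, rotationMatrix, h]

lemma antilinearPart_rotationMatrix (θ : Fin n → ℝ) :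
    antilinearPart (rotationMatrix θ) = 0 := by
  ext i j
  by_cases h : i = j
  · subst h
    apply Complex.ext <;> simp [antilinearPart, rotationMatrix]
  · apply Complex.ext <;> simp [antilinearPart, rotationMatrix, h]

/-- The complex-linear part of a block rotation in another symplectic basis. -/
lemma complexPart_conj_rotationMatrix (C : Matrix (Fin n ⊕ Fin n) (Fin n ⊕ Fin n) ℝ)
    (θ : Fin n → ℝ) :
    complexPart (C * rotationMatrix θ * symplecticInv C) =
      complexPart C * (diagonal fun j => Complex.exp (θ j * Complex.I)) * (complexPart C)ᴴ -
      antilinearPart C * (diagonal fun j => star (Complex.exp (θ j * Complex.I))) *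
        (antilinearPart C)ᴴ := by
  rw [complexPart_mul, complexPart_mul, antilinearPart_mul, complexPart_symplecticInv,
    antilinearPart_symplecticInv, complexPart_rotationMatrix, antilinearPart_rotationMatrix]
  have h1 : (-(antilinearPart C)ᵀ).map star = -(antilinearPart C)ᴴ := by
    ext i j; simp
  have h2 : (diagonal fun j => Complex.exp (θ j * Complex.I)).map star =
      diagonal fun j : Fin n => star (Complex.exp (θ j * Complex.I)) := by
    rw [Matrix.diagonal_map (star_zero ℂ)]
  rw [h1, h2]
  simp [sub_eq_add_neg]

lemma complexPart_mul_conjTranspose {C : Matrix (Fin n ⊕ Fin n) (Fin n ⊕ Fin n) ℝ}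
    (hC : C ∈ Matrix.symplecticGroup (Fin n) ℝ) :
    complexPart C * (complexPart C)ᴴ = 1 + antilinearPart C * (antilinearPart C)ᴴ := by
  have h := complexPart_mul C (symplecticInv C)
  have h1 : (-(antilinearPart C)ᵀ).map star = -(antilinearPart C)ᴴ := by
    ext i j; simp
  rw [mul_symplecticInv hC, complexPart_one, complexPart_symplecticInv,
    antilinearPart_symplecticInv, h1, Matrix.mul_neg] at h
  rw [h]
  abel

end ComplexParts

section Nonvanishing

variable {n : ℕ}

lemma norm_sq_conjTranspose_mulVec (P : Matrix (Fin n) (Fin n) ℂ) (x : Fin n → ℂ) :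
    ((‖WithLp.toLp 2 (Pᴴ *ᵥ x)‖ ^ 2 : ℝ) : ℂ) = star x ⬝ᵥ (P * Pᴴ) *ᵥ x := by
  have h := inner_self_eq_norm_sq_to_K (𝕜 := ℂ) (WithLp.toLp 2 (Pᴴ *ᵥ x))
  rw [EuclideanSpace.inner_eq_star_dotProduct] at h
  push_cast
  refine h.symm.trans ?_
  rw [← Matrix.mulVec_mulVec, Matrix.dotProduct_mulVec, dotProduct_comm, Matrix.star_mulVec,
    Matrix.conjTranspose_conjTranspose]

/-- If `P Pᴴ = 1 + Q Qᴴ`, then `P d Pᴴ - s Q d̄ Qᴴ` is invertible for `d` diagonal unitary and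
`s ∈ [0, 1]`. -/
lemma det_sub_ne_zero {P Q : Matrix (Fin n) (Fin n) ℂ} (h : P * Pᴴ = 1 + Q * Qᴴ) {d : Fin n → ℂ}
    (hd : ∀ j, ‖d j‖ = 1) {s : ℝ} (hs : s ∈ Icc (0 : ℝ) 1) :
    (P * diagonal d * Pᴴ - (s : ℂ) • (Q * (diagonal fun j => star (d j)) * Qᴴ)).det ≠ 0 := by
  have hnorm : ∀ x : Fin n → ℂ, ‖WithLp.toLp 2 (Pᴴ *ᵥ x)‖ ^ 2 =
      ‖WithLp.toLp 2 x‖ ^ 2 + ‖WithLp.toLp 2 (Qᴴ *ᵥ x)‖ ^ 2 := by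
    intro x
    have e1 := norm_sq_conjTranspose_mulVec P x
    have e2 := norm_sq_conjTranspose_mulVec Q x
    have e3 := norm_sq_conjTranspose_mulVec (1 : Matrix (Fin n) (Fin n) ℂ) x
    rw [Matrix.conjTranspose_one, Matrix.one_mul, Matrix.one_mulVec] at e3
    rw [h, Matrix.add_mulVec, dotProduct_add, ← e2, Matrix.one_mulVec, ← e3] at e1
    exact_mod_cast e1
  have hunit : IsUnit Pᴴ.det := by
    rw [isUnit_iff_ne_zero]
    intro hdet
    obtain ⟨x, hx, hPx⟩ := Matrix.exists_mulVec_eq_zero_iff.2 hdet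
    have h1 := hnorm x
    rw [hPx, WithLp.toLp_zero, norm_zero] at h1
    have h2 : 0 < ‖WithLp.toLp 2 x‖ := by
      rw [norm_pos_iff]
      intro h0
      exact hx ((WithLp.toLp_eq_zero 2).1 h0)
    nlinarith [sq_nonneg ‖WithLp.toLp 2 (Qᴴ *ᵥ x)‖]
  intro hdet
  obtain ⟨x, hx, hMx⟩ := Matrix.exists_mulVec_eq_zero_iff.2 hdet
  have hx0 : 0 < ‖WithLp.toLp 2 x‖ := by
    rw [norm_pos_iff]
    intro h0
    exact hx ((WithLp.toLp_eq_zero 2).1 h0)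
  have hdiag : ∀ (c : Fin n → ℂ), (∀ j, ‖c j‖ = 1) → ∀ z : Fin n → ℂ,
      ‖WithLp.toLp 2 (diagonal c *ᵥ z)‖ = ‖WithLp.toLp 2 z‖ := by
    intro c hc z
    rw [EuclideanSpace.norm_eq, EuclideanSpace.norm_eq]
    congr 1
    refine Finset.sum_congr rfl fun j _ => ?_
    simp [Matrix.mulVec_diagonal, hc]
  set y : Fin n → ℂ := (Pᴴ)⁻¹ *ᵥ (diagonal d *ᵥ (Pᴴ *ᵥ x)) with hy
  have hPy : Pᴴ *ᵥ y = diagonal d *ᵥ (Pᴴ *ᵥ x) := by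
    rw [hy, Matrix.mulVec_mulVec, Matrix.mul_nonsing_inv _ hunit, Matrix.one_mulVec]
  clear_value y
  rw [Matrix.sub_mulVec, sub_eq_zero] at hMx
  have e1 := congrArg (fun z => star y ⬝ᵥ z) hMx
  simp only [Matrix.smul_mulVec, dotProduct_smul, ← Matrix.mulVec_mulVec] at e1
  rw [← hPy, Matrix.dotProduct_mulVec, Matrix.dotProduct_mulVec (star y) Q] at e1
  have hst : ∀ R : Matrix (Fin n) (Fin n) ℂ, star y ᵥ* R = star (Rᴴ *ᵥ y) := fun R => by
    rw [Matrix.star_mulVec, Matrix.conjTranspose_conjTranspose]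
  rw [hst, hst] at e1
  have hin : ∀ a b : Fin n → ℂ, star a ⬝ᵥ b = inner ℂ (WithLp.toLp 2 a) (WithLp.toLp 2 b) := by
    intro a b
    rw [EuclideanSpace.inner_eq_star_dotProduct, dotProduct_comm]
  rw [hin, hin] at e1
  have e2 := congrArg norm e1
  rw [inner_self_eq_norm_sq_to_K, norm_pow, norm_smul, Complex.norm_real,
    Real.norm_of_nonneg hs.1] at e2
  have e2' : ‖WithLp.toLp 2 (Pᴴ *ᵥ y)‖ ^ 2 ≤
      ‖WithLp.toLp 2 (Qᴴ *ᵥ y)‖ * ‖WithLp.toLp 2 (Qᴴ *ᵥ x)‖ := by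
    have e4 := norm_inner_le_norm (𝕜 := ℂ) (WithLp.toLp 2 (Qᴴ *ᵥ y))
      (WithLp.toLp 2 ((diagonal fun j => star (d j)) *ᵥ (Qᴴ *ᵥ x)))
    rw [hdiag _ (fun j => by rw [norm_star, hd])] at e4
    have e5 : ‖((‖WithLp.toLp 2 (Pᴴ *ᵥ y)‖ : ℝ) : ℂ)‖ = ‖WithLp.toLp 2 (Pᴴ *ᵥ y)‖ := by simp
    calc ‖WithLp.toLp 2 (Pᴴ *ᵥ y)‖ ^ 2 = s * ‖inner ℂ (WithLp.toLp 2 (Qᴴ *ᵥ y))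
          (WithLp.toLp 2 ((diagonal fun j => star (d j)) *ᵥ (Qᴴ *ᵥ x)))‖ := by
            rw [← e2]; exact congrArg (· ^ 2) e5.symm
      _ ≤ 1 * ‖inner ℂ (WithLp.toLp 2 (Qᴴ *ᵥ y))
          (WithLp.toLp 2 ((diagonal fun j => star (d j)) *ᵥ (Qᴴ *ᵥ x)))‖ := by
            gcongr
            exact hs.2
      _ ≤ _ := by rw [one_mul]; exact e4
  have e6 : ‖WithLp.toLp 2 (Pᴴ *ᵥ y)‖ = ‖WithLp.toLp 2 (Pᴴ *ᵥ x)‖ := by rw [hPy, hdiag d hd]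
  have hnx := hnorm x
  have hny := hnorm y
  rw [e6] at e2' hny
  set p := ‖WithLp.toLp 2 (Pᴴ *ᵥ x)‖
  set q := ‖WithLp.toLp 2 (Qᴴ *ᵥ x)‖
  set q' := ‖WithLp.toLp 2 (Qᴴ *ᵥ y)‖
  nlinarith [sq_nonneg (q - q'), sq_nonneg ‖WithLp.toLp 2 y‖, pow_pos hx0 2]

end Nonvanishing

section ContinuousLog

/-- A homotopy of loops in `ℂ \ {0}`: the ratio of the end loops has a continuous periodic
logarithm. -/
lemma exists_log_of_homotopy {g : ℝ → ℝ → ℂ}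
    (hg : ContinuousOn (Function.uncurry g) (Icc 0 1 ×ˢ Icc 0 1))
    (hne : ∀ s ∈ Icc (0 : ℝ) 1, ∀ t ∈ Icc (0 : ℝ) 1, g s t ≠ 0)
    (hper : ∀ s ∈ Icc (0 : ℝ) 1, g s 0 = g s 1) :
    ∃ l : ℝ → ℂ, ContinuousOn l (Icc 0 1) ∧ l 0 = l 1 ∧
      ∀ t ∈ Icc (0 : ℝ) 1, g 1 t = Complex.exp (l t) * g 0 t := by
  set S : Set (ℝ × ℝ) := Icc 0 1 ×ˢ Icc 0 1 with hS
  have hSc : IsCompact S := isCompact_Icc.prod isCompact_Icc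
  have hSne : S.Nonempty := ⟨(0, 0), by simp [hS]⟩
  obtain ⟨p₀, hp₀, hmin⟩ := hSc.exists_isMinOn hSne hg.norm
  set m := ‖Function.uncurry g p₀‖ with hm
  have hm0 : 0 < m := norm_pos_iff.2 (hne _ hp₀.1 _ hp₀.2)
  have hlow : ∀ s ∈ Icc (0 : ℝ) 1, ∀ t ∈ Icc (0 : ℝ) 1, m ≤ ‖g s t‖ := fun s hs t ht =>
    hmin (show (s, t) ∈ S from ⟨hs, ht⟩)
  obtain ⟨δ, hδ, hclose⟩ := Metric.uniformContinuousOn_iff.1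
    (hSc.uniformContinuousOn_of_continuous hg) m hm0
  obtain ⟨N, hN⟩ := exists_nat_one_div_lt hδ
  have hN0 : (0 : ℝ) < (N + 1 : ℕ) := by positivity
  have key : ∀ k : ℕ, k ≤ N + 1 → ∃ l : ℝ → ℂ, ContinuousOn l (Icc 0 1) ∧ l 0 = l 1 ∧
      ∀ t ∈ Icc (0 : ℝ) 1, g (k / (N + 1 : ℕ)) t = Complex.exp (l t) * g 0 t := by
    intro k
    induction k with
    | zero => exact fun _ => ⟨fun _ => 0, continuousOn_const, rfl, fun t _ => by simp⟩
    | succ k ih =>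
      intro hk
      obtain ⟨l, hl, hl0, hlt⟩ := ih (by omega)
      have hs : ∀ j : ℕ, j ≤ N + 1 → (j / (N + 1 : ℕ) : ℝ) ∈ Icc (0 : ℝ) 1 := fun j hj =>
        ⟨by positivity, (div_le_one hN0).2 (by exact_mod_cast hj)⟩
      have h1 := hs k (by omega)
      have h2 := hs (k + 1) hk
      set r : ℝ → ℂ := fun t => g ((k + 1 : ℕ) / (N + 1 : ℕ)) t / g (k / (N + 1 : ℕ)) t with hr
      have hcg : ∀ s ∈ Icc (0 : ℝ) 1, ContinuousOn (g s) (Icc 0 1) := fun s hs =>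
        hg.comp (f := fun t => (s, t)) (by fun_prop) fun t ht => ⟨hs, ht⟩
      have hrc : ContinuousOn r (Icc 0 1) := (hcg _ h2).div (hcg _ h1) fun t ht => hne _ h1 t ht
      have hslit : ∀ t ∈ Icc (0 : ℝ) 1, r t ∈ Complex.slitPlane := by
        intro t ht
        have hd := hclose (((k + 1 : ℕ) : ℝ) / (N + 1 : ℕ), t) ⟨h2, ht⟩ ((k : ℝ) / (N + 1 : ℕ), t)
          ⟨h1, ht⟩ (by
            rw [Prod.dist_eq, dist_self, max_eq_left dist_nonneg, Real.dist_eq, ← sub_div]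
            push_cast
            rw [add_sub_cancel_left, abs_of_pos (by positivity)]
            exact hN)
        rw [dist_eq_norm] at hd
        have hlt : ‖r t - 1‖ < 1 := by
          rw [hr]
          simp only
          rw [div_sub_one (hne _ h1 t ht), norm_div, div_lt_one (norm_pos_iff.2 (hne _ h1 t ht))]
          exact hd.trans_le (hlow _ h1 t ht)
        left
        have := (Complex.abs_re_le_norm (r t - 1)).trans_lt hlt
        rw [abs_lt, Complex.sub_re, Complex.one_re] at this
        linarith [this.1]
      refine ⟨fun t => l t + Complex.log (r t), hl.add (hrc.clog hslit), ?_, fun t ht => ?_⟩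
      · simp only [hl0, hr, hper _ h1, hper _ h2]
      · rw [Complex.exp_add, Complex.exp_log (Complex.slitPlane_ne_zero (hslit t ht)), mul_right_comm,
          ← hlt t ht, hr]
        simp only
        rw [mul_div_cancel₀ _ (hne _ h1 t ht)]
  obtain ⟨l, h1, h2, h3⟩ := key (N + 1) le_rfl
  refine ⟨l, h1, h2, fun t ht => ?_⟩
  rw [← h3 t ht, div_self hN0.ne']

end ContinuousLog

section Polar

open scoped ComplexOrder

variable {n : ℕ}

lemma symplectic_polar {A P U : Matrix (Fin n ⊕ Fin n) (Fin n ⊕ Fin n) ℝ}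
    (hA : A ∈ Matrix.symplecticGroup (Fin n) ℝ) (hP : P.PosDef)
    (hU : U ∈ Matrix.orthogonalGroup (Fin n ⊕ Fin n) ℝ) (h : A = P * U) :
    U * J (Fin n) ℝ = J (Fin n) ℝ * U := by
  set j := J (Fin n) ℝ with hj
  have hjj : j * j = -1 := Matrix.J_squared _ _
  have hjt : jᵀ = -j := Matrix.J_transpose _ _
  have hPt : Pᵀ = P := by simpa [Matrix.IsHermitian] using hP.1
  have hUU : U * Uᵀ = 1 := by
    have := (Matrix.mem_orthogonalGroup_iff ..).1 hU
    simpa [Matrix.star_eq_conjTranspose] using this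
  have hUU' : Uᵀ * U = 1 := mul_eq_one_comm.1 hUU
  have hdet : IsUnit P.det := isUnit_iff_ne_zero.2 hP.det_pos.ne'
  have hA1 : A * j * Aᵀ = j := SymplecticGroup.mem_iff.1 hA
  have hA2 : Aᵀ * j * A = j := SymplecticGroup.mem_iff'.1 hA
  have hS : P * P = A * Aᵀ := by
    rw [h, Matrix.transpose_mul, hPt, Matrix.mul_assoc, ← Matrix.mul_assoc U, hUU, Matrix.one_mul]
  have hSJ : (P * P) * j * (P * P) = j := by
    rw [hS]
    calc A * Aᵀ * j * (A * Aᵀ) = A * (Aᵀ * j * A) * Aᵀ := by simp only [Matrix.mul_assoc]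
      _ = j := by rw [hA2, hA1]
  have hinj : Function.Injective j.mulVec := by
    apply Matrix.mulVec_injective_of_isUnit
    exact IsUnit.of_mul_eq_one (-j) (by rw [Matrix.mul_neg, hjj, neg_neg])
  have hQ : (jᵀ * P⁻¹ * j).PosDef := by
    have := hP.inv.conjTranspose_mul_mul_same hinj
    simpa using this
  have hPi : P⁻¹ * P = 1 := Matrix.nonsing_inv_mul _ hdet
  have hiP : P * P⁻¹ = 1 := Matrix.mul_nonsing_inv _ hdet
  have hQQ : P * P = (jᵀ * P⁻¹ * j) * (jᵀ * P⁻¹ * j) := by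
    have e1 : j * (P * P) = -(P⁻¹ * P⁻¹ * (j * j) * j) * (-1) * (-1) := by
      calc j * (P * P) = P⁻¹ * (P⁻¹ * P) * P * (j * (P * P)) := by
            rw [hPi, Matrix.mul_one, hPi, Matrix.one_mul]
        _ = P⁻¹ * P⁻¹ * (P * P * j * (P * P)) := by simp only [Matrix.mul_assoc]
        _ = _ := by rw [hSJ, hjj]; simp
    calc P * P = -(j * j) * (P * P) := by rw [hjj]; simp
      _ = -(j * (j * (P * P))) := by rw [Matrix.neg_mul, Matrix.mul_assoc]
      _ = -(j * (P⁻¹ * P⁻¹ * j)) := by rw [e1, hjj]; simp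
      _ = _ := by
        rw [hjt]
        calc -(j * (P⁻¹ * P⁻¹ * j)) = j * P⁻¹ * (-1) * P⁻¹ * j := by simp [Matrix.mul_assoc]
          _ = _ := by rw [← hjj]; simp [Matrix.mul_assoc]
  have hPQ := eq_of_mul_self_eq hP hQ hQQ
  have hPJ : P * j * P = j := by
    calc P * j * P = jᵀ * P⁻¹ * j * j * P := by rw [← hPQ]
      _ = -(jᵀ * P⁻¹ * (j * j) * P) * (-1) := by simp [Matrix.mul_assoc]
      _ = j := by rw [hjj, hjt]; simp [Matrix.mul_assoc, hPi]
  have hUJ : U * j * Uᵀ = j := by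
    have e : P * (U * j * Uᵀ) * P = P * j * P := by
      have e3 := hA1
      rw [h, Matrix.transpose_mul, hPt] at e3
      rw [hPJ]
      refine Eq.trans ?_ e3
      simp only [Matrix.mul_assoc]
    calc U * j * Uᵀ = (P⁻¹ * P) * (U * j * Uᵀ) * (P * P⁻¹) := by rw [hPi, hiP]; simp
      _ = P⁻¹ * (P * (U * j * Uᵀ) * P) * P⁻¹ := by simp only [Matrix.mul_assoc]
      _ = (P⁻¹ * P) * j * (P * P⁻¹) := by rw [e]; simp only [Matrix.mul_assoc]
      _ = j := by rw [hPi, hiP]; simp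
  calc U * j = U * j * (Uᵀ * U) := by rw [hUU', Matrix.mul_one]
    _ = (U * j * Uᵀ) * U := by simp only [Matrix.mul_assoc]
    _ = j * U := by rw [hUJ]

lemma complexParts_of_commute {U : Matrix (Fin n ⊕ Fin n) (Fin n ⊕ Fin n) ℝ}
    (h : U * J (Fin n) ℝ = J (Fin n) ℝ * U) :
    antilinearPart U = 0 ∧ (complexPart U).det = complexDet U := by
  have h' := h
  rw [← Matrix.fromBlocks_toBlocks U] at h'
  simp only [J, Matrix.fromBlocks_multiply, Matrix.fromBlocks_inj] at h'
  obtain ⟨h1, h2, -, -⟩ := h'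
  simp only [Matrix.mul_zero, Matrix.mul_one, zero_add, Matrix.zero_mul, Matrix.neg_mul,
    Matrix.one_mul, Matrix.mul_neg, add_zero] at h1 h2
  have e1 : ∀ i j, U (.inl i) (.inr j) = -U (.inr i) (.inl j) := fun i j => congrFun₂ h1 i j
  have e2 : ∀ i j, U (.inl i) (.inl j) = U (.inr i) (.inr j) := fun i j => by
    have := congrFun₂ h2 i j
    simpa [toBlocks₁₁, toBlocks₂₂] using this
  refine ⟨?_, ?_⟩
  · ext i j
    apply Complex.ext <;> simp [antilinearPart, e1, e2]
  · rw [complexDet]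
    congr 1
    ext i j
    apply Complex.ext <;> simp [complexPart, e1, e2, toBlocks₁₁, toBlocks₂₁]

lemma complexPart_posSemidef {P : Matrix (Fin n ⊕ Fin n) (Fin n ⊕ Fin n) ℝ} (hP : P.PosDef) :
    (complexPart P).PosSemidef := by
  obtain ⟨M, hM, hMM⟩ := exists_symm_sqrt hP
  have h1 : complexPart M = (complexPart M)ᴴ := by rw [← complexPart_transpose, hM]
  have h2 : antilinearPart M = (antilinearPart M)ᵀ := by rw [← antilinearPart_transpose, hM]
  have e : complexPart P = complexPart M * (complexPart M)ᴴ +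
      antilinearPart M * (antilinearPart M)ᴴ := by
    rw [← hMM, complexPart_mul, ← h1, ← map_star_transpose, ← h2]
  rw [e]
  exact (Matrix.posSemidef_self_mul_conjTranspose _).add
    (Matrix.posSemidef_self_mul_conjTranspose _)

lemma eq_endpoints_of_exp_eq_one {φ : ℝ → ℝ} (hφ : ContinuousOn φ (Icc 0 1))
    (h : ∀ t ∈ Icc (0 : ℝ) 1, Complex.exp (φ t * Complex.I) = 1) : φ 0 = φ 1 := by
  have hpi : (2 * Real.pi : ℝ) ≠ 0 := by positivity
  have hmaps : MapsTo (fun t => φ t / (2 * Real.pi)) (Icc 0 1) (Set.range ((↑) : ℤ → ℝ)) := by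
    intro t ht
    obtain ⟨m, hm⟩ := Complex.exp_eq_one_iff.1 (h t ht)
    refine ⟨m, ?_⟩
    have := congrArg Complex.im hm
    simp at this
    simp only
    rw [this]
    field_simp
  have : DiscreteTopology (Set.range ((↑) : ℤ → ℝ)) :=
    Int.isClosedEmbedding_coe_real.isEmbedding.toHomeomorph.symm.isEmbedding.discreteTopology
  obtain ⟨y, -, hy⟩ := (isPreconnected_Icc (a := (0 : ℝ)) (b := 1)).eqOn_const_of_mapsTo
    ⟨this⟩ (hφ.div_const (2 * Real.pi)) hmaps ⟨0, 0, by simp⟩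
  have h0 := hy (show (0 : ℝ) ∈ Icc (0 : ℝ) 1 by simp)
  have h1 := hy (show (1 : ℝ) ∈ Icc (0 : ℝ) 1 by simp)
  simp only [Function.const] at h0 h1
  rw [← h1] at h0
  field_simp at h0
  exact h0

/-- Phases of proportional complex numbers. -/
lemma exp_phase_eq_one {p q a b : ℝ} {l : ℂ} (hp : 0 < p) (hq : 0 < q)
    (h : (p : ℂ) * Complex.exp (a * Complex.I) =
      Complex.exp l * (q * Complex.exp (b * Complex.I))) :
    Complex.exp (((a - l.im - b : ℝ) : ℂ) * Complex.I) = 1 := by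
  have hn := congrArg norm h
  rw [norm_mul, norm_mul, norm_mul, Complex.norm_exp_ofReal_mul_I, Complex.norm_exp_ofReal_mul_I,
    Complex.norm_exp, Complex.norm_real, Complex.norm_real, Real.norm_of_nonneg hp.le,
    Real.norm_of_nonneg hq.le, mul_one, mul_one] at hn
  have hl : Complex.exp l = (Real.exp l.re : ℂ) * Complex.exp (l.im * Complex.I) := by
    rw [Complex.ofReal_exp, ← Complex.exp_add, Complex.re_add_im]
  rw [hl, hn] at h
  have hc : ((Real.exp l.re : ℝ) : ℂ) * (q : ℂ) ≠ 0 := by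
    rw [← Complex.ofReal_mul]
    exact_mod_cast (mul_pos (Real.exp_pos _) hq).ne'
  have h2 : Complex.exp (a * Complex.I) =
      Complex.exp (l.im * Complex.I) * Complex.exp (b * Complex.I) := by
    apply mul_left_cancel₀ hc
    rw [← Complex.ofReal_mul, h]
    push_cast
    ring
  rw [← Complex.exp_add] at h2
  have : ((a - l.im - b : ℝ) : ℂ) * Complex.I = a * Complex.I - (l.im * Complex.I + b * Complex.I) := by
    push_cast; ring
  rw [this, Complex.exp_sub, h2, div_self (Complex.exp_ne_zero _)]

/-- The weights of a symplectic circle action of Maslov index zero are integers of vanishing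
sum. -/
theorem weights_of_maslov_zero {A : ℝ → Matrix (Fin n ⊕ Fin n) (Fin n ⊕ Fin n) ℝ}
    (hm : HasMaslovIndex A 0) (h1 : A 1 = 1) {C : Matrix (Fin n ⊕ Fin n) (Fin n ⊕ Fin n) ℝ}
    (hC : C ∈ Matrix.symplecticGroup (Fin n) ℝ) {α : Fin n → ℝ}
    (hα : ∀ t, A t * C = C * rotationMatrix fun j => α j * t) :
    ∃ a : Fin n → ℤ, (∀ j, α j = 2 * Real.pi * a j) ∧ ∑ j, a j = 0 := by
  have hAC : ∀ t, A t = C * rotationMatrix (fun j => α j * t) * symplecticInv C := fun t => by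
    rw [← hα, Matrix.mul_assoc, mul_symplecticInv hC, Matrix.mul_one]
  have hrot : rotationMatrix (fun j => α j * 1) = 1 := by
    have e := hα 1
    rw [h1, Matrix.one_mul] at e
    have hi : symplecticInv C * C = 1 := mul_eq_one_comm.1 (mul_symplecticInv hC)
    calc rotationMatrix (fun j => α j * 1)
        = symplecticInv C * (C * rotationMatrix (fun j => α j * 1)) := by
          rw [← Matrix.mul_assoc, hi, Matrix.one_mul]
      _ = 1 := by rw [← e, hi]
  have hint : ∀ j, ∃ m : ℤ, α j = 2 * Real.pi * m := by
    intro j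
    have e := congrArg complexPart hrot
    rw [complexPart_rotationMatrix, complexPart_one] at e
    have e2 := congrFun₂ e j j
    rw [Matrix.diagonal_apply_eq, Matrix.one_apply_eq, mul_one] at e2
    obtain ⟨m, hm⟩ := Complex.exp_eq_one_iff.1 e2
    refine ⟨m, ?_⟩
    have := congrArg Complex.im hm
    simp at this
    rw [this]; ring
  choose a ha using hint
  refine ⟨a, ha, ?_⟩
  obtain ⟨hsp, -, -, P, U, θ, hPU, hθ, hdet, hθ01⟩ := hm
  set P' := complexPart C with hP'
  set Q' := antilinearPart C with hQ'
  have hPQ : P' * P'ᴴ = 1 + Q' * Q'ᴴ := complexPart_mul_conjTranspose hC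
  set d : ℝ → Fin n → ℂ := fun t j => Complex.exp ((α j * t : ℝ) * Complex.I) with hd
  have hdn : ∀ t j, ‖d t j‖ = 1 := fun t j => Complex.norm_exp_ofReal_mul_I _
  set g : ℝ → ℝ → ℂ := fun s t =>
    (P' * diagonal (d t) * P'ᴴ - (s : ℂ) • (Q' * (diagonal fun j => star (d t j)) * Q'ᴴ)).det
    with hg
  have hdc : Continuous d := by
    rw [hd]; fun_prop
  have hgc : Continuous (Function.uncurry g) := by
    have hd2 : Continuous fun p : ℝ × ℝ => d p.2 := hdc.comp continuous_snd
    refine Continuous.matrix_det ?_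
    refine Continuous.sub ?_ ?_
    · exact (continuous_const.matrix_mul hd2.matrix_diagonal).matrix_mul continuous_const
    · refine (Complex.continuous_ofReal.comp continuous_fst).smul ?_
      refine (continuous_const.matrix_mul ?_).matrix_mul continuous_const
      exact hd2.star.matrix_diagonal
  have hgne : ∀ s ∈ Icc (0 : ℝ) 1, ∀ t ∈ Icc (0 : ℝ) 1, g s t ≠ 0 := fun s hs t _ =>
    det_sub_ne_zero hPQ (hdn t) hs
  have hd01 : d 0 = d 1 := by
    funext j
    simp only [hd]
    rw [mul_zero, mul_one, ha j]
    symm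
    rw [Complex.ofReal_zero, zero_mul, Complex.exp_zero, Complex.exp_eq_one_iff]
    exact ⟨a j, by push_cast; ring⟩
  obtain ⟨l, hlc, hl01, hl⟩ := exists_log_of_homotopy hgc.continuousOn hgne fun s _ => by
    simp only [hg, hd01]
  have hg1 : ∀ t, g 1 t = (complexPart (A t)).det := by
    intro t
    rw [hAC t, complexPart_conj_rotationMatrix]
    simp [hg, hd, hP', hQ']
  have hdetP : P'.det ≠ 0 := by
    intro h0
    have := hgne 0 (by simp) 0 (by simp)
    simp [hg, h0] at this
  have hg0 : ∀ t, g 0 t = ((‖P'.det‖ ^ 2 : ℝ) : ℂ) *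
      Complex.exp (((∑ j, α j) * t : ℝ) * Complex.I) := by
    intro t
    simp only [hg]
    rw [Complex.ofReal_zero, zero_smul, sub_zero, Matrix.det_mul, Matrix.det_mul,
      Matrix.det_conjTranspose, Matrix.det_diagonal, ← Complex.exp_sum, mul_right_comm,
      ← Finset.sum_mul, Complex.star_def, Complex.mul_conj, Complex.normSq_eq_norm_sq,
      ← Complex.ofReal_sum, Finset.sum_mul]
  have key : ∀ t ∈ Icc (0 : ℝ) 1, Complex.exp (((2 * Real.pi * θ t - (l t).im -
      (∑ j, α j) * t : ℝ) : ℂ) * Complex.I) = 1 := by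
    intro t ht
    obtain ⟨hP, hU, hA⟩ := hPU t ht
    obtain ⟨hU1, hU2⟩ := complexParts_of_commute (symplectic_polar (hsp t ht) hP hU hA)
    have e1 : g 1 t = (complexPart (P t)).det * complexDet (U t) := by
      rw [hg1, hA, complexPart_mul, hU1, ← hU2, ← Matrix.det_mul]
      congr 1
      have : (0 : Matrix (Fin n) (Fin n) ℂ).map star = 0 := by ext; simp
      rw [this, Matrix.mul_zero, add_zero]
    have hne := hgne 1 (by simp) t ht
    have hpos := (complexPart_posSemidef hP).det_nonneg
    have hp : ∃ p : ℝ, 0 < p ∧ (complexPart (P t)).det = p := by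
      rw [Complex.le_def] at hpos
      refine ⟨(complexPart (P t)).det.re, lt_of_le_of_ne hpos.1 ?_, ?_⟩
      · intro h0
        apply hne
        rw [e1]
        have : (complexPart (P t)).det = 0 := Complex.ext h0.symm hpos.2.symm
        rw [this, zero_mul]
      · exact Complex.ext rfl hpos.2.symm
    obtain ⟨p, hp0, hp⟩ := hp
    refine exp_phase_eq_one hp0 (show 0 < ‖P'.det‖ ^ 2 from pow_pos (norm_pos_iff.2 hdetP) 2) ?_
    rw [← hg0, ← hl t ht, e1, hp, hdet t ht]
    congr 2
    push_cast
    ring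
  have hend := eq_endpoints_of_exp_eq_one (φ := fun t => 2 * Real.pi * θ t - (l t).im -
    (∑ j, α j) * t) (((continuousOn_const.mul hθ).sub
      (Complex.continuous_im.comp_continuousOn hlc)).sub (by fun_prop)) key
  simp only [hl01, mul_zero, mul_one, sub_zero] at hend
  have hθe : θ 1 = θ 0 := by
    have := hθ01
    push_cast at this
    linarith
  have hsum : ∑ j, α j = 0 := by
    rw [hθe] at hend
    linarith
  have h2 : (2 * Real.pi) * ((∑ j, a j : ℤ) : ℝ) = 0 := by
    rw [← hsum]
    push_cast
    rw [Finset.mul_sum]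
    exact Finset.sum_congr rfl fun j _ => (ha j).symm
  have h3 := (mul_eq_zero.1 h2).resolve_left (by positivity)
  exact_mod_cast h3

end Polar

section UnitaryPath

variable {W : Type*} [NormedAddCommGroup W] [InnerProductSpace ℂ W] [FiniteDimensional ℂ W]

lemma finite_spectrum_continuousLinearMap (p : W →L[ℂ] W) : (spectrum ℂ p).Finite := by
  set φ : (W →ₗ[ℂ] W) →ₐ[ℂ] (W →L[ℂ] W) :=
    AlgHom.ofLinearMap (LinearMap.toContinuousLinearMap (𝕜 := ℂ) (E := W) (F' := W)).toLinearMap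
      (by ext; rfl) (fun _ _ => by ext; rfl) with hφ
  have h : φ p.toLinearMap = p := by ext; rfl
  rw [← h]
  exact (Module.End.finite_spectrum _).subset (AlgHom.spectrum_apply_subset φ _)

lemma exists_skewAdjoint_log (p : unitary (W →L[ℂ] W)) :
    ∃ S : W →L[ℂ] W, star S = -S ∧ NormedSpace.exp S = (p : W →L[ℂ] W) := by
  have : CompleteSpace W := FiniteDimensional.complete ℂ W
  have hfin := finite_spectrum_continuousLinearMap (p : W →L[ℂ] W)
  have hcont : ∀ g : ℂ → ℂ, ContinuousOn g (spectrum ℂ (p : W →L[ℂ] W)) := fun g =>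
    hfin.continuousOn g
  have hnorm : ∀ z ∈ spectrum ℂ (p : W →L[ℂ] W), ‖z‖ = 1 := fun z hz =>
    mem_sphere_zero_iff_norm.1 (Unitary.spectrum_subset_circle p hz)
  have : IsStarNormal (p : W →L[ℂ] W) := inferInstance
  refine ⟨cfc Complex.log (p : W →L[ℂ] W), ?_, ?_⟩
  · rw [← cfc_star, ← cfc_neg]
    refine cfc_congr fun z hz => ?_
    apply Complex.ext
    · simp [Complex.log_re, hnorm z hz]
    · simp
  · rw [← CFC.complex_exp_eq_normedSpace_exp,
      ← cfc_comp' Complex.exp Complex.log _ (by fun_prop) (hcont _)]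
    conv_rhs => rw [← cfc_id ℂ (p : W →L[ℂ] W)]
    refine cfc_congr fun z hz => ?_
    have : z ≠ 0 := by
      intro h0
      have := hnorm z hz
      simp [h0] at this
    simp [Complex.exp_log this]

/-- `E` is a one-parameter group of unitary operators with generator `S`. -/
structure IsUnitaryFlow (S : W →L[ℂ] W) (E : ℝ → W →L[ℂ] W) : Prop where
  skew : ∀ x y, inner ℂ (S x) y = -inner ℂ x (S y)
  smooth : ContDiff ℝ ∞ fun p : ℝ × W => E p.1 p.2
  deriv : ∀ t x, HasDerivAt (fun t => E t x) (E t (S x)) t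
  comm : ∀ t x, E t (S x) = S (E t x)
  add : ∀ s t x, E (s + t) x = E s (E t x)
  zero : ∀ x, E 0 x = x
  inner : ∀ t x y, inner ℂ (E t x) (E t y) = inner ℂ x y

/-- A unitary operator is the time one map of a one-parameter group of unitary operators. -/
lemma exists_unitary_path (P : W ≃ₗᵢ[ℂ] W) : ∃ (S : W →L[ℂ] W) (E : ℝ → W →L[ℂ] W),
    IsUnitaryFlow S E ∧ ∀ x, E 1 x = P x := by
  have : CompleteSpace W := FiniteDimensional.complete ℂ W
  obtain ⟨S, hS, hexp⟩ := exists_skewAdjoint_log (Unitary.linearIsometryEquiv.symm P)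
  let +nondep : NormedAlgebra ℚ (W →L[ℂ] W) := .restrictScalars ℚ ℂ _
  have hskew : ∀ t : ℝ, star (t • S) = -(t • S) := fun t => by
    rw [star_smul, hS, smul_neg]; simp
  have hcomm : ∀ t : ℝ, NormedSpace.exp (t • S) * S = S * NormedSpace.exp (t • S) := fun t =>
    (((Commute.refl S).smul_left t).exp_left).eq
  refine ⟨S, fun t => NormedSpace.exp (t • S), ⟨fun x y => ?_, ?_, fun t x => ?_, fun t x => ?_,
    fun s t x => ?_, fun x => ?_, fun t x y => ?_⟩, fun x => ?_⟩
  · rw [← ContinuousLinearMap.adjoint_inner_right, ← ContinuousLinearMap.star_eq_adjoint, hS,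
      _root_.neg_apply, inner_neg_right]
  · have h1 : ContDiff ℝ ∞ fun t : ℝ => NormedSpace.exp (t • S) := by
      refine ContDiff.comp (g := NormedSpace.exp) ?_ (contDiff_id.smul contDiff_const)
      exact contDiff_iff_contDiffAt.2 fun x => (NormedSpace.exp_analytic (𝕂 := ℝ) x).contDiffAt
    have h2 := (ContinuousLinearMap.restrictScalarsL ℂ W W ℝ ℝ).contDiff.comp
      (h1.comp (contDiff_fst (E := ℝ) (F := W)))
    exact h2.clm_apply contDiff_snd
  · have h2 := (ContinuousLinearMap.restrictScalarsL ℂ W W ℝ ℝ).hasFDerivAt.comp_hasDerivAt t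
      (hasDerivAt_exp_smul_const (𝕂 := ℝ) S t)
    exact (h2.clm_apply (hasDerivAt_const t x)).congr_deriv (by simp)
  · exact congrArg (fun T : W →L[ℂ] W => T x) (hcomm t)
  · simp only [add_smul]
    rw [NormedSpace.exp_add_of_commute (((Commute.refl S).smul_left s).smul_right t)]
    rfl
  · simp
  · have h := (NormedSpace.exp_mem_unitary_of_mem_skewAdjoint
      (skewAdjoint.mem_iff.2 (hskew t))).1
    rw [← ContinuousLinearMap.adjoint_inner_right, ← ContinuousLinearMap.star_eq_adjoint]
    exact congrArg (fun T : W →L[ℂ] W => inner ℂ x (T y)) h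
  · simp only [one_smul, hexp]
    rfl

namespace IsUnitaryFlow

variable {S : W →L[ℂ] W} {E : ℝ → W →L[ℂ] W}

lemma norm (h : IsUnitaryFlow S E) (t : ℝ) (x : W) : ‖E t x‖ = ‖x‖ := by
  rw [← sq_eq_sq₀ (norm_nonneg _) (norm_nonneg _), ← inner_self_eq_norm_sq (𝕜 := ℂ), h.inner,
    inner_self_eq_norm_sq]

lemma apply_neg_apply (h : IsUnitaryFlow S E) (t : ℝ) (x : W) : E t (E (-t) x) = x := by
  rw [← h.add, add_neg_cancel, h.zero]

lemma neg_apply_apply (h : IsUnitaryFlow S E) (t : ℝ) (x : W) : E (-t) (E t x) = x := by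
  rw [← h.add, neg_add_cancel, h.zero]

lemma hasDerivAt_apply (h : IsUnitaryFlow S E) {τ : ℝ → ℝ} {c : ℝ → W} {τ' : ℝ} {c' : W} {r : ℝ}
    (hτ : HasDerivAt τ τ' r) (hc : HasDerivAt c c' r) :
    HasDerivAt (fun r => E (τ r) (c r)) (E (τ r) (c' + τ' • S (c r))) r := by
  have hG := (h.smooth.differentiable (by simp) (τ r, c r)).hasFDerivAt
  have e1 : ∀ a : ℝ, fderiv ℝ (fun p : ℝ × W => E p.1 p.2) (τ r, c r) (a, 0) =
      a • E (τ r) (S (c r)) := fun a => by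
    have h1 : HasDerivAt (fun t : ℝ => (t, c r)) ((1 : ℝ), (0 : W)) (τ r) :=
      (hasDerivAt_id _).prodMk (hasDerivAt_const _ _)
    have h2 := (HasFDerivAt.comp_hasDerivAt (l := fun p : ℝ × W => E p.1 p.2) (τ r) hG h1).unique
      (h.deriv (τ r) (c r))
    rw [← h2, ← map_smul]
    simp
  have e2 : ∀ u : W, fderiv ℝ (fun p : ℝ × W => E p.1 p.2) (τ r, c r) (0, u) = E (τ r) u :=
    fun u => by
    have h1 : HasFDerivAt (fun x : W => (τ r, x)) (ContinuousLinearMap.inr ℝ ℝ W) (c r) :=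
      (hasFDerivAt_const _ _).prodMk (hasFDerivAt_id _)
    have h2 := (hG.comp (c r) h1).unique
      (((E (τ r)).restrictScalars ℝ).hasFDerivAt (x := c r))
    exact congrArg (fun T : W →L[ℝ] W => T u) h2
  have h3 := HasFDerivAt.comp_hasDerivAt (l := fun p : ℝ × W => E p.1 p.2) (f := fun r => (τ r, c r))
    r hG (hτ.prodMk hc)
  refine h3.congr_deriv ?_
  have : (τ', c') = (τ', (0 : W)) + ((0 : ℝ), c') := by simp
  rw [this, map_add, e1, e2, map_add, ← Complex.coe_smul, ← Complex.coe_smul, map_smul]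
  exact add_comm _ _

end IsUnitaryFlow

end UnitaryPath

section StandardForm

variable (W : Type*) [NormedAddCommGroup W] [InnerProductSpace ℂ W]

/-- The standard symplectic form of a complex inner product space. -/
def stdForm : W →L[ℝ] W →L[ℝ] ℝ :=
  LinearMap.mkContinuous₂ (LinearMap.mk₂ ℝ (fun x y : W => (inner ℂ x y).im)
    (fun x x' y => by simp)
    (fun c x y => by simp [← Complex.coe_smul]; ring)
    (fun x y y' => by simp)
    (fun c x y => by simp [← Complex.coe_smul])) 1 (fun x y => by
      rw [one_mul]
      exact (Complex.abs_im_le_norm _).trans (norm_inner_le_norm x y))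

variable {W}

lemma stdForm_apply (x y : W) : stdForm W x y = (inner ℂ x y).im := rfl

lemma stdForm_skew (x y : W) : stdForm W x y = -stdForm W y x := by
  rw [stdForm_apply, stdForm_apply, ← inner_conj_symm y x, Complex.conj_im, neg_neg]

lemma stdForm_I_smul_left (x y : W) : stdForm W (Complex.I • x) y = -(inner ℂ x y).re := by
  simp [stdForm_apply]

lemma stdForm_I_smul_right (x y : W) : stdForm W x (Complex.I • y) = (inner ℂ x y).re := by
  simp [stdForm_apply]

lemma eq_zero_of_stdForm_eq_zero {x : W} (h : ∀ y, stdForm W x y = 0) : x = 0 := by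
  have := h (Complex.I • x)
  rw [stdForm_I_smul_right] at this
  rw [← norm_eq_zero, ← sq_eq_zero_iff, ← inner_self_eq_norm_sq (𝕜 := ℂ)]
  exact this

/-- The quadratic Hamiltonian of the linear vector field `S`. -/
def quadHam (S : W →L[ℂ] W) (x : W) : ℝ := (inner ℂ x (S x)).im / 2

lemma hasFDerivAt_quadHam {S : W →L[ℂ] W} (hS : ∀ x y, inner ℂ (S x) y = -inner ℂ x (S y)) (x : W) :
    HasFDerivAt (quadHam S) (-stdForm W (S x)) x := by
  have h1 : HasFDerivAt (fun x => stdForm W x (S x)) _ x :=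
    (stdForm W).isBoundedBilinearMap.hasFDerivAt (x, S x) |>.comp (f := fun x => (x, S x)) x
      ((hasFDerivAt_id x).prodMk ((S.restrictScalars ℝ).hasFDerivAt (x := x)))
  have h2 : HasFDerivAt (quadHam S) _ x := h1.mul_const (2⁻¹ : ℝ)
  refine h2.congr_fderiv ?_
  ext u
  have e : stdForm W x (S u) = -stdForm W (S x) u := by
    rw [stdForm_apply, stdForm_apply, hS, Complex.neg_im, neg_neg]
  simp
  rw [e, stdForm_skew u]
  ring

end StandardForm

section CutoffRotation

variable {W : Type*} [NormedAddCommGroup W] [InnerProductSpace ℂ W] [FiniteDimensional ℂ W]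

/-- The Hamiltonian flow of `x ↦ χ (‖x‖²) q(x)`, where `q` is the Hamiltonian of a unitary
one-parameter group `E` with generator `S`, and `χ' = χ₁`. -/
def cutoffRotation (S : W →L[ℂ] W) (E : ℝ → W →L[ℂ] W) (χ : ℝ → ℝ) (s : ℝ) (x : W) : W :=
  Complex.exp ((s * (deriv χ (‖x‖ ^ 2) * (2 * quadHam S x)) : ℝ) * Complex.I) •
    E (s * χ (‖x‖ ^ 2)) x

variable {S : W →L[ℂ] W} {E : ℝ → W →L[ℂ] W} {χ : ℝ → ℝ}

lemma norm_cutoffRotation (h : IsUnitaryFlow S E) (s : ℝ) (x : W) :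
    ‖cutoffRotation S E χ s x‖ = ‖x‖ := by
  rw [cutoffRotation, norm_smul, Complex.norm_exp_ofReal_mul_I, one_mul, h.norm]

lemma quadHam_cutoffRotation (h : IsUnitaryFlow S E) (s : ℝ) (x : W) :
    quadHam S (cutoffRotation S E χ s x) = quadHam S x := by
  rw [cutoffRotation, quadHam, quadHam, map_smul, inner_smul_left, inner_smul_right, ← h.comm,
    h.inner, ← mul_assoc, mul_comm ((starRingEnd ℂ) _), Complex.mul_conj, Complex.normSq_eq_norm_sq,
    Complex.norm_exp_ofReal_mul_I]
  simp

lemma cutoffRotation_add (h : IsUnitaryFlow S E) (s t : ℝ) (x : W) :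
    cutoffRotation S E χ (s + t) x = cutoffRotation S E χ s (cutoffRotation S E χ t x) := by
  conv_rhs => rw [cutoffRotation, norm_cutoffRotation h, quadHam_cutoffRotation h, cutoffRotation,
    map_smul, ← h.add, smul_smul, ← Complex.exp_add]
  rw [cutoffRotation, add_mul s t (χ _)]
  congr 2
  push_cast
  ring

lemma cutoffRotation_zero (h : IsUnitaryFlow S E) (x : W) : cutoffRotation S E χ 0 x = x := by
  simp [cutoffRotation, h.zero]

lemma cutoffRotation_neg (h : IsUnitaryFlow S E) (s : ℝ) (x : W) :
    cutoffRotation S E χ s (cutoffRotation S E χ (-s) x) = x := by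
  rw [← cutoffRotation_add h, add_neg_cancel, cutoffRotation_zero h]

lemma cutoffRotation_of_eventually_const (s : ℝ) {x : W} {c : ℝ}
    (h : χ =ᶠ[nhds (‖x‖ ^ 2)] fun _ => c) : cutoffRotation S E χ s x = E (s * c) x := by
  rw [cutoffRotation, h.deriv_eq, h.eq_of_nhds]
  simp

lemma contDiff_quadHam (S : W →L[ℂ] W) : ContDiff ℝ ∞ (quadHam S) := by
  have : quadHam S = fun x => stdForm W x (S.restrictScalars ℝ x) / 2 := rfl
  rw [this]
  fun_prop

lemma contDiff_norm_sq_complex : ContDiff ℝ ∞ fun x : W => ‖x‖ ^ 2 := by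
  have : (fun x : W => ‖x‖ ^ 2) = fun x => stdForm W x
      ((Complex.I • ContinuousLinearMap.id ℂ W).restrictScalars ℝ x) := by
    funext x
    change _ = stdForm W x (Complex.I • x)
    rw [stdForm_I_smul_right]
    exact (inner_self_eq_norm_sq (𝕜 := ℂ) x).symm
  rw [this]
  fun_prop

lemma contDiff_cutoffRotation (h : IsUnitaryFlow S E) (hχ : ContDiff ℝ ∞ χ) :
    ContDiff ℝ ∞ fun p : ℝ × W => cutoffRotation S E χ p.1 p.2 := by
  have hN : ContDiff ℝ ∞ fun p : ℝ × W => ‖p.2‖ ^ 2 := contDiff_norm_sq_complex.comp contDiff_snd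
  have hχ' : ContDiff ℝ ∞ (deriv χ) := (contDiff_infty_iff_deriv.1 hχ).2
  have h1 : ContDiff ℝ ∞ fun p : ℝ × W =>
      Complex.exp ((p.1 * (deriv χ (‖p.2‖ ^ 2) * (2 * quadHam S p.2)) : ℝ) * Complex.I) := by
    refine ContDiff.cexp ((Complex.ofRealCLM.contDiff.comp ?_).mul contDiff_const)
    exact contDiff_fst.mul ((hχ'.comp hN).mul
      (contDiff_const.mul ((contDiff_quadHam S).comp contDiff_snd)))
  exact h1.smul (h.smooth.comp ((contDiff_fst.mul (hχ.comp hN)).prodMk contDiff_snd))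

lemma hasDerivAt_norm_sq_line (x u : W) :
    HasDerivAt (fun r : ℝ => ‖x + r • u‖ ^ 2) (2 * (inner ℂ u x).re) 0 := by
  have hre : (inner ℂ x u).re = (inner ℂ u x).re := by
    rw [← inner_conj_symm, Complex.conj_re]
  have e : (fun r : ℝ => ‖x + r • u‖ ^ 2) =
      fun r => ‖x‖ ^ 2 + r * (2 * (inner ℂ u x).re) + r ^ 2 * ‖u‖ ^ 2 := by
    funext r
    rw [norm_add_sq (𝕜 := ℂ), norm_smul, mul_pow, Real.norm_eq_abs, sq_abs, ← Complex.coe_smul,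
      inner_smul_right]
    simp [hre]
    ring
  rw [e]
  have := (((hasDerivAt_id (0 : ℝ)).mul_const (2 * (inner ℂ u x).re)).const_add (‖x‖ ^ 2)).add
    (((hasDerivAt_id (0 : ℝ)).pow 2).mul_const (‖u‖ ^ 2))
  exact this.congr_deriv (by simp)

lemma fderiv_cutoffRotation (h : IsUnitaryFlow S E) (hχ : ContDiff ℝ ∞ χ) (s : ℝ) (x u : W) :
    fderiv ℝ (cutoffRotation S E χ s) x u =
      Complex.exp ((s * (deriv χ (‖x‖ ^ 2) * (2 * quadHam S x)) : ℝ) * Complex.I) •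
        E (s * χ (‖x‖ ^ 2)) (u +
          (s * (deriv χ (‖x‖ ^ 2) * (2 * (inner ℂ u x).re))) • S x +
          (s * (deriv (deriv χ) (‖x‖ ^ 2) * (2 * (inner ℂ u x).re) * (2 * quadHam S x) +
            deriv χ (‖x‖ ^ 2) * (2 * stdForm W u (S x)))) • (Complex.I • x)) := by
  have hχ' : ContDiff ℝ ∞ (deriv χ) := (contDiff_infty_iff_deriv.1 hχ).2
  have hR : DifferentiableAt ℝ (cutoffRotation S E χ s) x :=
    ((contDiff_cutoffRotation h hχ).comp (contDiff_prodMk_right s)).differentiable (by simp) x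
  have hl : HasDerivAt (fun r : ℝ => x + r • u) u 0 :=
    (((hasDerivAt_id (0 : ℝ)).smul_const u).const_add x).congr_deriv (by simp)
  have h0 : x + (0 : ℝ) • u = x := by simp
  have h1 : HasDerivAt (fun r : ℝ => cutoffRotation S E χ s (x + r • u))
      (fderiv ℝ (cutoffRotation S E χ s) x u) 0 :=
    HasFDerivAt.comp_hasDerivAt (l := cutoffRotation S E χ s) (f := fun r : ℝ => x + r • u) 0
      (by rw [h0]; exact hR.hasFDerivAt) hl
  have hN := hasDerivAt_norm_sq_line x u
  have hχN : HasDerivAt (fun r : ℝ => χ (‖x + r • u‖ ^ 2))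
      (deriv χ (‖x‖ ^ 2) * (2 * (inner ℂ u x).re)) 0 :=
    HasDerivAt.comp (h₂ := χ) (h := fun r : ℝ => ‖x + r • u‖ ^ 2) 0
      (by rw [h0]; exact (hχ.differentiable (by simp) _).hasDerivAt) hN
  have hχN' : HasDerivAt (fun r : ℝ => deriv χ (‖x + r • u‖ ^ 2))
      (deriv (deriv χ) (‖x‖ ^ 2) * (2 * (inner ℂ u x).re)) 0 :=
    HasDerivAt.comp (h₂ := deriv χ) (h := fun r : ℝ => ‖x + r • u‖ ^ 2) 0
      (by rw [h0]; exact (hχ'.differentiable (by simp) _).hasDerivAt) hN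
  have hq : HasDerivAt (fun r : ℝ => quadHam S (x + r • u)) (stdForm W u (S x)) 0 := by
    have := HasFDerivAt.comp_hasDerivAt (l := quadHam S) (f := fun r : ℝ => x + r • u) 0
      (by rw [h0]; exact hasFDerivAt_quadHam h.skew x) hl
    refine this.congr_deriv ?_
    rw [_root_.neg_apply, stdForm_skew u]
  have hφ : HasDerivAt
      (fun r : ℝ => s * (deriv χ (‖x + r • u‖ ^ 2) * (2 * quadHam S (x + r • u)))) _ 0 :=
    (hχN'.mul (hq.const_mul 2)).const_mul s
  have hexp : HasDerivAt (fun r : ℝ => Complex.exp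
      ((s * (deriv χ (‖x + r • u‖ ^ 2) * (2 * quadHam S (x + r • u))) : ℝ) * Complex.I)) _ 0 :=
    (hφ.ofReal_comp.mul_const Complex.I).cexp
  have hE := h.hasDerivAt_apply (hχN.const_mul s) hl
  have h2 := h1.unique (hexp.smul hE)
  rw [h2]
  simp only [h0]
  rw [map_add (E _) (u + _), smul_add]
  congr 1
  rw [← Complex.coe_smul, map_smul, map_smul, smul_smul, smul_smul]
  congr 1
  ring

theorem stdForm_fderiv_cutoffRotation (h : IsUnitaryFlow S E) (hχ : ContDiff ℝ ∞ χ) (s : ℝ)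
    (x u v : W) : stdForm W (fderiv ℝ (cutoffRotation S E χ s) x u)
      (fderiv ℝ (cutoffRotation S E χ s) x v) = stdForm W u v := by
  have hunit : ∀ (φ : ℝ) (τ : ℝ) (y z : W), stdForm W (Complex.exp (φ * Complex.I) • E τ y)
      (Complex.exp (φ * Complex.I) • E τ z) = stdForm W y z := by
    intro φ τ y z
    rw [stdForm_apply, stdForm_apply, inner_smul_left, inner_smul_right, h.inner, ← mul_assoc,
      mul_comm ((starRingEnd ℂ) _), Complex.mul_conj, Complex.normSq_eq_norm_sq,
      Complex.norm_exp_ofReal_mul_I]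
    simp
  rw [fderiv_cutoffRotation h hχ, fderiv_cutoffRotation h hχ, hunit]
  simp only [map_add, map_smul, _root_.add_apply, _root_.smul_apply, smul_eq_mul,
    stdForm_I_smul_left, stdForm_I_smul_right]
  have e1 : stdForm W (S x) v = -stdForm W v (S x) := stdForm_skew _ _
  have e2 : (inner ℂ x v).re = (inner ℂ v x).re := by
    rw [← inner_conj_symm, Complex.conj_re]
  have e3 : (inner ℂ (S x) x).re = 0 := by
    have h1 := congrArg Complex.re (h.skew x x)
    rw [Complex.neg_re, ← inner_conj_symm x (S x), Complex.conj_re] at h1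
    linarith
  have e4 : (inner ℂ x (S x)).re = 0 := by rw [← inner_conj_symm, Complex.conj_re, e3]
  have e5 : stdForm W (S x) (S x) = 0 := by
    have := stdForm_skew (S x) (S x)
    linarith
  have e6 : (inner ℂ (Complex.I • x) x).re = 0 := by
    rw [inner_smul_left, inner_self_eq_norm_sq_to_K]
    simp [← Complex.ofReal_pow]
  rw [e1, e2, e3, e4, e5, e6]
  ring

end CutoffRotation

section ModelHomotopy

variable {W : Type*} [NormedAddCommGroup W] [InnerProductSpace ℂ W] [FiniteDimensional ℂ W]

/-- A homotopy of paths of unitary operators, conjugating one of them by the flow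
`cutoffRotation`. -/
def modelHomotopy (S : W →L[ℂ] W) (E : ℝ → W →L[ℂ] W) (χ : ℝ → ℝ) (G U : ℝ → W →L[ℂ] W)
    (s t : ℝ) (y : W) : W :=
  G t (cutoffRotation S E χ s (U t (cutoffRotation S E χ (-s) y)))

/-- The Hamiltonian generating the paths `modelHomotopy`. -/
def modelHam (S : W →L[ℂ] W) (E : ℝ → W →L[ℂ] W) (χ : ℝ → ℝ) (Sg : W →L[ℂ] W)
    (G : ℝ → W →L[ℂ] W) (Sb : W →L[ℂ] W) (s t : ℝ) (y : W) : ℝ :=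
  quadHam Sg y + quadHam Sb (cutoffRotation S E χ (-s) (G (-t) y))

variable {S Sg Sb : W →L[ℂ] W} {E G U : ℝ → W →L[ℂ] W} {χ : ℝ → ℝ}

lemma contDiff_modelHomotopy (h : IsUnitaryFlow S E) (hχ : ContDiff ℝ ∞ χ)
    (hG : IsUnitaryFlow Sg G) (hU : IsUnitaryFlow Sb U) :
    ContDiff ℝ ∞ fun p : ℝ × ℝ × W => modelHomotopy S E χ G U p.1 p.2.1 p.2.2 := by
  have hR := contDiff_cutoffRotation h hχ
  have h1 : ContDiff ℝ ∞ fun p : ℝ × ℝ × W => cutoffRotation S E χ (-p.1) p.2.2 :=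
    hR.comp (contDiff_fst.neg.prodMk (contDiff_snd.comp contDiff_snd))
  have ht : ContDiff ℝ ∞ fun p : ℝ × ℝ × W => p.2.1 := contDiff_fst.comp contDiff_snd
  exact hG.smooth.comp (ht.prodMk (hR.comp (contDiff_fst.prodMk (hU.smooth.comp (ht.prodMk h1)))))

lemma contDiff_modelHam (h : IsUnitaryFlow S E) (hχ : ContDiff ℝ ∞ χ)
    (hG : IsUnitaryFlow Sg G) (s : ℝ) :
    ContDiff ℝ ∞ fun p : ℝ × W => modelHam S E χ Sg G Sb s p.1 p.2 := by
  have hR := (contDiff_cutoffRotation h hχ).comp (contDiff_prodMk_right (-s))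
  exact ((contDiff_quadHam Sg).comp contDiff_snd).add ((contDiff_quadHam Sb).comp
    (hR.comp (hG.smooth.comp (contDiff_fst.neg.prodMk contDiff_snd))))

lemma norm_modelHomotopy (h : IsUnitaryFlow S E) (hG : IsUnitaryFlow Sg G)
    (hU : IsUnitaryFlow Sb U) (s t : ℝ) (y : W) : ‖modelHomotopy S E χ G U s t y‖ = ‖y‖ := by
  rw [modelHomotopy, hG.norm, norm_cutoffRotation h, hU.norm, norm_cutoffRotation h]

/-- The paths `modelHomotopy` are generated by the Hamiltonians `modelHam`. -/
lemma exists_hasDerivAt_modelHomotopy (h : IsUnitaryFlow S E) (hχ : ContDiff ℝ ∞ χ)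
    (hG : IsUnitaryFlow Sg G) (hU : IsUnitaryFlow Sb U) (s t : ℝ) (y : W) :
    ∃ v : W, HasDerivAt (fun t => modelHomotopy S E χ G U s t y) v t ∧
      ∀ w, stdForm W v w =
        -fderiv ℝ (modelHam S E χ Sg G Sb s t) (modelHomotopy S E χ G U s t y) w := by
  have hRs : ∀ s, ContDiff ℝ ∞ (cutoffRotation S E χ s) := fun s =>
    (contDiff_cutoffRotation h hχ).comp (contDiff_prodMk_right s)
  have hRd : ∀ s x, HasFDerivAt (cutoffRotation S E χ s) (fderiv ℝ (cutoffRotation S E χ s) x) x :=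
    fun s x => ((hRs s).differentiable (by simp) x).hasFDerivAt
  set c : W := U t (cutoffRotation S E χ (-s) y) with hc
  have hcd := hU.deriv t (cutoffRotation S E χ (-s) y)
  rw [hU.comm] at hcd
  have hRc := HasFDerivAt.comp_hasDerivAt (l := cutoffRotation S E χ s)
    (f := fun t => U t (cutoffRotation S E χ (-s) y)) t (hRd s c) hcd
  have hv := hG.hasDerivAt_apply (hasDerivAt_id t) hRc
  refine ⟨_, hv, fun w => ?_⟩
  set κ := modelHomotopy S E χ G U s t y with hκ
  have hκc : G (-t) κ = cutoffRotation S E χ s c := hG.neg_apply_apply t _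
  have hRR : cutoffRotation S E χ (-s) (cutoffRotation S E χ s c) = c := by
    have := cutoffRotation_neg (χ := χ) h (-s) c
    rwa [neg_neg] at this
  have hK : HasFDerivAt (modelHam S E χ Sg G Sb s t) (-stdForm W (Sg κ) +
      (-stdForm W (Sb c)).comp ((fderiv ℝ (cutoffRotation S E χ (-s))
        (cutoffRotation S E χ s c)).comp ((G (-t)).restrictScalars ℝ))) κ := by
    refine (hasFDerivAt_quadHam hG.skew κ).add ?_
    refine HasFDerivAt.comp (g := quadHam Sb)
      (f := fun y => cutoffRotation S E χ (-s) (G (-t) y)) κ ?_ ?_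
    · simp only [hκc, hRR]
      exact hasFDerivAt_quadHam hU.skew c
    · refine HasFDerivAt.comp (g := cutoffRotation S E χ (-s)) (f := fun y => G (-t) y) κ ?_
        ((G (-t)).restrictScalars ℝ).hasFDerivAt
      rw [hκc]
      exact hRd _ _
  rw [hK.fderiv]
  set z := fderiv ℝ (cutoffRotation S E χ (-s)) (cutoffRotation S E χ s c) (G (-t) w) with hz
  have hzw : fderiv ℝ (cutoffRotation S E χ s) c z = G (-t) w := by
    have h1 : HasFDerivAt (fun x => cutoffRotation S E χ s (cutoffRotation S E χ (-s) x)) _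
        (cutoffRotation S E χ s c) :=
      HasFDerivAt.comp (g := cutoffRotation S E χ s) (cutoffRotation S E χ s c)
        (by rw [hRR]; exact hRd s c) (hRd (-s) _)
    have h2 : (fun x => cutoffRotation S E χ s (cutoffRotation S E χ (-s) x)) = id :=
      funext fun x => cutoffRotation_neg h s x
    rw [h2] at h1
    exact congrArg (fun T : W →L[ℝ] W => T (G (-t) w)) (h1.unique (hasFDerivAt_id _))
  have e1 : stdForm W (G t (fderiv ℝ (cutoffRotation S E χ s) c (Sb c))) w =
      stdForm W (Sb c) z := by
    rw [← stdForm_fderiv_cutoffRotation h hχ s c (Sb c) z, hzw]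
    rw [stdForm_apply, stdForm_apply, ← hG.inner t _ (G (-t) w), hG.apply_neg_apply]
  simp only [id, one_smul, map_add, _root_.add_apply, _root_.neg_apply,
    ContinuousLinearMap.comp_apply, ContinuousLinearMap.coe_restrictScalars', ← hc, ← hz]
  rw [e1, hG.comm]
  change _ + stdForm W (Sg κ) w = _
  ring

lemma modelHomotopy_time_zero (h : IsUnitaryFlow S E) (hG : IsUnitaryFlow Sg G)
    (hU : IsUnitaryFlow Sb U) (s : ℝ) (y : W) : modelHomotopy S E χ G U s 0 y = y := by
  rw [modelHomotopy, hG.zero, hU.zero, cutoffRotation_neg h]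

lemma modelHomotopy_time_one (h : IsUnitaryFlow S E) (hG : ∀ x, G 1 x = x) (hU : ∀ x, U 1 x = x)
    (s : ℝ) (y : W) : modelHomotopy S E χ G U s 1 y = y := by
  rw [modelHomotopy, hG, hU, cutoffRotation_neg h]

lemma modelHomotopy_zero (h : IsUnitaryFlow S E) (t : ℝ) (y : W) :
    modelHomotopy S E χ G U 0 t y = G t (U t y) := by
  rw [modelHomotopy, neg_zero, cutoffRotation_zero h, cutoffRotation_zero h]

lemma cutoffRotation_of_one {ρ : ℝ} (h1 : ∀ N < ρ, χ N = 1) (s : ℝ) {x : W} (hx : ‖x‖ ^ 2 < ρ) :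
    cutoffRotation S E χ s x = E s x := by
  rw [cutoffRotation_of_eventually_const (c := 1) s, mul_one]
  filter_upwards [gt_mem_nhds hx] with N hN using h1 N hN

lemma cutoffRotation_of_zero (h : IsUnitaryFlow S E) {ρ : ℝ} (h0 : ∀ N > ρ, χ N = 0) (s : ℝ)
    {x : W} (hx : ρ < ‖x‖ ^ 2) : cutoffRotation S E χ s x = x := by
  rw [cutoffRotation_of_eventually_const (c := 0) s, mul_zero, h.zero]
  filter_upwards [lt_mem_nhds hx] with N hN using h0 N hN

lemma modelHomotopy_of_zero (h : IsUnitaryFlow S E) (hU : IsUnitaryFlow Sb U) {ρ : ℝ}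
    (h0 : ∀ N > ρ, χ N = 0) (s t : ℝ) {y : W} (hy : ρ < ‖y‖ ^ 2) :
    modelHomotopy S E χ G U s t y = G t (U t y) := by
  rw [modelHomotopy, cutoffRotation_of_zero h h0 _ hy, cutoffRotation_of_zero h h0]
  rwa [hU.norm]

lemma modelHam_of_zero (h : IsUnitaryFlow S E) (hG : IsUnitaryFlow Sg G) {ρ : ℝ}
    (h0 : ∀ N > ρ, χ N = 0) (s t : ℝ) {y : W} (hy : ρ < ‖y‖ ^ 2) :
    modelHam S E χ Sg G Sb s t y = quadHam Sg y + quadHam Sb (G (-t) y) := by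
  rw [modelHam, cutoffRotation_of_zero h h0]
  rwa [hG.norm]

lemma modelHam_of_one (hG : IsUnitaryFlow Sg G) {ρ : ℝ}
    (h1 : ∀ N < ρ, χ N = 1) (s t : ℝ) {y : W} (hy : ‖y‖ ^ 2 < ρ) :
    modelHam S E χ Sg G Sb s t y = quadHam Sg y + quadHam Sb (E (-s) (G (-t) y)) := by
  rw [modelHam, cutoffRotation_of_one h1]
  rwa [hG.norm]

end ModelHomotopy

section DiagonalFlow

variable {n : ℕ}

/-- The diagonal operator with entries `c`. -/
def diagOp (c : Fin n → ℂ) : EuclideanSpace ℂ (Fin n) →L[ℂ] EuclideanSpace ℂ (Fin n) :=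
  LinearMap.toContinuousLinearMap
    { toFun := fun x => WithLp.toLp 2 fun j => c j * x j
      map_add' := fun x y => by ext j; simp [mul_add]
      map_smul' := fun r x => by ext j; simp [mul_left_comm] }

lemma diagOp_apply (c : Fin n → ℂ) (x : EuclideanSpace ℂ (Fin n)) (j : Fin n) :
    diagOp c x j = c j * x j := rfl

/-- The generator of the rotation with weights `a`. -/
def rotationGen (a : Fin n → ℤ) : EuclideanSpace ℂ (Fin n) →L[ℂ] EuclideanSpace ℂ (Fin n) :=
  diagOp fun j => ((2 * Real.pi * a j : ℝ) : ℂ) * Complex.I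

/-- The rotation with weights `a`. -/
def rotation (a : Fin n → ℤ) (t : ℝ) :
    EuclideanSpace ℂ (Fin n) →L[ℂ] EuclideanSpace ℂ (Fin n) :=
  diagOp fun j => Complex.exp ((2 * Real.pi * a j * t : ℝ) * Complex.I)

lemma isUnitaryFlow_rotation (a : Fin n → ℤ) : IsUnitaryFlow (rotationGen a) (rotation a) where
  skew x y := by
    simp only [PiLp.inner_apply, rotationGen, diagOp_apply, ← Finset.sum_neg_distrib]
    refine Finset.sum_congr rfl fun j _ => ?_
    simp only [RCLike.inner_apply, map_mul, Complex.conj_ofReal, Complex.conj_I]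
    ring
  smooth := by
    refine (contDiff_piLp 2).2 fun j => ?_
    simp only [rotation, diagOp_apply]
    refine ContDiff.mul (ContDiff.cexp ((Complex.ofRealCLM.contDiff.comp
      (contDiff_const.mul contDiff_fst)).mul contDiff_const)) ?_
    exact ((contDiff_piLp_apply 2 (i := j)).comp contDiff_snd)
  deriv t x := by
    have h : HasDerivAt (fun (t : ℝ) (j : Fin n) =>
        Complex.exp ((2 * Real.pi * a j * t : ℝ) * Complex.I) * x j)
        (fun j => Complex.exp ((2 * Real.pi * a j * t : ℝ) * Complex.I) *
          (((2 * Real.pi * a j : ℝ) : ℂ) * Complex.I * x j)) t := by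
      rw [hasDerivAt_pi]
      intro j
      have h1 := ((((hasDerivAt_id t).const_mul (2 * Real.pi * a j)).ofReal_comp.mul_const
        Complex.I).cexp.mul_const (x j))
      exact h1.congr_deriv (by simp [mul_assoc])
    exact (PiLp.continuousLinearEquiv 2 ℝ fun _ : Fin n => ℂ).symm.hasFDerivAt.comp_hasDerivAt t h
  comm t x := by
    ext j
    simp only [rotation, rotationGen, diagOp_apply]
    ring
  add s t x := by
    ext j
    simp only [rotation, diagOp_apply]
    rw [← mul_assoc, ← Complex.exp_add]
    congr 2
    push_cast
    ring
  zero x := by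
    ext j
    simp [rotation, diagOp_apply]
  inner t x y := by
    simp only [PiLp.inner_apply, rotation, diagOp_apply]
    refine Finset.sum_congr rfl fun j _ => ?_
    rw [RCLike.inner_apply, RCLike.inner_apply, map_mul, mul_mul_mul_comm, Complex.mul_conj,
      Complex.normSq_eq_norm_sq, Complex.norm_exp_ofReal_mul_I]
    simp

lemma rotation_one (a : Fin n → ℤ) (x : EuclideanSpace ℂ (Fin n)) : rotation a 1 x = x := by
  ext j
  rw [rotation, diagOp_apply, (Complex.exp_eq_one_iff).2 ⟨a j, by push_cast; ring⟩, one_mul]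

lemma rotation_add_weights (a b : Fin n → ℤ) (t : ℝ) (x : EuclideanSpace ℂ (Fin n)) :
    rotation (a + b) t x = rotation a t (rotation b t x) := by
  ext j
  simp only [rotation, diagOp_apply]
  rw [← mul_assoc, ← Complex.exp_add]
  congr 2
  push_cast [Pi.add_apply]
  ring

lemma quadHam_rotationGen (a : Fin n → ℤ) (x : EuclideanSpace ℂ (Fin n)) :
    quadHam (rotationGen a) x = ∑ j, Real.pi * a j * ‖x j‖ ^ 2 := by
  rw [quadHam, PiLp.inner_apply, Complex.im_sum, Finset.sum_div]
  refine Finset.sum_congr rfl fun j _ => ?_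
  rw [rotationGen, diagOp_apply, RCLike.inner_apply, mul_assoc, Complex.mul_conj,
    Complex.normSq_eq_norm_sq, mul_right_comm, ← Complex.ofReal_mul, Complex.im_ofReal_mul,
    Complex.I_im]
  ring

lemma norm_rotation_apply (a : Fin n → ℤ) (t : ℝ) (x : EuclideanSpace ℂ (Fin n)) (j : Fin n) :
    ‖rotation a t x j‖ = ‖x j‖ := by
  rw [rotation, diagOp_apply, norm_mul, Complex.norm_exp_ofReal_mul_I, one_mul]

/-- Weights of vanishing sum are a coboundary for some permutation. -/
lemma exists_weights_coboundary {a : Fin n → ℤ} (ha : ∑ j, a j = 0) :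
    ∃ (b : Fin n → ℤ) (σ : Equiv.Perm (Fin n)), ∀ j, a j = b j - b (σ j) := by
  rcases n with _ | m
  · exact ⟨0, 1, fun j => j.elim0⟩
  refine ⟨fun j => -∑ i ∈ Finset.univ.filter (· < j), a i, finRotate (m + 1), fun j => ?_⟩
  induction j using Fin.lastCases with
  | last =>
    rw [finRotate_last]
    simp only [Fin.not_lt_zero, Finset.filter_false, Finset.sum_empty]
    have : (Finset.univ.filter (· < Fin.last m)) = Finset.univ.erase (Fin.last m) := by
      ext i
      simp [Fin.lt_last_iff_ne_last]
    rw [this]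
    have h2 := Finset.add_sum_erase Finset.univ a (Finset.mem_univ (Fin.last m))
    linarith
  | cast i =>
    have h1 : finRotate (m + 1) i.castSucc = i.succ := by
      rw [finRotate_apply, Fin.coeSucc_eq_succ]
    have h2 : (Finset.univ.filter (· < i.succ)) =
        insert i.castSucc (Finset.univ.filter (· < i.castSucc)) := by
      ext k
      simp only [Finset.mem_filter, Finset.mem_univ, true_and, Finset.mem_insert, Fin.lt_def,
        Fin.ext_iff, Fin.val_succ, Fin.val_castSucc]
      omega
    simp only [h1, h2]
    rw [Finset.sum_insert (by simp)]
    ring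

end DiagonalFlow

section VolumePreserving

variable {V : Type*} [NormedAddCommGroup V] [InnerProductSpace ℂ V] [FiniteDimensional ℂ V]

lemma abs_det_eq_one_of_stdForm [FiniteDimensional ℝ V] {M : V →L[ℝ] V}
    (hM : ∀ u v, stdForm V (M u) (M v) = stdForm V u v) : |M.det| = 1 := by
  set Λ : V →ₗ[ℝ] Module.Dual ℝ V :=
    { toFun := fun u => (stdForm V u).toLinearMap
      map_add' := fun u v => by ext; simp
      map_smul' := fun c u => by ext; simp } with hΛ
  have hinj : Function.Injective Λ := by
    rw [← LinearMap.ker_eq_bot, LinearMap.ker_eq_bot']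
    intro u hu
    exact eq_zero_of_stdForm_eq_zero fun y => congrArg (fun T : Module.Dual ℝ V => T y) hu
  set e := LinearEquiv.ofInjectiveOfFinrankEq Λ hinj (Subspace.dual_finrank_eq).symm with he
  have heq : M.toLinearMap.dualMap ∘ₗ (e : V →ₗ[ℝ] Module.Dual ℝ V) ∘ₗ M.toLinearMap =
      (e : V →ₗ[ℝ] Module.Dual ℝ V) := by
    ext u v
    exact hM u v
  have h1 : ((e.symm : Module.Dual ℝ V →ₗ[ℝ] V) ∘ₗ M.toLinearMap.dualMap ∘ₗ
      (e : V →ₗ[ℝ] Module.Dual ℝ V)) ∘ₗ M.toLinearMap = LinearMap.id := by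
    rw [LinearMap.comp_assoc, LinearMap.comp_assoc, heq]
    ext u
    simp
  have h2 := congrArg LinearMap.det h1
  have h3 := LinearMap.det_conj M.toLinearMap.dualMap e.symm
  rw [LinearEquiv.symm_symm] at h3
  rw [LinearMap.det_comp, h3, LinearMap.det_dualMap, LinearMap.det_id] at h2
  change |LinearMap.det M.toLinearMap| = 1
  rw [← sq_eq_sq₀ (abs_nonneg _) zero_le_one, sq_abs, sq, h2, one_pow]

lemma setIntegral_ball_comp_of_stdForm {n : ℕ} {f g : EuclideanSpace ℂ (Fin n) →
    EuclideanSpace ℂ (Fin n)} (hf : Differentiable ℝ f) (hnorm : ∀ x, ‖f x‖ = ‖x‖)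
    (hgnorm : ∀ x, ‖g x‖ = ‖x‖) (hgf : ∀ x, g (f x) = x) (hfg : ∀ x, f (g x) = x)
    (hform : ∀ x u v, stdForm _ (fderiv ℝ f x u) (fderiv ℝ f x v) = stdForm _ u v) (r : ℝ)
    (q : EuclideanSpace ℂ (Fin n) → ℝ) :
    ∫ x in Metric.ball 0 r, q (f x) = ∫ x in Metric.ball 0 r, q x := by
  have himg : f '' Metric.ball 0 r = Metric.ball 0 r := by
    ext y
    constructor
    · rintro ⟨x, hx, rfl⟩
      rw [mem_ball_zero_iff] at hx ⊢
      rwa [hnorm]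
    · intro hy
      refine ⟨g y, ?_, hfg y⟩
      rw [mem_ball_zero_iff] at hy ⊢
      rwa [hgnorm]
  have h := integral_image_eq_integral_abs_det_fderiv_smul volume (f := f)
    (s := Metric.ball 0 r) Metric.isOpen_ball.measurableSet
    (fun x _ => (hf x).hasFDerivAt.hasFDerivWithinAt)
    (fun x _ y _ hxy => by rw [← hgf x, hxy, hgf]) q
  rw [himg] at h
  rw [h]
  refine integral_congr_ae (Filter.Eventually.of_forall fun x => ?_)
  simp only
  rw [abs_det_eq_one_of_stdForm (hform x), one_smul]

end VolumePreserving

section ModelLoop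

variable {n : ℕ}

/-- Compactly supported modification of a linear circle action of vanishing total weight: the
Hamiltonian becomes zero near the origin. -/
theorem exists_model_homotopy {a : Fin n → ℤ} (ha : ∑ j, a j = 0) {r₀ r₁ : ℝ} (hr₀ : 0 < r₀)
    (hr : r₀ < r₁) :
    ∃ (κ : ℝ → ℝ → EuclideanSpace ℂ (Fin n) → EuclideanSpace ℂ (Fin n))
      (K : ℝ → ℝ → EuclideanSpace ℂ (Fin n) → ℝ),
      ContDiff ℝ ∞ (fun p : ℝ × ℝ × EuclideanSpace ℂ (Fin n) => κ p.1 p.2.1 p.2.2) ∧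
      (∀ s, ContDiff ℝ ∞ fun p : ℝ × EuclideanSpace ℂ (Fin n) => K s p.1 p.2) ∧
      (∀ s t y, ‖κ s t y‖ = ‖y‖) ∧
      (∀ s t y, ∃ v, HasDerivAt (fun t => κ s t y) v t ∧
        ∀ w, stdForm _ v w = -fderiv ℝ (K s t) (κ s t y) w) ∧
      (∀ s y, κ s 0 y = y) ∧ (∀ s y, κ s 1 y = y) ∧ (∀ t y, κ 0 t y = rotation a t y) ∧
      (∀ s t y, r₁ < ‖y‖ → κ s t y = rotation a t y) ∧
      (∀ s t y, r₁ < ‖y‖ → K s t y = quadHam (rotationGen a) y) ∧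
      (∀ t y, ‖y‖ < r₀ → K 1 t y = 0) ∧
      ∀ s t r, ∫ y in Metric.ball 0 r, K s t y =
        ∫ y in Metric.ball 0 r, quadHam (rotationGen a) y := by
  obtain ⟨b, σ, hσ⟩ := exists_weights_coboundary ha
  set g : Fin n → ℤ := fun j => -b (σ j) with hg
  have hag : a = g + b := by
    funext j
    rw [hσ, hg, Pi.add_apply]
    ring
  obtain ⟨S, E, hE, hE1⟩ := exists_unitary_path (LinearIsometryEquiv.piLpCongrLeft 2 ℂ ℂ σ.symm)
  have hr₁ : 0 < r₁ := hr₀.trans hr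
  have hd : 0 < r₁ ^ 2 - r₀ ^ 2 := by nlinarith
  set χ : ℝ → ℝ := fun N => Real.smoothTransition ((r₁ ^ 2 - N) / (r₁ ^ 2 - r₀ ^ 2)) with hχdef
  have hχ : ContDiff ℝ ∞ χ := Real.smoothTransition.contDiff.comp (by fun_prop)
  have hχ0 : ∀ N > r₁ ^ 2, χ N = 0 := fun N hN =>
    Real.smoothTransition.zero_of_nonpos (div_nonpos_of_nonpos_of_nonneg (by linarith) hd.le)
  have hχ1 : ∀ N < r₀ ^ 2, χ N = 1 := fun N hN =>
    Real.smoothTransition.one_of_one_le ((one_le_div hd).2 (by linarith))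
  have hG := isUnitaryFlow_rotation g
  have hU := isUnitaryFlow_rotation b
  have hQ : ∀ y : EuclideanSpace ℂ (Fin n), quadHam (rotationGen a) y =
      quadHam (rotationGen g) y + quadHam (rotationGen b) y := fun y => by
    simp only [quadHam_rotationGen, ← Finset.sum_add_distrib]
    refine Finset.sum_congr rfl fun j _ => ?_
    rw [hag, Pi.add_apply]
    push_cast
    ring
  have hQinv : ∀ (t : ℝ) (y : EuclideanSpace ℂ (Fin n)),
      quadHam (rotationGen b) (rotation g t y) = quadHam (rotationGen b) y := fun t y => by
    simp only [quadHam_rotationGen, norm_rotation_apply]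
  have hRs : ∀ s, ContDiff ℝ ∞ (cutoffRotation S E χ s) := fun s =>
    (contDiff_cutoffRotation hE hχ).comp (contDiff_prodMk_right s)
  refine ⟨modelHomotopy S E χ (rotation g) (rotation b),
    modelHam S E χ (rotationGen g) (rotation g) (rotationGen b),
    contDiff_modelHomotopy hE hχ hG hU, contDiff_modelHam hE hχ hG, norm_modelHomotopy hE hG hU,
    exists_hasDerivAt_modelHomotopy hE hχ hG hU, modelHomotopy_time_zero hE hG hU,
    modelHomotopy_time_one hE (rotation_one g) (rotation_one b), fun t y => ?_,
    fun s t y hy => ?_, fun s t y hy => ?_, fun t y hy => ?_, fun s t r => ?_⟩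
  · rw [modelHomotopy_zero hE, hag, rotation_add_weights]
  · rw [modelHomotopy_of_zero hE hU hχ0 s t (by gcongr), hag, rotation_add_weights]
  · rw [modelHam_of_zero hE hG hχ0 s t (by gcongr), hQinv, hQ]
  · rw [modelHam_of_one hG hχ1 1 t (by gcongr)]
    have hP : ∀ x, E (-1) x = (LinearIsometryEquiv.piLpCongrLeft 2 ℂ ℂ σ.symm).symm x := fun x => by
      rw [LinearIsometryEquiv.eq_symm_apply, ← hE1, hE.apply_neg_apply]
    rw [hP, quadHam_rotationGen, quadHam_rotationGen, ← Equiv.sum_comp σ (fun j => Real.pi * b j *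
      ‖((LinearIsometryEquiv.piLpCongrLeft 2 ℂ ℂ σ.symm).symm (rotation g (-t) y)) j‖ ^ 2),
      ← Finset.sum_add_distrib]
    refine Finset.sum_eq_zero fun j _ => ?_
    have : ((LinearIsometryEquiv.piLpCongrLeft 2 ℂ ℂ σ.symm).symm (rotation g (-t) y)) (σ j) =
        rotation g (-t) y j := by
      simp [LinearIsometryEquiv.piLpCongrLeft_symm, LinearIsometryEquiv.piLpCongrLeft_apply,
        Equiv.piCongrLeft']
    rw [this, norm_rotation_apply, hg]
    push_cast
    ring
  · have hf : Differentiable ℝ fun y => cutoffRotation S E χ (-s) (rotation g (-t) y) :=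
      ((hRs (-s)).differentiable (by simp)).comp ((rotation g (-t)).restrictScalars ℝ).differentiable
    have hint : ∀ q : EuclideanSpace ℂ (Fin n) → ℝ, Continuous q →
        IntegrableOn q (Metric.ball 0 r) volume := fun q hq =>
      (hq.continuousOn.integrableOn_compact (isCompact_closedBall 0 r)).mono_set
        Metric.ball_subset_closedBall
    have h1 := setIntegral_ball_comp_of_stdForm hf
      (g := fun y => rotation g t (cutoffRotation S E χ s y))
      (fun x => by rw [norm_cutoffRotation hE, hG.norm])
      (fun x => by rw [hG.norm, norm_cutoffRotation hE])
      (fun x => by rw [cutoffRotation_neg hE, hG.apply_neg_apply])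
      (fun x => by
        have := cutoffRotation_neg (χ := χ) hE (-s) x
        rw [neg_neg] at this
        rw [hG.neg_apply_apply, this])
      (fun x u v => by
        have h2 : fderiv ℝ (fun y => cutoffRotation S E χ (-s) (rotation g (-t) y)) x =
            (fderiv ℝ (cutoffRotation S E χ (-s)) (rotation g (-t) x)).comp
              ((rotation g (-t)).restrictScalars ℝ) :=
          (HasFDerivAt.comp (g := cutoffRotation S E χ (-s)) (f := fun y => rotation g (-t) y) x
            (((hRs (-s)).differentiable (by simp)) _).hasFDerivAt
            ((rotation g (-t)).restrictScalars ℝ).hasFDerivAt).fderiv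
        rw [h2]
        simp only [ContinuousLinearMap.comp_apply, ContinuousLinearMap.coe_restrictScalars']
        rw [stdForm_fderiv_cutoffRotation hE hχ, stdForm_apply, stdForm_apply, hG.inner]) r
      (quadHam (rotationGen b))
    simp only [hQ, modelHam]
    rw [integral_add (hint _ (contDiff_quadHam _).continuous)
      (hint (fun y => quadHam (rotationGen b) (cutoffRotation S E χ (-s) (rotation g (-t) y)))
        ((contDiff_quadHam _).continuous.comp hf.continuous)),
      integral_add (hint _ (contDiff_quadHam _).continuous)
      (hint _ (contDiff_quadHam _).continuous), h1]

end ModelLoop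

section WedgePower

variable {V : Type*} [AddCommGroup V] [Module ℝ V] [TopologicalSpace V] {n : ℕ}

lemma update_pair_zero (p q a : V) : Function.update ![p, q] 0 a = ![a, q] := by
  ext i; fin_cases i <;> simp

lemma update_pair_one (p q a : V) : Function.update ![p, q] 1 a = ![p, a] := by
  ext i; fin_cases i <;> simp

lemma form_update_zero_add (η : V [⋀^Fin 2]→L[ℝ] ℝ) (a b c : V) :
    η ![a + b, c] = η ![a, c] + η ![b, c] := by
  have := η.toContinuousMultilinearMap.map_update_add ![0, c] 0 a b
  rwa [update_pair_zero, update_pair_zero, update_pair_zero] at this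

lemma form_update_one_add (η : V [⋀^Fin 2]→L[ℝ] ℝ) (a b c : V) :
    η ![c, a + b] = η ![c, a] + η ![c, b] := by
  have := η.toContinuousMultilinearMap.map_update_add ![c, 0] 1 a b
  rwa [update_pair_one, update_pair_one, update_pair_one] at this

lemma form_update_zero_smul (η : V [⋀^Fin 2]→L[ℝ] ℝ) (r : ℝ) (a c : V) :
    η ![r • a, c] = r * η ![a, c] := by
  have := η.toContinuousMultilinearMap.map_update_smul ![0, c] 0 r a
  rwa [update_pair_zero, update_pair_zero] at this

lemma form_update_one_smul (η : V [⋀^Fin 2]→L[ℝ] ℝ) (r : ℝ) (a c : V) :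
    η ![c, r • a] = r * η ![c, a] := by
  have := η.toContinuousMultilinearMap.map_update_smul ![c, 0] 1 r a
  rwa [update_pair_one, update_pair_one] at this

lemma form_skew (η : V [⋀^Fin 2]→L[ℝ] ℝ) (a b : V) : η ![a, b] = -η ![b, a] := by
  have h := η.toAlternatingMap.map_swap ![b, a] (i := 0) (j := 1) (by decide)
  have e : ![b, a] ∘ Equiv.swap (0 : Fin 2) 1 = ![a, b] := by
    ext i
    fin_cases i <;> rfl
  rw [e] at h
  exact h

/-- The product `∏ η(v₂ᵢ, v₂ᵢ₊₁)` as a function of the `j`-th vector. -/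
lemma exists_factor_of_pairing (η : V [⋀^Fin 2]→L[ℝ] ℝ) (v : Fin (2 * n) → V) (j : Fin (2 * n)) :
    ∃ T : V →ₗ[ℝ] ℝ, ∀ x, ∏ i : Fin n, η ![Function.update v j x ⟨2 * i.1, by omega⟩,
      Function.update v j x ⟨2 * i.1 + 1, by omega⟩] = T x := by
  obtain ⟨k, hk⟩ : ∃ k : Fin n, j.1 = 2 * k.1 ∨ j.1 = 2 * k.1 + 1 :=
    ⟨⟨j.1 / 2, by omega⟩, by simp only; omega⟩
  set c : ℝ := ∏ i ∈ Finset.univ.erase k, η ![v ⟨2 * i.1, by omega⟩, v ⟨2 * i.1 + 1, by omega⟩]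
    with hc
  have hrest : ∀ x, ∏ i ∈ Finset.univ.erase k, η ![Function.update v j x ⟨2 * i.1, by omega⟩,
      Function.update v j x ⟨2 * i.1 + 1, by omega⟩] = c := by
    intro x
    refine Finset.prod_congr rfl fun i hi => ?_
    have hik : i.1 ≠ k.1 := fun h => (Finset.mem_erase.1 hi).1 (Fin.ext h)
    rw [Function.update_of_ne, Function.update_of_ne]
    · intro h
      have := congrArg Fin.val h
      simp only at this
      omega
    · intro h
      have := congrArg Fin.val h
      simp only at this
      omega
  rcases hk with hk | hk
  · refine ⟨{ toFun := fun x => η ![x, v ⟨2 * k.1 + 1, by omega⟩] * c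
              map_add' := fun x y => by rw [form_update_zero_add]; ring
              map_smul' := fun r x => by rw [form_update_zero_smul]; simp [mul_assoc] }, fun x => ?_⟩
    rw [← Finset.mul_prod_erase _ _ (Finset.mem_univ k), hrest]
    have h1 : (⟨2 * k.1, by omega⟩ : Fin (2 * n)) = j := Fin.ext hk.symm
    have h2 : (⟨2 * k.1 + 1, by omega⟩ : Fin (2 * n)) ≠ j := fun h => by
      have := congrArg Fin.val h
      simp only at this
      omega
    rw [Function.update_of_ne h2, h1, Function.update_self]
    rfl
  · refine ⟨{ toFun := fun x => η ![v ⟨2 * k.1, by omega⟩, x] * c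
              map_add' := fun x y => by rw [form_update_one_add]; ring
              map_smul' := fun r x => by rw [form_update_one_smul]; simp [mul_assoc] }, fun x => ?_⟩
    rw [← Finset.mul_prod_erase _ _ (Finset.mem_univ k), hrest]
    have h1 : (⟨2 * k.1 + 1, by omega⟩ : Fin (2 * n)) = j := Fin.ext hk.symm
    have h2 : (⟨2 * k.1, by omega⟩ : Fin (2 * n)) ≠ j := fun h => by
      have := congrArg Fin.val h
      simp only at this
      omega
    rw [Function.update_of_ne h2, h1, Function.update_self]
    rfl

/-- The product `∏ η(v₂ᵢ, v₂ᵢ₊₁)` as a multilinear map. -/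
def pairing (η : V [⋀^Fin 2]→L[ℝ] ℝ) : MultilinearMap ℝ (fun _ : Fin (2 * n) => V) ℝ where
  toFun v := ∏ i : Fin n, η ![v ⟨2 * i.1, by omega⟩, v ⟨2 * i.1 + 1, by omega⟩]
  map_update_add' {inst} v j x y := by
    rw [Subsingleton.elim inst (instDecidableEqFin _)]
    obtain ⟨T, hT⟩ := exists_factor_of_pairing η v j
    rw [hT, hT, hT, map_add]
  map_update_smul' {inst} v j c x := by
    rw [Subsingleton.elim inst (instDecidableEqFin _)]
    obtain ⟨T, hT⟩ := exists_factor_of_pairing η v j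
    rw [hT, hT, map_smul]

lemma wedgePower_eq (η : V [⋀^Fin 2]→L[ℝ] ℝ) (v : Fin (2 * n) → V) :
    wedgePower η v = (1 / 2 : ℝ) ^ n * MultilinearMap.alternatization (pairing η) v := by
  rw [wedgePower, MultilinearMap.alternatization_apply]
  congr 1
  refine Finset.sum_congr rfl fun σ _ => ?_
  rw [Units.smul_def, zsmul_eq_mul]
  rfl

end WedgePower

section WedgePowerDet

variable {n : ℕ}

lemma wedgePower_compContinuousLinearMap (η : Model n [⋀^Fin 2]→L[ℝ] ℝ)
    (L : Model n →L[ℝ] Model n) (v : Fin (2 * n) → Model n) :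
    wedgePower (η.compContinuousLinearMap L) v = L.det * wedgePower η v := by
  have h1 : wedgePower (η.compContinuousLinearMap L) v = wedgePower η (L ∘ v) := by
    simp only [wedgePower, ContinuousAlternatingMap.compContinuousLinearMap_apply]
    congr 1
    refine Finset.sum_congr rfl fun σ _ => ?_
    congr 1
    refine Finset.prod_congr rfl fun i _ => ?_
    congr 1
    ext k
    fin_cases k <;> rfl
  set b := (EuclideanSpace.basisFun (Fin (2 * n)) ℝ).toBasis
  have h2 := AlternatingMap.eq_smul_basis_det b (MultilinearMap.alternatization (pairing (n := n) η))
  rw [h1, wedgePower_eq, wedgePower_eq, h2]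
  simp only [AlternatingMap.smul_apply, smul_eq_mul]
  have := b.det_comp L.toLinearMap v
  change b.det (L ∘ v) = L.det * b.det v at this
  rw [this]
  ring

end WedgePowerDet

section SmoothCharts

variable {n : ℕ} {X : Type*} [TopologicalSpace X] [ChartedSpace (Model n) X]
  {V V' : Type*} [NormedAddCommGroup V] [NormedSpace ℝ V] [NormedAddCommGroup V'] [NormedSpace ℝ V']

/-- A smooth chart with values in a normed space. -/
structure IsSmoothChart (n : ℕ) {X : Type*} [TopologicalSpace X] [ChartedSpace (Model n) X]
    {V : Type*} [NormedAddCommGroup V] [NormedSpace ℝ V] (e : OpenPartialHomeomorph X V) : Prop where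
  smooth : ContMDiffOn (𝓡 (2 * n)) 𝓘(ℝ, V) ∞ e e.source
  smooth_symm : ContMDiffOn 𝓘(ℝ, V) (𝓡 (2 * n)) ∞ e.symm e.target

lemma isSmoothChart_chartAt [IsManifold (𝓡 (2 * n)) ∞ X] (x : X) :
    IsSmoothChart n (chartAt (Model n) x) :=
  ⟨contMDiffOn_chart, contMDiffOn_chart_symm⟩

/-- The coordinate expression of a 2-form in a chart. -/
def formIn (Ω : SymplecticForm n X) (e : OpenPartialHomeomorph X V) (y : V) : V [⋀^Fin 2]→L[ℝ] ℝ :=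
  ContinuousAlternatingMap.compContinuousLinearMap (M := Model n) (M' := V) (Ω.form (e.symm y))
    (mfderiv 𝓘(ℝ, V) (𝓡 (2 * n)) e.symm y)

lemma formInChart_eq (Ω : SymplecticForm n X) (x : X) :
    formInChart Ω.form x = formIn Ω (chartAt (Model n) x) := rfl

lemma formIn_apply (Ω : SymplecticForm n X) (e : OpenPartialHomeomorph X V) (y u v : V) :
    formIn Ω e y ![u, v] = Ω.form (e.symm y) ![mfderiv 𝓘(ℝ, V) (𝓡 (2 * n)) e.symm y u,
      mfderiv 𝓘(ℝ, V) (𝓡 (2 * n)) e.symm y v] := by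
  refine congrArg (Ω.form (e.symm y)) ?_
  ext k
  fin_cases k <;> rfl

lemma form_congr (Ω : SymplecticForm n X) {x x' : X} (h : x = x') (u v : Model n) :
    Ω.form x ![u, v] = Ω.form x' ![u, v] := by
  subst h; rfl

lemma ext_two {η η' : V [⋀^Fin 2]→L[ℝ] ℝ} (h : ∀ u v, η ![u, v] = η' ![u, v]) : η = η' := by
  ext v
  have : v = ![v 0, v 1] := by
    ext k
    fin_cases k <;> rfl
  rw [this, h]

lemma IsSmoothChart.contDiffAt_transition {e : OpenPartialHomeomorph X V}
    {e' : OpenPartialHomeomorph X V'} (he : IsSmoothChart n e) (he' : IsSmoothChart n e') {y : V}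
    (hy : y ∈ e.target) (hy' : e.symm y ∈ e'.source) :
    ContDiffAt ℝ ∞ (fun y => e' (e.symm y)) y := by
  have h1 := he.smooth_symm.contMDiffAt (e.open_target.mem_nhds hy)
  have h2 := he'.smooth.contMDiffAt (e'.open_source.mem_nhds hy')
  exact contMDiffAt_iff_contDiffAt.1 (h2.comp y h1)

lemma IsSmoothChart.formIn_transition (Ω : SymplecticForm n X) {e : OpenPartialHomeomorph X V}
    {e' : OpenPartialHomeomorph X V'} (he : IsSmoothChart n e) (he' : IsSmoothChart n e') {y : V}
    (hy : y ∈ e.target) (hy' : e.symm y ∈ e'.source) :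
    formIn Ω e y = (formIn Ω e' (e' (e.symm y))).compContinuousLinearMap
      (fderiv ℝ (fun y => e' (e.symm y)) y) := by
  have hg := he.contDiffAt_transition he' hy hy'
  have hev : e.symm =ᶠ[nhds y] e'.symm ∘ fun y => e' (e.symm y) := by
    have : e.symm ⁻¹' e'.source ∈ nhds y :=
      (e.symm.continuousAt hy).preimage_mem_nhds (e'.open_source.mem_nhds hy')
    filter_upwards [this] with z hz
    exact (e'.left_inv hz).symm
  have hd : MDifferentiableAt 𝓘(ℝ, V') (𝓡 (2 * n)) e'.symm (e' (e.symm y)) :=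
    (he'.smooth_symm.contMDiffAt (e'.open_target.mem_nhds (e'.map_source hy'))).mdifferentiableAt
      (by simp)
  have hm : ∀ u, (mfderiv 𝓘(ℝ, V) (𝓡 (2 * n)) e.symm y u : Model n) =
      mfderiv 𝓘(ℝ, V') (𝓡 (2 * n)) e'.symm (e' (e.symm y))
        (fderiv ℝ (fun y => e' (e.symm y)) y u) := by
    intro u
    have h1 := hev.mfderiv_eq (I := 𝓘(ℝ, V)) (I' := 𝓡 (2 * n))
    have h2 := mfderiv_comp y hd
      (mdifferentiableAt_iff_differentiableAt.2 (hg.differentiableAt (by simp)))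
    rw [mfderiv_eq_fderiv] at h2
    have h3 := h1.trans h2
    exact congrArg (fun T : V →L[ℝ] Model n => T u) h3
  refine ext_two fun u v => ?_
  rw [formIn_apply, ContinuousAlternatingMap.compContinuousLinearMap_apply]
  have hc : (⇑(fderiv ℝ (fun y => e' (e.symm y)) y) ∘ ![u, v]) =
      ![fderiv ℝ (fun y => e' (e.symm y)) y u, fderiv ℝ (fun y => e' (e.symm y)) y v] := by
    ext k
    fin_cases k <;> rfl
  rw [hc, formIn_apply]
  exact (congrArg₂ (fun a b : Model n => Ω.form (e.symm y) ![a, b]) (hm u) (hm v)).trans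
    (form_congr Ω (e'.left_inv hy').symm _ _)

end SmoothCharts

section MeasureGluing

/-- Compatible measures on the members of a countable cover are the restrictions of their
supremum. -/
lemma iSup_apply_of_compatible {X ι : Type*} [MeasurableSpace X] {m : ι → Measure X}
    {S : ι → Set X} (hS : ∀ i, MeasurableSet (S i)) (hsupp : ∀ i, m i (S i)ᶜ = 0)
    (hcompat : ∀ i j A, MeasurableSet A → A ⊆ S i → A ⊆ S j → m i A = m j A) {c : ℕ → ι}
    (hc : ⋃ k, S (c k) = univ) (i : ι) {A : Set X} (hA : MeasurableSet A) (hAi : A ⊆ S i) :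
    (⨆ i, m i) A = m i A := by
  set T := disjointed fun k => S (c k) with hT
  have hTm : ∀ k, MeasurableSet (T k) := fun k => MeasurableSet.disjointed (fun k => hS (c k)) k
  have hTS : ∀ k, T k ⊆ S (c k) := disjointed_subset _
  have hTu : ⋃ k, T k = univ := by rw [hT, iUnion_disjointed, hc]
  set ν : Measure X := Measure.sum fun k => (m (c k)).restrict (T k) with hν
  have hνA : ∀ j A, MeasurableSet A → A ⊆ S j → ν A = m j A := by
    intro j A hA hAj
    rw [hν, Measure.sum_apply _ hA]
    have : ∀ k, (m (c k)).restrict (T k) A = m j (A ∩ T k) := fun k => by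
      rw [Measure.restrict_apply hA]
      exact hcompat _ _ _ (hA.inter (hTm k)) (inter_subset_right.trans (hTS k))
        (inter_subset_left.trans hAj)
    simp_rw [this]
    rw [← measure_iUnion (fun k l hkl => ((disjoint_disjointed _ hkl).mono inter_subset_right
      inter_subset_right)) (fun k => hA.inter (hTm k)), ← inter_iUnion, hTu, inter_univ]
  have hle : ∀ j, m j ≤ ν := fun j => Measure.le_iff.2 fun B hB => by
    calc m j B ≤ m j (B ∩ S j) + m j (S j)ᶜ := by
          refine (measure_mono ?_).trans (measure_union_le _ _)
          intro x hx
          by_cases h : x ∈ S j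
          · exact Or.inl ⟨hx, h⟩
          · exact Or.inr h
      _ = ν (B ∩ S j) := by rw [hsupp, add_zero, hνA j _ (hB.inter (hS j)) inter_subset_right]
      _ ≤ ν B := measure_mono inter_subset_left
  refine le_antisymm ?_ (Measure.le_iff.1 (le_iSup m i) A hA)
  rw [← hνA i A hA hAi]
  exact Measure.le_iff.1 (iSup_le hle) A hA

lemma measurableSet_image_openPartialHomeomorph {X V : Type*} [TopologicalSpace X]
    [TopologicalSpace V] [MeasurableSpace X] [BorelSpace X] [MeasurableSpace V] [BorelSpace V]
    (e : OpenPartialHomeomorph X V) {A : Set X} (hA : MeasurableSet A) (hAe : A ⊆ e.source) :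
    MeasurableSet (e '' A) := by
  rw [e.image_eq_target_inter_inv_preimage hAe]
  have h1 : Measurable (e.target.domRestrict e.symm) :=
    (continuousOn_iff_continuous_domRestrict.1 e.continuousOn_symm).measurable
  have h2 := e.open_target.measurableSet.subtype_image (h1 hA)
  convert h2 using 1
  ext y
  simp [Set.domRestrict, and_comm]

end MeasureGluing

section Volume

variable {n : ℕ} {X : Type*} [TopologicalSpace X] [ChartedSpace (Model n) X]
  [MeasurableSpace X] [BorelSpace X]

/-- The density of `ω^n` in a chart. -/
def volumeDensity (Ω : SymplecticForm n X) (e : OpenPartialHomeomorph X (Model n)) (y : Model n) :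
    ENNReal :=
  ENNReal.ofReal |wedgePower (formIn Ω e y) fun i => EuclideanSpace.single i (1 : ℝ)|

lemma lintegral_volumeDensity_transition (Ω : SymplecticForm n X)
    {e e' : OpenPartialHomeomorph X (Model n)} (he : IsSmoothChart n e) (he' : IsSmoothChart n e')
    {A : Set X} (hA : MeasurableSet A) (hAe : A ⊆ e.source) (hAe' : A ⊆ e'.source) :
    ∫⁻ y in e' '' A, volumeDensity Ω e' y = ∫⁻ y in e '' A, volumeDensity Ω e y := by
  set g : Model n → Model n := fun y => e' (e.symm y) with hg
  have himg : e' '' A = g '' (e '' A) := by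
    rw [Set.image_image]
    refine Set.image_congr fun x hx => ?_
    rw [hg]
    simp only
    rw [e.left_inv (hAe hx)]
  have hmem : ∀ y ∈ e '' A, y ∈ e.target ∧ e.symm y ∈ e'.source ∧ e.symm y ∈ A := by
    rintro _ ⟨x, hx, rfl⟩
    refine ⟨e.map_source (hAe hx), ?_⟩
    rw [e.left_inv (hAe hx)]
    exact ⟨hAe' hx, hx⟩
  have hmeas := measurableSet_image_openPartialHomeomorph e hA hAe
  rw [himg, lintegral_image_eq_lintegral_abs_det_fderiv_mul volume hmeas
    (f' := fun y => fderiv ℝ g y)]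
  · refine setLIntegral_congr_fun hmeas fun y hy => ?_
    obtain ⟨h1, h2, -⟩ := hmem y hy
    simp only [volumeDensity]
    rw [he.formIn_transition Ω he' h1 h2, wedgePower_compContinuousLinearMap, abs_mul,
      ENNReal.ofReal_mul (abs_nonneg _)]
  · intro y hy
    obtain ⟨h1, h2, -⟩ := hmem y hy
    exact ((he.contDiffAt_transition he' h1 h2).differentiableAt
      (by simp)).hasFDerivAt.hasFDerivWithinAt
  · rintro _ ⟨x, hx, rfl⟩ _ ⟨x', hx', rfl⟩ h
    simp only [hg] at h
    rw [e.left_inv (hAe hx), e.left_inv (hAe hx')] at h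
    rw [e'.injOn (hAe' hx) (hAe' hx') h]

lemma chartVolume_apply (Ω : SymplecticForm n X) (x : X) {A : Set X} (hA : MeasurableSet A) :
    chartVolume Ω x A = ∫⁻ y in (chartAt (Model n) x).target ∩ (chartAt (Model n) x).symm ⁻¹' A,
      volumeDensity Ω (chartAt (Model n) x) y := by
  set φ := chartAt (Model n) x with hφ
  have ht : (extChartAt (𝓡 (2 * n)) x).target = φ.target := by simp [hφ]
  have hm : MeasurableSet φ.target := φ.open_target.measurableSet
  rw [chartVolume, Measure.map_apply_of_aemeasurable _ hA, withDensity_apply', ht,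
    Measure.restrict_restrict' hm, inter_comm]
  · rfl
  · rw [ht]
    exact (φ.continuousOn_symm.aemeasurable hm).mono_ac (withDensity_absolutelyContinuous _ _)

lemma chartVolume_apply_of_subset (Ω : SymplecticForm n X) (x : X) {A : Set X}
    (hA : MeasurableSet A) (hAx : A ⊆ (chartAt (Model n) x).source) :
    chartVolume Ω x A = ∫⁻ y in chartAt (Model n) x '' A,
      volumeDensity Ω (chartAt (Model n) x) y := by
  rw [chartVolume_apply Ω x hA, OpenPartialHomeomorph.image_eq_target_inter_inv_preimage _ hAx]

variable [IsManifold (𝓡 (2 * n)) ∞ X] [CompactSpace X]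

lemma symplecticVolume_apply_of_subset_chart (Ω : SymplecticForm n X) (x : X) {A : Set X}
    (hA : MeasurableSet A) (hAx : A ⊆ (chartAt (Model n) x).source) :
    symplecticVolume Ω A = chartVolume Ω x A := by
  obtain ⟨t, ht, hcov⟩ := countable_cover_nhds_of_sigmaCompact fun x : X =>
    (chartAt (Model n) x).open_source.mem_nhds (mem_chart_source (Model n) x)
  have hne : t.Nonempty := by
    rw [nonempty_iff_ne_empty]
    rintro rfl
    simp only [mem_empty_iff_false, iUnion_of_empty, iUnion_empty] at hcov
    exact (hcov ▸ mem_univ x : x ∈ (∅ : Set X))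
  obtain ⟨c, rfl⟩ := ht.exists_eq_range hne
  rw [biUnion_range] at hcov
  refine iSup_apply_of_compatible (m := chartVolume Ω)
    (S := fun x => (chartAt (Model n) x).source)
    (fun x => (chartAt (Model n) x).open_source.measurableSet) (fun x => ?_)
    (fun x y A hA hAx hAy => ?_) hcov x hA hAx
  · rw [chartVolume_apply Ω x (chartAt (Model n) x).open_source.measurableSet.compl]
    have : (chartAt (Model n) x).target ∩
        (chartAt (Model n) x).symm ⁻¹' (chartAt (Model n) x).sourceᶜ = ∅ := by
      ext y
      simp only [mem_inter_iff, mem_preimage, mem_compl_iff, mem_empty_iff_false, iff_false, not_and,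
        not_not]
      exact fun hy => (chartAt (Model n) x).map_target hy
    rw [this]
    simp
  · rw [chartVolume_apply_of_subset Ω x hA hAx, chartVolume_apply_of_subset Ω y hA hAy]
    exact lintegral_volumeDensity_transition Ω (isSmoothChart_chartAt y) (isSmoothChart_chartAt x)
      hA hAy hAx

/-- The symplectic volume in an arbitrary smooth chart. -/
lemma symplecticVolume_apply_of_subset (Ω : SymplecticForm n X)
    {e : OpenPartialHomeomorph X (Model n)} (he : IsSmoothChart n e) {x : X}
    (hex : e.source ⊆ (chartAt (Model n) x).source) {A : Set X} (hA : MeasurableSet A)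
    (hAe : A ⊆ e.source) :
    symplecticVolume Ω A = ∫⁻ y in e '' A, volumeDensity Ω e y := by
  rw [symplecticVolume_apply_of_subset_chart Ω x hA (hAe.trans hex),
    chartVolume_apply_of_subset Ω x hA (hAe.trans hex)]
  exact lintegral_volumeDensity_transition Ω he (isSmoothChart_chartAt x) hA hAe (hAe.trans hex)

end Volume

section Finiteness

variable {n : ℕ} {X : Type*} [TopologicalSpace X] [ChartedSpace (Model n) X]
  [MeasurableSpace X] [BorelSpace X] [IsManifold (𝓡 (2 * n)) ∞ X] [CompactSpace X]

lemma continuous_wedgePower (v : Fin (2 * n) → Model n) :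
    Continuous fun η : Model n [⋀^Fin 2]→L[ℝ] ℝ => wedgePower η v := by
  unfold wedgePower
  refine continuous_const.mul (continuous_finsetSum _ fun σ _ => continuous_const.mul
    (continuous_finsetProd _ fun i _ => ?_))
  fun_prop

lemma isFiniteMeasure_symplecticVolume (Ω : SymplecticForm n X) :
    IsFiniteMeasure (symplecticVolume Ω) := by
  have : IsLocallyFiniteMeasure (symplecticVolume Ω) := by
    refine ⟨fun x => ?_⟩
    set φ := chartAt (Model n) x with hφ
    set w : Model n → ℝ := fun y =>
      |wedgePower (formIn Ω φ y) fun i => EuclideanSpace.single i (1 : ℝ)| with hw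
    have ht : (extChartAt (𝓡 (2 * n)) x).target = φ.target := by simp [hφ]
    have hxt : φ x ∈ φ.target := φ.map_source (mem_chart_source _ x)
    have hc : ContinuousAt w (φ x) := by
      have h1 : ContinuousAt (formInChart Ω.form x) (φ x) :=
        (Ω.smooth x).continuousOn.continuousAt (by rw [ht]; exact φ.open_target.mem_nhds hxt)
      rw [formInChart_eq] at h1
      exact (ContinuousAt.comp (f := formIn Ω φ)
        (g := fun η => wedgePower η fun i => EuclideanSpace.single i (1 : ℝ)) (x := φ x)
        (continuous_wedgePower _).continuousAt h1).abs
    have h1 : ∀ᶠ y in nhds (φ x), w y < w (φ x) + 1 := hc.eventually_lt_const (by linarith)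
    obtain ⟨ε, hε, hball⟩ := Metric.eventually_nhds_iff_ball.1
      (h1.and (φ.open_target.mem_nhds hxt))
    set N := φ.source ∩ φ ⁻¹' Metric.ball (φ x) ε with hN
    have hNo : IsOpen N := φ.isOpen_inter_preimage Metric.isOpen_ball
    refine ⟨N, hNo.mem_nhds ⟨mem_chart_source _ x, Metric.mem_ball_self hε⟩, ?_⟩
    rw [symplecticVolume_apply_of_subset Ω (isSmoothChart_chartAt x) Subset.rfl hNo.measurableSet
      inter_subset_left]
    have hsub : φ '' N ⊆ Metric.ball (φ x) ε := by
      rintro _ ⟨z, hz, rfl⟩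
      exact hz.2
    calc ∫⁻ y in φ '' N, volumeDensity Ω φ y
        ≤ ∫⁻ y in Metric.ball (φ x) ε, volumeDensity Ω φ y := lintegral_mono_set hsub
      _ ≤ ∫⁻ y in Metric.ball (φ x) ε, ENNReal.ofReal (w (φ x) + 1) :=
          setLIntegral_mono' Metric.isOpen_ball.measurableSet fun y hy =>
            ENNReal.ofReal_le_ofReal (hball y hy).1.le
      _ < ⊤ := by
          rw [setLIntegral_const]
          exact ENNReal.mul_lt_top ENNReal.ofReal_lt_top measure_ball_lt_top
  exact CompactSpace.isFiniteMeasure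

end Finiteness

section DarbouxVolume

variable {n : ℕ} {X : Type*} [TopologicalSpace X] [ChartedSpace (Model n) X]

/-- An isometry between the complex and the real model space. -/
def realModelIsometry (n : ℕ) : EuclideanSpace ℂ (Fin n) ≃ₗᵢ[ℝ] Model n :=
  ((stdOrthonormalBasis ℝ (EuclideanSpace ℂ (Fin n))).reindex (finCongr (by
    rw [← Module.finrank_mul_finrank ℝ ℂ, Complex.finrank_real_complex, finrank_euclideanSpace,
      Fintype.card_fin]))).repr

lemma IsSmoothChart.transIsometry {e : OpenPartialHomeomorph X (EuclideanSpace ℂ (Fin n))}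
    (he : IsSmoothChart n e) :
    IsSmoothChart n (e.transHomeomorph (realModelIsometry n).toHomeomorph) where
  smooth := by
    have h : ContMDiff 𝓘(ℝ, EuclideanSpace ℂ (Fin n)) 𝓘(ℝ, Model n) ∞ (realModelIsometry n) :=
      (realModelIsometry n).toContinuousLinearEquiv.contDiff.contMDiff
    exact h.comp_contMDiffOn he.smooth
  smooth_symm := by
    have h : ContMDiff 𝓘(ℝ, Model n) 𝓘(ℝ, EuclideanSpace ℂ (Fin n)) ∞ (realModelIsometry n).symm :=
      (realModelIsometry n).symm.toContinuousLinearEquiv.contDiff.contMDiff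
    exact he.smooth_symm.comp h.contMDiffOn fun y hy => hy

variable [MeasurableSpace X] [BorelSpace X] [IsManifold (𝓡 (2 * n)) ∞ X] [CompactSpace X]

/-- In a chart in which the symplectic form is constant, the symplectic volume is a multiple of the
Lebesgue measure. -/
lemma exists_map_symplecticVolume (Ω : SymplecticForm n X)
    {e : OpenPartialHomeomorph X (EuclideanSpace ℂ (Fin n))} (he : IsSmoothChart n e) {x : X}
    (hex : e.source ⊆ (chartAt (Model n) x).source)
    {η : EuclideanSpace ℂ (Fin n) [⋀^Fin 2]→L[ℝ] ℝ} (hη : ∀ y ∈ e.target, formIn Ω e y = η) :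
    ∃ C : ENNReal, ((symplecticVolume Ω).restrict e.source).map e =
      C • (volume.restrict e.target) := by
  set T := realModelIsometry n
  set e' := e.transHomeomorph T.toHomeomorph with he'
  have hse : e'.source = e.source := by simp [he']
  set w : ℝ := wedgePower (η.compContinuousLinearMap
    (T.symm.toContinuousLinearEquiv : Model n →L[ℝ] EuclideanSpace ℂ (Fin n)))
    fun i => EuclideanSpace.single i (1 : ℝ)
  have hem : MeasurableSet e.source := e.open_source.measurableSet
  have hae : AEMeasurable e ((symplecticVolume Ω).restrict e.source) :=
    e.continuousOn.aemeasurable hem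
  have hdens : ∀ y ∈ e'.target, volumeDensity Ω e' y = ENNReal.ofReal |w| := by
    intro y hy
    have hy1 : T.symm y ∈ e.target := by simpa [he'] using hy
    have hsymm : e'.symm y = e.symm (T.symm y) := rfl
    have hev : (fun y => e (e'.symm y)) =ᶠ[nhds y] T.symm := by
      filter_upwards [e'.open_target.mem_nhds hy] with z hz
      have hz1 : T.symm z ∈ e.target := by simpa [he'] using hz
      exact e.right_inv hz1
    rw [volumeDensity, he.transIsometry.formIn_transition Ω he hy
      (by rw [hsymm]; exact e.map_target hy1), hev.fderiv_eq, hev.eq_of_nhds, hη _ hy1]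
    rw [show fderiv ℝ T.symm y =
      (T.symm.toContinuousLinearEquiv : Model n →L[ℝ] EuclideanSpace ℂ (Fin n)) from
      T.symm.toContinuousLinearEquiv.hasFDerivAt.fderiv]
  refine ⟨ENNReal.ofReal |w|, Measure.ext fun B hB => ?_⟩
  have hA : MeasurableSet (e.source ∩ e ⁻¹' B) := by
    have h1 : Measurable (e.source.domRestrict e) :=
      (continuousOn_iff_continuous_domRestrict.1 e.continuousOn).measurable
    have h2 := hem.subtype_image (h1 hB)
    convert h2 using 1
    ext y
    simp [Set.domRestrict, and_comm]
  have himg : e' '' (e.source ∩ e ⁻¹' B) = T.symm ⁻¹' (B ∩ e.target) := by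
    ext y
    constructor
    · rintro ⟨z, ⟨hz1, hz2⟩, rfl⟩
      have : T.symm (e' z) = e z := T.symm_apply_apply (e z)
      rw [mem_preimage, this]
      exact ⟨hz2, e.map_source hz1⟩
    · rintro ⟨h1, h2⟩
      refine ⟨e.symm (T.symm y), ⟨e.map_target h2, ?_⟩, ?_⟩
      · rw [mem_preimage, e.right_inv h2]
        exact h1
      · change T (e (e.symm (T.symm y))) = y
        rw [e.right_inv h2, T.apply_symm_apply]
  have himeas := measurableSet_image_openPartialHomeomorph e' hA
    (by rw [hse]; exact inter_subset_left)
  rw [Measure.map_apply_of_aemeasurable hae hB, Measure.restrict_apply' hem, inter_comm,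
    symplecticVolume_apply_of_subset Ω he.transIsometry (x := x) (by rw [hse]; exact hex) hA
      (by rw [hse]; exact inter_subset_left)]
  rw [setLIntegral_congr_fun himeas (g := fun _ => ENNReal.ofReal |w|), setLIntegral_const,
    himg, T.symm.measurePreserving.measure_preimage
      (hB.inter e.open_target.measurableSet).nullMeasurableSet, Measure.smul_apply,
    Measure.restrict_apply hB, smul_eq_mul]
  rintro _ ⟨z, ⟨hz1, hz2⟩, rfl⟩
  exact hdens _ (e'.map_source (by rwa [hse]))

/-- Functions of vanishing integral in a Darboux chart have vanishing symplectic integral. -/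
lemma setIntegral_symplecticVolume_eq_zero (Ω : SymplecticForm n X)
    {e : OpenPartialHomeomorph X (EuclideanSpace ℂ (Fin n))} (he : IsSmoothChart n e) {x : X}
    (hex : e.source ⊆ (chartAt (Model n) x).source)
    {η : EuclideanSpace ℂ (Fin n) [⋀^Fin 2]→L[ℝ] ℝ} (hη : ∀ y ∈ e.target, formIn Ω e y = η)
    {q : EuclideanSpace ℂ (Fin n) → ℝ} (hq : Continuous q) (h0 : ∫ y in e.target, q y = 0) :
    ∫ x in e.source, q (e x) ∂(symplecticVolume Ω) = 0 := by
  obtain ⟨C, hC⟩ := exists_map_symplecticVolume Ω he hex hη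
  have hae : AEMeasurable e ((symplecticVolume Ω).restrict e.source) :=
    e.continuousOn.aemeasurable e.open_source.measurableSet
  rw [← integral_map hae hq.aestronglyMeasurable, hC, integral_smul_measure, h0, smul_zero]

end DarbouxVolume

section Bilinear

variable {V : Type*} [NormedAddCommGroup V] [NormedSpace ℝ V]

lemma norm_form_apply_le (η : V [⋀^Fin 2]→L[ℝ] ℝ) (u v : V) : ‖η ![u, v]‖ ≤ ‖η‖ * ‖u‖ * ‖v‖ := by
  refine (η.le_opNorm _).trans_eq ?_
  rw [Fin.prod_univ_two, mul_assoc]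
  rfl

/-- An alternating 2-form as a bilinear form. -/
def toBilin : (V [⋀^Fin 2]→L[ℝ] ℝ) →L[ℝ] V →L[ℝ] V →L[ℝ] ℝ :=
  LinearMap.mkContinuous
    { toFun := fun η => LinearMap.mkContinuous₂ (LinearMap.mk₂ ℝ (fun u v => η ![u, v])
        (fun u u' v => form_update_zero_add η u u' v)
        (fun c u v => form_update_zero_smul η c u v)
        (fun u v v' => form_update_one_add η v v' u)
        (fun c u v => form_update_one_smul η c v u)) ‖η‖ (norm_form_apply_le η)
      map_add' := fun η η' => by ext u v; rfl
      map_smul' := fun c η => by ext u v; rfl } 1 (fun η => by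
        rw [one_mul]
        exact LinearMap.mkContinuous₂_norm_le _ (norm_nonneg _) (norm_form_apply_le η))

lemma toBilin_apply (η : V [⋀^Fin 2]→L[ℝ] ℝ) (u v : V) : toBilin η u v = η ![u, v] := rfl

lemma toBilin_skew (η : V [⋀^Fin 2]→L[ℝ] ℝ) (u v : V) : toBilin η u v = -toBilin η v u :=
  form_skew η u v

lemma contDiffAt_toBilin {U : Type*} [NormedAddCommGroup U] [NormedSpace ℝ U]
    {η : U → V [⋀^Fin 2]→L[ℝ] ℝ} {y : U} (h : ContDiffAt ℝ ∞ η y) :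
    ContDiffAt ℝ ∞ (fun y => toBilin (η y)) y :=
  ContDiffAt.comp (g := toBilin (V := V)) y (toBilin (V := V)).contDiff.contDiffAt h

lemma cyclic_fderiv_of_extDeriv_eq_zero {η : V → V [⋀^Fin 2]→L[ℝ] ℝ} {y : V}
    (hd : DifferentiableAt ℝ η y) (h : extDeriv η y = 0) (a b c : V) :
    fderiv ℝ (fun y => toBilin (η y)) y a b c + fderiv ℝ (fun y => toBilin (η y)) y b c a +
      fderiv ℝ (fun y => toBilin (η y)) y c a b = 0 := by
  have hB : HasFDerivAt (fun y => toBilin (η y)) (toBilin.comp (fderiv ℝ η y)) y :=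
    toBilin.hasFDerivAt.comp y hd.hasFDerivAt
  rw [hB.fderiv]
  simp only [ContinuousLinearMap.comp_apply]
  have h1 := congrArg (fun T => T ![a, b, c]) h
  rw [extDeriv, ContinuousAlternatingMap.alternatizeUncurryFin_apply, Fin.sum_univ_three] at h1
  have e0 : (0 : Fin 3).removeNth ![a, b, c] = ![b, c] := by
    ext i; fin_cases i <;> rfl
  have e1 : (1 : Fin 3).removeNth ![a, b, c] = ![a, c] := by
    ext i; fin_cases i <;> rfl
  have e2 : (2 : Fin 3).removeNth ![a, b, c] = ![a, b] := by
    ext i; fin_cases i <;> rfl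
  rw [e0, e1, e2] at h1
  simp only [Fin.val_zero, Fin.val_one, Fin.val_two, pow_zero, pow_one, one_smul, neg_smul,
    even_two, Even.neg_pow, one_pow, Matrix.cons_val_zero, Matrix.cons_val_one, Matrix.cons_val] at h1
  have hz : (0 : V [⋀^Fin 3]→L[ℝ] ℝ) ![a, b, c] = 0 := rfl
  rw [hz] at h1
  rw [toBilin_skew (fderiv ℝ η y b) c a]
  simp only [toBilin_apply]
  linarith

end Bilinear

section Pullback

variable {V E : Type*} [NormedAddCommGroup V] [NormedSpace ℝ V] [NormedAddCommGroup E]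
  [NormedSpace ℝ E]

/-- Pullback of a bilinear form under a linear map. -/
def pullBilin (B : E →L[ℝ] E →L[ℝ] ℝ) (L : V →L[ℝ] E) : V →L[ℝ] V →L[ℝ] ℝ :=
  ((B.comp L).flip.comp L).flip

lemma pullBilin_apply (B : E →L[ℝ] E →L[ℝ] ℝ) (L : V →L[ℝ] E) (u v : V) :
    pullBilin B L u v = B (L u) (L v) := rfl

lemma contDiffAt_flip {A C : Type*} [NormedAddCommGroup A] [NormedSpace ℝ A]
    [NormedAddCommGroup C] [NormedSpace ℝ C] {T : V → A →L[ℝ] C →L[ℝ] ℝ} {y : V}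
    (hT : ContDiffAt ℝ ∞ T y) : ContDiffAt ℝ ∞ (fun y => (T y).flip) y :=
  ContDiffAt.comp (g := fun S : A →L[ℝ] C →L[ℝ] ℝ => S.flip) y
    (ContinuousLinearMap.flipₗᵢ ℝ A C ℝ).toContinuousLinearEquiv.contDiff.contDiffAt hT

lemma contDiffAt_pullBilin {B : E → E →L[ℝ] E →L[ℝ] ℝ} {g : V → E} {y : V}
    (hB : ContDiffAt ℝ ∞ B (g y)) (hg : ContDiffAt ℝ ∞ g y) :
    ContDiffAt ℝ ∞ (fun y => pullBilin (B (g y)) (fderiv ℝ g y)) y := by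
  have h1 : ContDiffAt ℝ ∞ (fun y => B (g y)) y := ContDiffAt.comp y hB hg
  have h2 : ContDiffAt ℝ ∞ (fderiv ℝ g) y := hg.fderiv_right (m := ∞) (by simp)
  exact contDiffAt_flip ((contDiffAt_flip (h1.clm_comp h2)).clm_comp h2)

/-- Pullbacks of closed 2-forms are closed. -/
lemma cyclic_fderiv_pullBilin {B : E → E →L[ℝ] E →L[ℝ] ℝ} {g : V → E} {y : V}
    (hB : DifferentiableAt ℝ B (g y)) (hg : ContDiffAt ℝ ∞ g y)
    (hskew : ∀ u v, B (g y) u v = -B (g y) v u)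
    (hclosed : ∀ a b c, fderiv ℝ B (g y) a b c + fderiv ℝ B (g y) b c a +
      fderiv ℝ B (g y) c a b = 0)
    (hdiff : DifferentiableAt ℝ (fun y => pullBilin (B (g y)) (fderiv ℝ g y)) y) (a b c : V) :
    fderiv ℝ (fun y => pullBilin (B (g y)) (fderiv ℝ g y)) y a b c +
      fderiv ℝ (fun y => pullBilin (B (g y)) (fderiv ℝ g y)) y b c a +
      fderiv ℝ (fun y => pullBilin (B (g y)) (fderiv ℝ g y)) y c a b = 0 := by
  have hg' : DifferentiableAt ℝ (fderiv ℝ g) y :=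
    (hg.fderiv_right (m := ∞) (by simp)).differentiableAt (by simp)
  set g'' := fderiv ℝ (fderiv ℝ g) y with hg''
  have hsymm : ∀ a b, g'' a b = g'' b a := fun a b =>
    (hg.isSymmSndFDerivAt (by
      rw [minSmoothness_of_isRCLikeNormedField]; exact WithTop.coe_le_coe.2 le_top)).eq a b
  have key : ∀ a b c, fderiv ℝ (fun y => pullBilin (B (g y)) (fderiv ℝ g y)) y a b c =
      fderiv ℝ B (g y) (fderiv ℝ g y a) (fderiv ℝ g y b) (fderiv ℝ g y c) +
      B (g y) (g'' a b) (fderiv ℝ g y c) + B (g y) (fderiv ℝ g y b) (g'' a c) := by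
    intro a b c
    have h1 : HasFDerivAt (fun y => pullBilin (B (g y)) (fderiv ℝ g y) b c) _ y :=
      (hdiff.hasFDerivAt.clm_apply (hasFDerivAt_const b y)).clm_apply (hasFDerivAt_const c y)
    have h2 : HasFDerivAt (fun y => B (g y) (fderiv ℝ g y b) (fderiv ℝ g y c)) _ y :=
      ((HasFDerivAt.comp y hB.hasFDerivAt (hg.differentiableAt (by simp)).hasFDerivAt).clm_apply
        (hg'.hasFDerivAt.clm_apply (hasFDerivAt_const b y))).clm_apply
        (hg'.hasFDerivAt.clm_apply (hasFDerivAt_const c y))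
    have h3 := congrArg (fun T : V →L[ℝ] ℝ => T a) (h1.unique h2)
    simp at h3
    rw [h3]
    ring
  rw [key, key, key]
  have e1 : B (g y) (fderiv ℝ g y c) (g'' b a) = -B (g y) (g'' a b) (fderiv ℝ g y c) := by
    rw [hskew, hsymm]
  have e2 : B (g y) (fderiv ℝ g y b) (g'' a c) = -B (g y) (g'' c a) (fderiv ℝ g y b) := by
    rw [hskew, hsymm]
  have e3 : B (g y) (fderiv ℝ g y a) (g'' c b) = -B (g y) (g'' b c) (fderiv ℝ g y a) := by
    rw [hskew, hsymm]
  have := hclosed (fderiv ℝ g y a) (fderiv ℝ g y b) (fderiv ℝ g y c)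
  rw [e1, e2, e3]
  linarith

end Pullback

section FormInChart

variable {n : ℕ} {X : Type*} [TopologicalSpace X] [ChartedSpace (Model n) X]
  [IsManifold (𝓡 (2 * n)) ∞ X]
  {V : Type*} [NormedAddCommGroup V] [NormedSpace ℝ V]

lemma bilinIn_transition (Ω : SymplecticForm n X) {e : OpenPartialHomeomorph X V}
    (he : IsSmoothChart n e) {x : X} {y : V} (hy : y ∈ e.target)
    (hex : e.symm y ∈ (chartAt (Model n) x).source) :
    toBilin (formIn Ω e y) = pullBilin
      (toBilin (formIn Ω (chartAt (Model n) x) (chartAt (Model n) x (e.symm y))))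
      (fderiv ℝ (fun y => chartAt (Model n) x (e.symm y)) y) := by
  rw [he.formIn_transition Ω (isSmoothChart_chartAt x) hy hex]
  ext u v
  rw [toBilin_apply, pullBilin_apply, toBilin_apply,
    ContinuousAlternatingMap.compContinuousLinearMap_apply]
  congr 1
  ext k
  fin_cases k <;> rfl

lemma contDiffAt_bilinIn_chartAt (Ω : SymplecticForm n X) (x : X) {y : Model n}
    (hy : y ∈ (chartAt (Model n) x).target) :
    ContDiffAt ℝ ∞ (formIn Ω (chartAt (Model n) x)) y := by
  have ht : (extChartAt (𝓡 (2 * n)) x).target = (chartAt (Model n) x).target := by simp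
  rw [← formInChart_eq]
  exact (Ω.smooth x).contDiffAt (by rw [ht]; exact (chartAt _ x).open_target.mem_nhds hy)

lemma eventually_bilinIn_transition (Ω : SymplecticForm n X) {e : OpenPartialHomeomorph X V}
    (he : IsSmoothChart n e) {x : X} (hex : e.source ⊆ (chartAt (Model n) x).source) {y : V}
    (hy : y ∈ e.target) :
    (fun y => toBilin (formIn Ω e y)) =ᶠ[nhds y] fun y => pullBilin
      (toBilin (formIn Ω (chartAt (Model n) x) (chartAt (Model n) x (e.symm y))))
      (fderiv ℝ (fun y => chartAt (Model n) x (e.symm y)) y) := by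
  filter_upwards [e.open_target.mem_nhds hy] with z hz
  exact bilinIn_transition Ω he hz (hex (e.map_target hz))

lemma contDiffAt_bilinIn (Ω : SymplecticForm n X) {e : OpenPartialHomeomorph X V}
    (he : IsSmoothChart n e) {x : X} (hex : e.source ⊆ (chartAt (Model n) x).source) {y : V}
    (hy : y ∈ e.target) : ContDiffAt ℝ ∞ (fun y => toBilin (formIn Ω e y)) y := by
  have hx := hex (e.map_target hy)
  refine ContDiffAt.congr_of_eventuallyEq ?_ (eventually_bilinIn_transition Ω he hex hy)
  exact contDiffAt_pullBilin (B := fun z => toBilin (formIn Ω (chartAt (Model n) x) z))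
    (contDiffAt_toBilin (contDiffAt_bilinIn_chartAt Ω x ((chartAt (Model n) x).map_source hx)))
    (he.contDiffAt_transition (isSmoothChart_chartAt x) hy hx)

lemma cyclic_fderiv_bilinIn (Ω : SymplecticForm n X) {e : OpenPartialHomeomorph X V}
    (he : IsSmoothChart n e) {x : X} (hex : e.source ⊆ (chartAt (Model n) x).source) {y : V}
    (hy : y ∈ e.target) (a b c : V) :
    fderiv ℝ (fun y => toBilin (formIn Ω e y)) y a b c +
      fderiv ℝ (fun y => toBilin (formIn Ω e y)) y b c a +
      fderiv ℝ (fun y => toBilin (formIn Ω e y)) y c a b = 0 := by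
  have hx := hex (e.map_target hy)
  have hxt := (chartAt (Model n) x).map_source hx
  have hev := eventually_bilinIn_transition Ω he hex hy
  have hs := contDiffAt_bilinIn_chartAt Ω x hxt
  have ht : (extChartAt (𝓡 (2 * n)) x).target = (chartAt (Model n) x).target := by simp
  rw [hev.fderiv_eq]
  refine cyclic_fderiv_pullBilin (B := fun z => toBilin (formIn Ω (chartAt (Model n) x) z))
    (g := fun y => chartAt (Model n) x (e.symm y)) ((contDiffAt_toBilin hs).differentiableAt (by simp))
    (he.contDiffAt_transition (isSmoothChart_chartAt x) hy hx) (fun u v => toBilin_skew _ u v)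
    (fun a b c => cyclic_fderiv_of_extDeriv_eq_zero (hs.differentiableAt (by simp)) ?_ a b c)
    (((contDiffAt_bilinIn Ω he hex hy).differentiableAt (by simp)).congr_of_eventuallyEq hev.symm)
    a b c
  exact Ω.closed x _ (by rw [ht]; exact hxt)

end FormInChart

section FlowInChart

variable {n : ℕ} {X : Type*} [TopologicalSpace X] [ChartedSpace (Model n) X]
  {V : Type*} [NormedAddCommGroup V] [NormedSpace ℝ V]

lemma velocity_eq_of_chart {e : OpenPartialHomeomorph X V} (he : IsSmoothChart n e)
    {h : ℝ → X → X} {x : X} {c : ℝ → V} {t : ℝ} {v : V} (ht : t ∈ Icc (0 : ℝ) 1)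
    (hc : ∀ τ ∈ Icc (0 : ℝ) 1, h τ x = e.symm (c τ)) (hct : c t ∈ e.target)
    (hcd : HasDerivWithinAt c v (Icc 0 1) t) :
    (velocity (n := n) h t x : Model n) = mfderiv 𝓘(ℝ, V) (𝓡 (2 * n)) e.symm (c t) v := by
  have h1 := ((he.smooth_symm.contMDiffAt (e.open_target.mem_nhds hct)).mdifferentiableAt
    (by simp)).hasMFDerivAt
  have h2 : HasMFDerivWithinAt 𝓘(ℝ, ℝ) 𝓘(ℝ, V) c (Icc 0 1) t
      (ContinuousLinearMap.toSpanSingleton ℝ v) :=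
    hasMFDerivWithinAt_iff_hasFDerivWithinAt.2 hcd.hasFDerivWithinAt
  have h3 := HasMFDerivWithinAt.congr_mono (f₁ := fun τ => h τ x)
    (HasMFDerivAt.comp_hasMFDerivWithinAt t h1 h2) hc (hc t ht) Subset.rfl
  have h4 := h3.mfderivWithin
    (uniqueDiffOn_Icc zero_lt_one t ht).uniqueMDiffWithinAt
  have h5 := congrArg (fun T : ℝ →L[ℝ] Model n => T 1) h4
  refine h5.trans ?_
  change (mfderiv 𝓘(ℝ, V) (𝓡 (2 * n)) e.symm (c t))
    (ContinuousLinearMap.toSpanSingleton ℝ v (1 : ℝ)) = _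
  rw [ContinuousLinearMap.toSpanSingleton_apply, one_smul]

lemma mfderiv_comp_symm_apply {e : OpenPartialHomeomorph X V} (he : IsSmoothChart n e) {y : V}
    (hy : y ∈ e.target) {H : X → ℝ} (hH : MDifferentiableAt (𝓡 (2 * n)) 𝓘(ℝ, ℝ) H (e.symm y))
    (w : V) : mfderiv (𝓡 (2 * n)) 𝓘(ℝ, ℝ) H (e.symm y)
      (mfderiv 𝓘(ℝ, V) (𝓡 (2 * n)) e.symm y w) = fderiv ℝ (fun y => H (e.symm y)) y w := by
  have h1 := ((he.smooth_symm.contMDiffAt (e.open_target.mem_nhds hy)).mdifferentiableAt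
    (by simp))
  have h2 := mfderiv_comp y hH h1
  rw [mfderiv_eq_fderiv] at h2
  exact (congrArg (fun T : V →L[ℝ] ℝ => T w) h2).symm

lemma exists_mfderiv_symm_eq {e : OpenPartialHomeomorph X V} (he : IsSmoothChart n e) {y : V}
    (hy : y ∈ e.target) (w : Model n) :
    ∃ w' : V, mfderiv 𝓘(ℝ, V) (𝓡 (2 * n)) e.symm y w' = w := by
  have h1 := ((he.smooth_symm.contMDiffAt (e.open_target.mem_nhds hy)).mdifferentiableAt
    (by simp))
  have hs : e.symm y ∈ e.source := e.map_target hy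
  have h2 := ((he.smooth.contMDiffAt (e.open_source.mem_nhds hs)).mdifferentiableAt (by simp))
  have hright : e (e.symm y) = y := e.right_inv hy
  have h3 : mfderiv (𝓡 (2 * n)) (𝓡 (2 * n)) (e.symm ∘ e) (e.symm y) =
      (mfderiv 𝓘(ℝ, V) (𝓡 (2 * n)) e.symm (e (e.symm y))).comp
        (mfderiv (𝓡 (2 * n)) 𝓘(ℝ, V) e (e.symm y)) :=
    mfderiv_comp (e.symm y) (by rw [hright]; exact h1) h2
  have h4 : (e.symm ∘ e) =ᶠ[nhds (e.symm y)] id := by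
    filter_upwards [e.open_source.mem_nhds hs] with z hz
    exact e.left_inv hz
  rw [h4.mfderiv_eq, mfderiv_id] at h3
  refine ⟨mfderiv (𝓡 (2 * n)) 𝓘(ℝ, V) e (e.symm y) w, ?_⟩
  have h5 := congrArg (fun T : Model n →L[ℝ] Model n => T w) h3
  rw [hright] at h5
  exact h5.symm

/-- The equation of a Hamiltonian flow, in a chart. -/
lemma flow_iff_in_chart (Ω : SymplecticForm n X) {e : OpenPartialHomeomorph X V}
    (he : IsSmoothChart n e) {h : ℝ → X → X} {x : X} {c : ℝ → V} {t : ℝ} {v : V}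
    (ht : t ∈ Icc (0 : ℝ) 1) (hc : ∀ τ ∈ Icc (0 : ℝ) 1, h τ x = e.symm (c τ)) (hct : c t ∈ e.target)
    (hcd : HasDerivWithinAt c v (Icc 0 1) t) {H : X → ℝ}
    (hH : MDifferentiableAt (𝓡 (2 * n)) 𝓘(ℝ, ℝ) H (e.symm (c t))) :
    (∀ w : TangentSpace (𝓡 (2 * n)) (h t x), Ω.form (h t x) ![velocity h t x, w] =
        -mfderiv (𝓡 (2 * n)) 𝓘(ℝ, ℝ) H (h t x) w) ↔
      ∀ w : V, formIn Ω e (c t) ![v, w] = -fderiv ℝ (fun y => H (e.symm y)) (c t) w := by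
  have hv := velocity_eq_of_chart he ht hc hct hcd
  have hL : ∀ w : V, Ω.form (h t x) ![velocity h t x,
      (mfderiv 𝓘(ℝ, V) (𝓡 (2 * n)) e.symm (c t) w : Model n)] = formIn Ω e (c t) ![v, w] := by
    intro w
    rw [formIn_apply]
    exact (congrArg (fun a : Model n => Ω.form (h t x)
      ![a, (mfderiv 𝓘(ℝ, V) (𝓡 (2 * n)) e.symm (c t) w : Model n)]) hv).trans
      (form_congr Ω (hc t ht) _ _)
  have hcong : ∀ (p p' : X), p = p' → ∀ w : Model n, (mfderiv (𝓡 (2 * n)) 𝓘(ℝ, ℝ) H p w : ℝ) =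
      mfderiv (𝓡 (2 * n)) 𝓘(ℝ, ℝ) H p' w := by
    rintro p _ rfl w
    rfl
  have hR : ∀ w : V, (mfderiv (𝓡 (2 * n)) 𝓘(ℝ, ℝ) H (h t x)
      (mfderiv 𝓘(ℝ, V) (𝓡 (2 * n)) e.symm (c t) w : Model n) : ℝ) =
      fderiv ℝ (fun y => H (e.symm y)) (c t) w := fun w =>
    (hcong _ _ (hc t ht) _).trans (mfderiv_comp_symm_apply he hct hH w)
  constructor
  · intro hf w
    rw [← hL, ← hR]
    exact hf _
  · intro hf w
    obtain ⟨w', hw'⟩ := exists_mfderiv_symm_eq he hct w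
    rw [← hw']
    exact (hL w').trans ((hf w').trans (congrArg Neg.neg (hR w').symm))

end FlowInChart

section LinearNormalForm

variable {n : ℕ}

/-- The real coordinates of a complex vector. -/
def realCoords (n : ℕ) : EuclideanSpace ℂ (Fin n) →ₗ[ℝ] (Fin n ⊕ Fin n → ℝ) where
  toFun x := Sum.elim (fun j => (x j).re) fun j => (x j).im
  map_add' x y := by
    ext (j | j) <;> simp
  map_smul' c x := by
    ext (j | j) <;> simp

lemma rotationMatrix_mulVec_realCoords (a : Fin n → ℤ) (t : ℝ) (x : EuclideanSpace ℂ (Fin n)) :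
    rotationMatrix (fun j => 2 * Real.pi * a j * t) *ᵥ realCoords n x =
      realCoords n (rotation a t x) := by
  ext (j | j)
  · simp [rotationMatrix, realCoords, rotation, diagOp_apply, Matrix.fromBlocks_mulVec,
      Matrix.mulVec_diagonal, Complex.exp_re, Complex.exp_im]
    ring
  · simp [rotationMatrix, realCoords, rotation, diagOp_apply, Matrix.fromBlocks_mulVec,
      Matrix.mulVec_diagonal, Complex.exp_re, Complex.exp_im]
    ring

lemma stdForm_eq_realCoords (u v : EuclideanSpace ℂ (Fin n)) :
    stdForm _ u v = -(realCoords n u ⬝ᵥ J (Fin n) ℝ *ᵥ realCoords n v) := by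
  rw [stdForm_apply, PiLp.inner_apply, Complex.im_sum]
  simp only [J, realCoords, LinearMap.coe_mk, AddHom.coe_mk, Matrix.fromBlocks_mulVec,
    dotProduct, Fintype.sum_sum_type]
  rw [← Finset.sum_add_distrib, ← Finset.sum_neg_distrib]
  refine Finset.sum_congr rfl fun j _ => ?_
  simp [Matrix.neg_mulVec, Matrix.one_mulVec]
  ring

/-- Normal form of a Maslov-zero linear symplectic circle action. -/
theorem exists_linear_normal_form {V : Type*} [NormedAddCommGroup V] [NormedSpace ℝ V]
    [FiniteDimensional ℝ V] (b : Module.Basis (Fin n ⊕ Fin n) ℝ V) {η : V →L[ℝ] V →L[ℝ] ℝ}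
    (hη : ∀ k l, η (b k) (b l) = -J (Fin n) ℝ k l) {B : ℝ → V →L[ℝ] V}
    (hadd : ∀ s t v, B (s + t) v = B s (B t v)) (h0 : ∀ v, B 0 v = v) (h1 : ∀ v, B 1 v = v)
    (hd : ∀ v, DifferentiableAt ℝ (fun t => B t v) 0)
    (hm : HasMaslovIndex (fun t => LinearMap.toMatrix b b (B t).toLinearMap) 0) :
    ∃ (a : Fin n → ℤ) (T : EuclideanSpace ℂ (Fin n) ≃L[ℝ] V), ∑ j, a j = 0 ∧
      (∀ t x, T (rotation a t x) = B t (T x)) ∧ ∀ u v, η (T u) (T v) = stdForm _ u v := by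
  set A : ℝ → Matrix (Fin n ⊕ Fin n) (Fin n ⊕ Fin n) ℝ :=
    fun t => LinearMap.toMatrix b b (B t).toLinearMap with hA
  have hAadd : ∀ s t, A (s + t) = A s * A t := fun s t => by
    rw [hA]
    simp only
    rw [← LinearMap.toMatrix_comp]
    congr 1
    ext v
    exact hadd s t v
  have hA0 : A 0 = 1 := by
    rw [hA]
    simp only
    rw [← LinearMap.toMatrix_id b]
    congr 1
    ext v
    exact h0 v
  have hA1 : A 1 = 1 := by
    rw [hA]
    simp only
    rw [← LinearMap.toMatrix_id b]
    congr 1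
    ext v
    exact h1 v
  have hnat : ∀ (m : ℕ) (t : ℝ), A (t + m) = A t := by
    intro m
    induction m with
    | zero => simp
    | succ m ih =>
      intro t
      push_cast
      rw [← add_assoc, hAadd, ih, hA1, Matrix.mul_one]
  have hsp : ∀ t, A t ∈ Matrix.symplecticGroup (Fin n) ℝ := by
    intro t
    have hfr : A t = A (Int.fract t) := by
      obtain ⟨m, hm⟩ | ⟨m, hm⟩ : (∃ m : ℕ, ⌊t⌋ = m) ∨ ∃ m : ℕ, ⌊t⌋ = -m := by
        rcases Int.eq_nat_or_neg ⌊t⌋ with ⟨m, h | h⟩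
        · exact Or.inl ⟨m, h⟩
        · exact Or.inr ⟨m, h⟩
      · rw [← hnat m (Int.fract t)]
        congr 1
        have := Int.fract_add_floor t
        rw [hm] at this
        push_cast at this
        exact this.symm
      · rw [← hnat m t]
        congr 1
        have := Int.fract_add_floor t
        rw [hm] at this
        push_cast at this
        linarith
    rw [hfr]
    exact hm.1 _ ⟨Int.fract_nonneg t, (Int.fract_lt_one t).le⟩
  have hder : ∃ L, HasMatrixDerivAt A L 0 := by
    refine ⟨Matrix.of fun i j => deriv (fun t => A t i j) 0, fun i j => ?_⟩
    have h2 : DifferentiableAt ℝ (fun t => A t i j) 0 := by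
      have : (fun t => A t i j) = fun t => b.repr (B t (b j)) i := by
        funext t
        rw [hA]
        simp only
        rw [LinearMap.toMatrix_apply]
        rfl
      rw [this]
      set ℓ : V →L[ℝ] ℝ := LinearMap.toContinuousLinearMap (b.coord i)
      exact ℓ.differentiableAt.comp (0 : ℝ) (hd (b j))
    exact h2.hasDerivAt
  obtain ⟨L, hL⟩ := hder
  obtain ⟨C, hC, α, hα⟩ := symplectic_circle_normal_form hAadd hA0 hA1 hL hsp
  obtain ⟨a, ha, hsum⟩ := weights_of_maslov_zero hm hA1 hC hα
  set T₀ : EuclideanSpace ℂ (Fin n) →ₗ[ℝ] V :=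
    b.equivFun.symm.toLinearMap ∘ₗ C.mulVecLin ∘ₗ realCoords n with hT₀
  have hT₀r : ∀ x, ⇑(b.repr (T₀ x)) = C *ᵥ realCoords n x := fun x => by
    have := b.equivFun.apply_symm_apply (C *ᵥ realCoords n x)
    exact this
  have hform : ∀ u v, η (T₀ u) (T₀ v) = stdForm _ u v := by
    intro u v
    have hexp : ∀ p q : V, η p q = -(⇑(b.repr p) ⬝ᵥ J (Fin n) ℝ *ᵥ ⇑(b.repr q)) := by
      intro p q
      conv_lhs => rw [← b.sum_repr p, ← b.sum_repr q]
      simp only [map_sum, map_smul, _root_.smul_apply, _root_.sum_apply, smul_eq_mul,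
        hη, dotProduct, Matrix.mulVec, Finset.mul_sum, ← Finset.sum_neg_distrib]
      rw [Finset.sum_comm]
      refine Finset.sum_congr rfl fun k _ => Finset.sum_congr rfl fun l _ => ?_
      ring
    rw [hexp, hT₀r, hT₀r, stdForm_eq_realCoords]
    congr 1
    rw [Matrix.mulVec_mulVec, Matrix.dotProduct_mulVec, Matrix.vecMul_mulVec, ← Matrix.mul_assoc,
      SymplecticGroup.mem_iff'.1 hC, ← Matrix.dotProduct_mulVec]
  have hinj : Function.Injective T₀ := by
    rw [← LinearMap.ker_eq_bot, LinearMap.ker_eq_bot']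
    intro u hu
    refine eq_zero_of_stdForm_eq_zero fun y => ?_
    rw [← hform, hu, map_zero, _root_.zero_apply]
  have hrank : Module.finrank ℝ (EuclideanSpace ℂ (Fin n)) = Module.finrank ℝ V := by
    rw [Module.finrank_eq_card_basis b, ← Module.finrank_mul_finrank ℝ ℂ,
      Complex.finrank_real_complex, finrank_euclideanSpace]
    simp [two_mul]
  refine ⟨a, (LinearEquiv.ofInjectiveOfFinrankEq T₀ hinj hrank).toContinuousLinearEquiv, hsum,
    fun t x => ?_, fun u v => hform u v⟩
  change T₀ (rotation a t x) = B t (T₀ x)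
  apply b.repr.injective
  ext k
  rw [hT₀r, ← rotationMatrix_mulVec_realCoords, Matrix.mulVec_mulVec]
  have e1 := LinearMap.toMatrix_mulVec_repr b b (B t).toLinearMap (T₀ x)
  have e2 : (fun j => 2 * Real.pi * a j * t) = fun j => α j * t := by
    funext j
    rw [ha j]
  rw [e2, ← hα t, ← Matrix.mulVec_mulVec, ← hT₀r, hA]
  exact congrFun e1 k

end LinearNormalForm

section Linearization

universe u

variable {E : Type u} [NormedAddCommGroup E] [NormedSpace ℝ E] [CompleteSpace E]
  {W : Type u} [NormedAddCommGroup W] [InnerProductSpace ℂ W]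
  [FiniteDimensional ℂ W]

lemma IsUnitaryFlow.contDiff_neg {S : W →L[ℂ] W} {ρ : ℝ → W →L[ℂ] W} (hρ : IsUnitaryFlow S ρ) :
    ContDiff ℝ ∞ fun p : ℝ × W => ρ (-p.1) p.2 :=
  ContDiff.comp (g := fun p : ℝ × W => ρ p.1 p.2) (f := fun p : ℝ × W => (-p.1, p.2)) hρ.smooth
    (contDiff_fst.neg.prodMk contDiff_snd)

/-- Linearization of a smooth local circle action at a fixed point. -/
theorem exists_equivariant_linearization {S : W →L[ℂ] W} {ρ : ℝ → W →L[ℂ] W}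
    (hρ : IsUnitaryFlow S ρ) (hρ1 : ∀ x, ρ 1 x = x) {g : ℝ → E → E} {N : Set (ℝ × E)}
    (hN : IsOpen N) (hg : ContDiffOn ℝ ∞ (fun p : ℝ × E => g p.1 p.2) N) {y₀ : E}
    (hy₀ : ∀ t, (t, y₀) ∈ N) (hfix : ∀ t, g t y₀ = y₀)
    (hNper : ∀ t y, (t + 1, y) ∈ N ↔ (t, y) ∈ N) (hper : ∀ t y, g (t + 1) y = g t y)
    (hadd : ∀ s t y, (t, y) ∈ N → (s + t, y) ∈ N → (s, g t y) ∈ N ∧ g (s + t) y = g s (g t y))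
    (T : W ≃L[ℝ] E) (hT : ∀ t x, T (ρ t x) = fderiv ℝ (g t) y₀ (T x)) :
    ∃ e : OpenPartialHomeomorph E W, y₀ ∈ e.source ∧ e y₀ = 0 ∧ ContDiffOn ℝ ∞ e e.source ∧
      ContDiffOn ℝ ∞ e.symm e.target ∧ HasFDerivAt e (T.symm : E →L[ℝ] W) y₀ ∧
      ∃ R > 0, Metric.ball 0 R ⊆ e.target ∧ ∀ x ∈ Metric.ball (0 : W) R, ∀ t,
        (t, e.symm x) ∈ N ∧ g t (e.symm x) = e.symm (ρ t x) := by
  have hNat : ∀ (P : ℝ → Prop), (∀ t, P (t + 1) ↔ P t) → (∀ t ∈ Icc (0 : ℝ) 1, P t) →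
      ∀ t, P t := by
    intro P hP h t
    have h1 : ∀ (m : ℕ) t, P (t + m) ↔ P t := by
      intro m
      induction m with
      | zero => simp
      | succ m ih =>
        intro t
        push_cast
        rw [← add_assoc, hP, ih]
    have h2 := h _ ⟨Int.fract_nonneg t, (Int.fract_lt_one t).le⟩
    have h3 := Int.fract_add_floor t
    rcases Int.eq_nat_or_neg ⌊t⌋ with ⟨m, hm | hm⟩
    · rw [hm] at h3
      push_cast at h3
      rw [← h3]
      exact (h1 m _).2 h2
    · rw [hm] at h3
      push_cast at h3
      rw [← h1 m, ← h3]
      convert h2 using 1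
      ring
  have tube : ∀ {O : Set (ℝ × E)}, IsOpen O → IsOpen {y | ∀ t ∈ Icc (0 : ℝ) 1, (t, y) ∈ O} := by
    intro O hO
    rw [isOpen_iff_eventually]
    intro y hy
    refine isCompact_Icc.eventually_forall_of_forall_eventually
      (P := fun y t => (t, y) ∈ O) fun t ht => ?_
    exact (hO.preimage continuous_swap).mem_nhds (hy t ht)
  have : CompleteSpace W := FiniteDimensional.complete ℂ W
  set U : Set E := {y | ∀ t ∈ Icc (0 : ℝ) 1, (t, y) ∈ N} with hU
  have hUo : IsOpen U := tube hN
  have hUN : ∀ y ∈ U, ∀ t, (t, y) ∈ N := fun y hy =>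
    hNat (fun t => (t, y) ∈ N) (fun t => hNper t y) hy
  have hyU : y₀ ∈ U := fun t _ => hy₀ t
  set G : ℝ × E → W := fun p => ρ (-p.1) (T.symm (g p.1 p.2 - y₀)) with hG
  have hGc : ContDiffOn ℝ ∞ G N := by
    refine ContDiff.comp_contDiffOn (g := fun p : ℝ × W => ρ (-p.1) p.2)
      (f := fun p : ℝ × E => (p.1, T.symm (g p.1 p.2 - y₀))) hρ.contDiff_neg ?_
    exact contDiff_fst.contDiffOn.prodMk
      (T.symm.contDiff.comp_contDiffOn (hg.sub contDiffOn_const))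
  set Θ : E → W := fun y => ∫ t in (0 : ℝ)..1, G (t, y) with hΘ
  have hΘat : ∀ y ∈ U, _ := fun y hy => contDiffAt_parametric_integral hN hGc hy
  have hΘc : ContDiffOn ℝ ∞ Θ U := fun y hy => (hΘat y hy).1.contDiffWithinAt
  have hρinv : ∀ t x, ρ (-t) (ρ t x) = x := fun t x => by
    rw [← hρ.add, neg_add_cancel, hρ.zero]
  have hΘd : HasFDerivAt Θ (T.symm : E →L[ℝ] W) y₀ := by
    have h1 := (hΘat y₀ hyU).1.differentiableAt (by simp)
    have h2 : fderiv ℝ Θ y₀ = (T.symm : E →L[ℝ] W) := by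
      ext u
      rw [(hΘat y₀ hyU).2 u]
      have : ∀ t : ℝ, fderiv ℝ G (t, y₀) (0, u) = T.symm u := by
        intro t
        have hd : DifferentiableAt ℝ G (t, y₀) :=
          (hGc.contDiffAt (hN.mem_nhds (hy₀ t))).differentiableAt (by simp)
        have hi : HasFDerivAt (fun y : E => (t, y)) (ContinuousLinearMap.inr ℝ ℝ E) y₀ :=
          hasFDerivAt_prodMk_right t y₀
        have hgd : DifferentiableAt ℝ (g t) y₀ :=
          ((hg.contDiffAt (hN.mem_nhds (hy₀ t))).differentiableAt (by simp)).comp y₀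
            hi.differentiableAt
        have c1 : HasFDerivAt (fun y => G (t, y))
            ((fderiv ℝ G (t, y₀)).comp (ContinuousLinearMap.inr ℝ ℝ E)) y₀ :=
          HasFDerivAt.comp y₀ (f := fun y : E => (t, y)) hd.hasFDerivAt hi
        have c2 : HasFDerivAt (fun y => G (t, y))
            ((((ρ (-t)).restrictScalars ℝ).comp (T.symm : E →L[ℝ] W)).comp (fderiv ℝ (g t) y₀)) y₀ :=
          (((ρ (-t)).restrictScalars ℝ).comp (T.symm : E →L[ℝ] W)).hasFDerivAt.comp y₀
            (hgd.hasFDerivAt.sub_const y₀)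
        have c3 := congrArg (fun L : E →L[ℝ] W => L u) (c1.unique c2)
        have c4 : fderiv ℝ G (t, y₀) (0, u) = ρ (-t) (T.symm (fderiv ℝ (g t) y₀ u)) := c3
        have c5 := hT t (T.symm u)
        rw [T.apply_symm_apply] at c5
        rw [c4, ← c5, T.symm_apply_apply, hρinv]
      simp [this]
    rw [← h2]
    exact h1.hasFDerivAt
  have hΘ0 : Θ y₀ = 0 := by
    simp [hΘ, hG, hfix]
  have hgU : ∀ y ∈ U, ∀ s, g s y ∈ U := fun y hy s t _ =>
    (hadd t s y (hUN y hy s) (hUN y hy _)).1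
  have hequi : ∀ y ∈ U, ∀ s, Θ (g s y) = ρ s (Θ y) := by
    intro y hy s
    have hcont : Continuous fun t : ℝ => G (t, y) := by
      rw [← continuousOn_univ]
      exact hGc.continuousOn.comp (by fun_prop) fun t _ => hUN y hy t
    have h1 : ∀ t, G (t, g s y) = ρ s (G (t + s, y)) := by
      intro t
      simp only [hG]
      rw [← (hadd t s y (hUN y hy s) (hUN y hy _)).2, ← hρ.add]
      congr 2
      ring
    have hp : Function.Periodic (fun t => G (t, y)) 1 := by
      intro t
      simp only [hG]
      have hm := hρinv 1 (T.symm (g t y - y₀))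
      rw [hρ1] at hm
      rw [hper, neg_add, hρ.add, hm]
    simp only [hΘ, h1]
    have h2 := ((ρ s).restrictScalars ℝ).intervalIntegral_comp_comm
      (μ := volume) ((hcont.comp (continuous_add_const s)).intervalIntegrable 0 1)
    have h3 : (∫ t in (0 : ℝ)..1, G (t + s, y)) = ∫ t in (0 : ℝ)..1, G (t, y) := by
      rw [intervalIntegral.integral_comp_add_right (fun t => G (t, y)) s, add_comm 1 s, zero_add]
      have := hp.intervalIntegral_add_eq s 0
      rw [zero_add] at this
      exact this
    refine h2.trans ?_
    exact congrArg (ρ s) h3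
  obtain ⟨e, hys, hsU, heΘ, hes⟩ := exists_smooth_localInverse hUo hΘc hyU
    (f' := T.symm) hΘd
  have heΘ' : (e : E → W) = Θ := funext heΘ
  have hec : ContDiffOn ℝ ∞ e e.source := by
    rw [heΘ']
    exact hΘc.mono hsU
  set O : Set (ℝ × E) := N ∩ (fun p : ℝ × E => g p.1 p.2) ⁻¹' e.source with hO
  have hOo : IsOpen O := hg.continuousOn.isOpen_inter_preimage hN e.open_source
  set Q : Set E := e.source ∩ {y | ∀ t ∈ Icc (0 : ℝ) 1, (t, y) ∈ O} with hQ
  have hQo : IsOpen Q := e.open_source.inter (tube hOo)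
  have hyQ : y₀ ∈ Q := ⟨hys, fun t _ => ⟨hy₀ t, by rw [mem_preimage, hfix]; exact hys⟩⟩
  have hI : IsOpen (e '' Q) := e.isOpen_image_of_subset_source hQo inter_subset_left
  have h0I : (0 : W) ∈ e '' Q := ⟨y₀, hyQ, by rw [heΘ, hΘ0]⟩
  obtain ⟨R, hR, hRs⟩ := Metric.isOpen_iff.1 hI 0 h0I
  refine ⟨e, hys, by rw [heΘ, hΘ0], hec, hes, by rw [heΘ']; exact hΘd, R, hR, fun x hx => ?_,
    fun x hx t => ?_⟩
  · obtain ⟨y, hy, rfl⟩ := hRs hx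
    exact e.map_source hy.1
  · obtain ⟨y, hy, rfl⟩ := hRs hx
    rw [e.left_inv hy.1]
    have hmem : (t, y) ∈ O := by
      refine hNat (fun t => (t, y) ∈ O) (fun t => ?_) hy.2 t
      simp only [hO, mem_inter_iff, mem_preimage, hNper, hper]
    refine ⟨hmem.1, ?_⟩
    rw [heΘ, ← hequi y (hsU hy.1), ← heΘ]
    exact (e.left_inv hmem.2).symm

/-- A closed 2-form is invariant under linear flows which are Hamiltonian with respect to it. -/
theorem form_invariant_of_hamiltonian {S : W →L[ℂ] W} {ρ : ℝ → W →L[ℂ] W}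
    (hρ : IsUnitaryFlow S ρ) {η : W → W →L[ℝ] W →L[ℝ] ℝ} {H : W → ℝ} {R : ℝ}
    (hη : ContDiffOn ℝ ∞ η (Metric.ball 0 R)) (hH : ContDiffOn ℝ ∞ H (Metric.ball 0 R))
    (hskew : ∀ x ∈ Metric.ball (0 : W) R, ∀ u v, η x u v = - η x v u)
    (hclosed : ∀ x ∈ Metric.ball (0 : W) R, ∀ a b c, fderiv ℝ η x a b c + fderiv ℝ η x b c a +
      fderiv ℝ η x c a b = 0)
    (hcon : ∀ x ∈ Metric.ball (0 : W) R, η x (S x) = -fderiv ℝ H x) (τ : ℝ) {x : W}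
    (hx : x ∈ Metric.ball (0 : W) R) (u v : W) : η (ρ τ x) (ρ τ u) (ρ τ v) = η x u v := by
  have hball : IsOpen (Metric.ball (0 : W) R) := Metric.isOpen_ball
  have hηd : ∀ x ∈ Metric.ball (0 : W) R, DifferentiableAt ℝ η x := fun x hx =>
    (hη.contDiffAt (hball.mem_nhds hx)).differentiableAt (by simp)
  have hHd : ∀ x ∈ Metric.ball (0 : W) R, ContDiffAt ℝ ∞ H x := fun x hx =>
    hH.contDiffAt (hball.mem_nhds hx)
  have hHd' : ∀ x ∈ Metric.ball (0 : W) R, DifferentiableAt ℝ (fun x => τ • fderiv ℝ H x) x :=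
    fun x hx => (((hHd x hx).fderiv_right (m := ∞) (by simp)).differentiableAt
      (by simp)).const_smul τ
  set L : W →L[ℝ] W := τ • S.restrictScalars ℝ with hL
  have hcurve : ∀ (w : W) (s : ℝ), HasDerivAt (fun s => ρ (s * τ) w) (L (ρ (s * τ) w)) s := by
    intro w s
    have h1 := HasDerivAt.scomp s (hρ.deriv (s * τ) w) ((hasDerivAt_id s).mul_const τ)
    rw [one_mul, hρ.comm] at h1
    exact h1
  have hVd : ∀ p : ℝ × W, HasFDerivAt (fun p : ℝ × W => L p.2)
      (L.comp (ContinuousLinearMap.snd ℝ ℝ W)) p := fun p =>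
    (L.comp (ContinuousLinearMap.snd ℝ ℝ W)).hasFDerivAt
  have key := form_constant_along_flow (N := univ ×ˢ Metric.ball (0 : W) R)
    (Ω := fun p => η p.2) (V := fun p => L p.2) (β := fun p => τ • fderiv ℝ H p.2)
    (c := fun s => ρ (s * τ) x) (U₁ := fun s => ρ (s * τ) u) (U₂ := fun s => ρ (s * τ) v)
    (isOpen_univ.prod hball)
    (fun p hp => ((hηd p.2 hp.2).comp p differentiableAt_snd).differentiableWithinAt)
    (fun p _ => (hVd p).differentiableAt.differentiableWithinAt)
    (fun p hp => (DifferentiableAt.comp (g := fun x => τ • fderiv ℝ H x) p (hHd' p.2 hp.2)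
      differentiableAt_snd).differentiableWithinAt)
    (fun p hp => hskew p.2 hp.2)
    (fun p hp => by
      simp only [hL]
      change η p.2 (τ • S p.2) = _
      rw [map_smul, hcon p.2 hp.2, smul_neg])
    (fun p hp a b c => by
      rw [fderiv_comp_snd (hηd p.2 hp.2), fderiv_comp_snd (hηd p.2 hp.2),
        fderiv_comp_snd (hηd p.2 hp.2)]
      exact hclosed p.2 hp.2 a b c)
    (fun p hp a b => by
      rw [fderiv_comp_snd (hηd p.2 hp.2), fderiv_comp_snd (g := fun x => τ • fderiv ℝ H x)
        (hHd' p.2 hp.2), fderiv_comp_snd (g := fun x => τ • fderiv ℝ H x)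
        (hHd' p.2 hp.2), fderiv_fun_const_smul (((hHd p.2 hp.2).fderiv_right (m := ∞)
          (by simp)).differentiableAt (by simp))]
      have hs := ((hHd p.2 hp.2).isSymmSndFDerivAt (by
        rw [minSmoothness_of_isRCLikeNormedField]; exact WithTop.coe_le_coe.2 le_top)).eq a b
      simp only [_root_.smul_apply]
      simp [hs])
    (fun s _ => ⟨mem_univ _, by
      rw [mem_ball_zero_iff]
      change ‖ρ (s * τ) x‖ < R
      rw [hρ.norm]; exact mem_ball_zero_iff.1 hx⟩)
    (fun s _ => (hcurve x s).hasDerivWithinAt)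
    (fun s _ => by
      rw [(hVd _).fderiv]
      exact (hcurve u s).hasDerivWithinAt)
    (fun s _ => by
      rw [(hVd _).fderiv]
      exact (hcurve v s).hasDerivWithinAt)
  simpa [hρ.zero] using key

end Linearization

section FixedPoint

variable {n : ℕ} {X : Type*} [TopologicalSpace X] [ChartedSpace (Model n) X]

lemma differentialAtFixedPoint_apply {g : X → X} {z : X} (hz : g z = z) (v : Model n) :
    (differentialAtFixedPoint (n := n) g z hz v : Model n) =
      mfderiv (𝓡 (2 * n)) (𝓡 (2 * n)) g z v := by
  have key : ∀ (z' : X) (h : z' = z)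
      (L : TangentSpace (𝓡 (2 * n)) z →L[ℝ] TangentSpace (𝓡 (2 * n)) z'),
      ((h ▸ L : TangentSpace (𝓡 (2 * n)) z →L[ℝ] TangentSpace (𝓡 (2 * n)) z) v : Model n) = L v := by
    rintro z' rfl L
    rfl
  exact key _ hz _

/-- The differential at a fixed point, in the preferred chart. -/
lemma mfderiv_fixedPoint {g : X → X} {z : X} (hz : g z = z)
    (hg : MDifferentiableAt (𝓡 (2 * n)) (𝓡 (2 * n)) g z) (v : Model n) :
    (mfderiv (𝓡 (2 * n)) (𝓡 (2 * n)) g z v : Model n) =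
      fderiv ℝ (fun y => chartAt (Model n) z (g ((chartAt (Model n) z).symm y)))
        (chartAt (Model n) z z) v := by
  have h1 := hg.mfderiv
  have h2 : writtenInExtChartAt (𝓡 (2 * n)) (𝓡 (2 * n)) z g =
      fun y => chartAt (Model n) z (g ((chartAt (Model n) z).symm y)) := by
    rw [writtenInExtChartAt, hz]
    rfl
  have h3 := congrArg (fun L : Model n →L[ℝ] Model n => L v) h1
  refine h3.trans ?_
  rw [h2, modelWithCornersSelf_coe, range_id, fderivWithin_univ]
  rfl

lemma formIn_chartAt_self [IsManifold (𝓡 (2 * n)) ∞ X] (Ω : SymplecticForm n X) (z : X)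
    (u v : Model n) : formIn Ω (chartAt (Model n) z) (chartAt (Model n) z z) ![u, v] =
      Ω.form z ![u, v] := by
  have : IsManifold (𝓡 (2 * n)) 1 X := IsManifold.of_le (n := ∞) (by simp)
  have h1 := mfderivWithin_range_extChartAt_symm (I := 𝓡 (2 * n)) (x := z)
  rw [modelWithCornersSelf_coe, range_id, mfderivWithin_univ] at h1
  have h2 : ∀ w : Model n, (mfderiv 𝓘(ℝ, Model n) (𝓡 (2 * n)) (chartAt (Model n) z).symm
      (chartAt (Model n) z z) w : Model n) = w := fun w =>
    congrArg (fun L : Model n →L[ℝ] Model n => L w) h1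
  rw [formIn_apply]
  exact (congrArg₂ (fun a b : Model n => Ω.form ((chartAt (Model n) z).symm
    (chartAt (Model n) z z)) ![a, b]) (h2 u) (h2 v)).trans
    (form_congr Ω ((chartAt (Model n) z).left_inv (mem_chart_source _ z)) _ _)

end FixedPoint

section ChartComposition

variable {n : ℕ} {X : Type*} [TopologicalSpace X] [ChartedSpace (Model n) X]
  {V V' : Type*} [NormedAddCommGroup V] [NormedSpace ℝ V] [NormedAddCommGroup V'] [NormedSpace ℝ V']

lemma IsSmoothChart.trans {e : OpenPartialHomeomorph X V} (he : IsSmoothChart n e)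
    {ψ : OpenPartialHomeomorph V V'} (hψ : ContDiffOn ℝ ∞ ψ ψ.source)
    (hψs : ContDiffOn ℝ ∞ ψ.symm ψ.target) : IsSmoothChart n (e.trans ψ) where
  smooth := by
    refine ContMDiffOn.comp (g := ψ) hψ.contMDiffOn (he.smooth.mono fun x hx => ?_) fun x hx => ?_
    · rw [OpenPartialHomeomorph.trans_source] at hx
      exact hx.1
    · rw [OpenPartialHomeomorph.trans_source] at hx
      exact hx.2
  smooth_symm := by
    refine ContMDiffOn.comp (g := e.symm) (f := ψ.symm) (t := e.target) he.smooth_symm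
      (hψs.contMDiffOn.mono fun x hx => ?_) fun x hx => ?_
    · rw [OpenPartialHomeomorph.trans_target] at hx
      exact hx.1
    · rw [OpenPartialHomeomorph.trans_target] at hx
      exact hx.2

lemma IsSmoothChart.formIn_trans [IsManifold (𝓡 (2 * n)) ∞ X] (Ω : SymplecticForm n X)
    {e : OpenPartialHomeomorph X V}
    (he : IsSmoothChart n e) {ψ : OpenPartialHomeomorph V V'} (hψ : ContDiffOn ℝ ∞ ψ ψ.source)
    (hψs : ContDiffOn ℝ ∞ ψ.symm ψ.target) {y : V'} (hy : y ∈ (e.trans ψ).target) (u v : V') :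
    formIn Ω (e.trans ψ) y ![u, v] =
      formIn Ω e (ψ.symm y) ![fderiv ℝ ψ.symm y u, fderiv ℝ ψ.symm y v] := by
  have hy' := hy
  rw [OpenPartialHomeomorph.trans_target] at hy'
  have hsymm : ∀ z, (e.trans ψ).symm z = e.symm (ψ.symm z) := fun z => rfl
  have hev : (fun z => e ((e.trans ψ).symm z)) =ᶠ[nhds y] ψ.symm := by
    filter_upwards [(e.trans ψ).open_target.mem_nhds hy] with z hz
    rw [OpenPartialHomeomorph.trans_target] at hz
    exact e.right_inv hz.2
  rw [(he.trans hψ hψs).formIn_transition Ω he hy (e.map_target hy'.2), hev.fderiv_eq,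
    hsymm, e.right_inv hy'.2, ContinuousAlternatingMap.compContinuousLinearMap_apply]
  congr 1
  ext k
  fin_cases k <;> rfl

end ChartComposition

section StandardForm

variable {W : Type*} [NormedAddCommGroup W] [InnerProductSpace ℂ W] [FiniteDimensional ℂ W]

lemma exists_stdForm_equiv : ∃ e : W ≃L[ℝ] (W →L[ℝ] ℝ), (e : W →L[ℝ] W →L[ℝ] ℝ) = stdForm W := by
  have : FiniteDimensional ℝ W := FiniteDimensional.complexToReal W
  have hinj : Function.Injective (stdForm W).toLinearMap := by
    rw [← LinearMap.ker_eq_bot, LinearMap.ker_eq_bot']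
    intro u hu
    refine eq_zero_of_stdForm_eq_zero fun y => ?_
    exact congrArg (fun L : W →L[ℝ] ℝ => L y) hu
  have hrank : Module.finrank ℝ W = Module.finrank ℝ (W →L[ℝ] ℝ) := by
    rw [← (LinearMap.toContinuousLinearMap (𝕜 := ℝ) (E := W) (F' := ℝ)).finrank_eq]
    exact (Subspace.dual_finrank_eq (K := ℝ) (V := W)).symm
  refine ⟨(LinearEquiv.ofInjectiveOfFinrankEq (stdForm W).toLinearMap hinj
    hrank).toContinuousLinearEquiv, ?_⟩
  ext u v
  rfl

/-- The members of a unitary flow as real linear isometries. -/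
def IsUnitaryFlow.isometryEquiv {S : W →L[ℂ] W} {ρ : ℝ → W →L[ℂ] W} (hρ : IsUnitaryFlow S ρ)
    (t : ℝ) : W ≃ₗᵢ[ℝ] W where
  toLinearEquiv := LinearEquiv.ofLinearMap ((ρ t).restrictScalars ℝ).toLinearMap
    ((ρ (-t)).restrictScalars ℝ).toLinearMap (by ext x; exact hρ.apply_neg_apply t x)
    (by ext x; exact hρ.neg_apply_apply t x)
  norm_map' x := hρ.norm t x

end StandardForm

section LocalAction

variable {n : ℕ} {X : Type*} [TopologicalSpace X] [ChartedSpace (Model n) X]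
  {Ω : SymplecticForm n X} {F : X → ℝ} {f : ℝ → X → X}

lemma IsHamiltonianCircleAction.add_one (hf : IsHamiltonianCircleAction Ω F f) (t : ℝ) (x : X) :
    f (t + 1) x = f t x := by
  rw [hf.add, hf.period]

lemma IsHamiltonianCircleAction.contMDiff_ham (hf : IsHamiltonianCircleAction Ω F f) :
    ContMDiff (𝓡 (2 * n)) 𝓘(ℝ, ℝ) ∞ F := by
  rw [← contMDiffOn_univ]
  exact ContMDiffOn.comp (g := fun p : ℝ × X => F p.2) (f := fun x : X => ((0 : ℝ), x))
    hf.flow.smooth_ham (contMDiff_const.prodMk contMDiff_id).contMDiffOn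
    fun x _ => ⟨⟨le_rfl, zero_le_one⟩, mem_univ x⟩

lemma contDiffAt_in_chart {V : Type*} [NormedAddCommGroup V] [NormedSpace ℝ V]
    {e : OpenPartialHomeomorph X V} (he : IsSmoothChart n e) {H : X → ℝ}
    (hH : ContMDiff (𝓡 (2 * n)) 𝓘(ℝ, ℝ) ∞ H) {y : V} (hy : y ∈ e.target) :
    ContDiffAt ℝ ∞ (fun y => H (e.symm y)) y :=
  contMDiffAt_iff_contDiffAt.1
    (hH.contMDiffAt.comp y (he.smooth_symm.contMDiffAt (e.open_target.mem_nhds hy)))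

variable [IsManifold (𝓡 (2 * n)) ∞ X]

/-- Near a Maslov-zero fixed point, a Hamiltonian circle action is linear in suitable coordinates
which are symplectic at the fixed point. -/
theorem exists_linearizing_chart (hf : IsHamiltonianCircleAction Ω F f) {z₀ : X}
    (hz : IsMaslovZeroFixedPoint Ω f z₀) :
    ∃ (a : Fin n → ℤ) (e : OpenPartialHomeomorph X (EuclideanSpace ℂ (Fin n))) (R : ℝ),
      ∑ j, a j = 0 ∧ 0 < R ∧ IsSmoothChart n e ∧ e.source ⊆ (chartAt (Model n) z₀).source ∧
      Metric.ball 0 R ⊆ e.target ∧ z₀ ∈ e.source ∧ e z₀ = 0 ∧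
      (∀ u v, formIn Ω e 0 ![u, v] = stdForm _ u v) ∧
      ∀ t, ∀ y ∈ Metric.ball 0 R, f t (e.symm y) = e.symm (rotation a t y) := by
  obtain ⟨hfix, b, hb, hm⟩ := hz
  set φ := chartAt (Model n) z₀ with hφ
  have hφs : IsSmoothChart n φ := isSmoothChart_chartAt z₀
  have hz₀ : z₀ ∈ φ.source := mem_chart_source _ z₀
  set y₀ := φ z₀ with hy₀
  have hy₀t : y₀ ∈ φ.target := φ.map_source hz₀
  have hsymm₀ : φ.symm y₀ = z₀ := φ.left_inv hz₀
  set g : ℝ → Model n → Model n := fun t y => φ (f t (φ.symm y)) with hg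
  set N : Set (ℝ × Model n) := {p | p.2 ∈ φ.target ∧ f p.1 (φ.symm p.2) ∈ φ.source} with hNdef
  have hact : ∀ p : ℝ × Model n, p.2 ∈ φ.target →
      ContMDiffAt 𝓘(ℝ, ℝ × Model n) (𝓡 (2 * n)) ∞ (fun p => f p.1 (φ.symm p.2)) p := by
    intro p hp
    have h1 : ContMDiffAt 𝓘(ℝ, ℝ × Model n) (𝓡 (2 * n)) ∞
        (fun p : ℝ × Model n => φ.symm p.2) p :=
      ContMDiffAt.comp (g := φ.symm) p (hφs.smooth_symm.contMDiffAt (φ.open_target.mem_nhds hp))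
        contDiff_snd.contMDiff.contMDiffAt
    exact ContMDiffAt.comp (g := fun q : ℝ × X => f q.1 q.2)
      (f := fun p : ℝ × Model n => (p.1, φ.symm p.2)) p hf.smooth.contMDiffAt
      (contDiff_fst.contMDiff.contMDiffAt.prodMk h1)
  have hN : IsOpen N := by
    have hc : ContinuousOn (fun p : ℝ × Model n => f p.1 (φ.symm p.2)) (Prod.snd ⁻¹' φ.target) :=
      fun p hp => (hact p hp).continuousAt.continuousWithinAt
    exact hc.isOpen_inter_preimage (φ.open_target.preimage continuous_snd) φ.open_source
  have hgs : ContDiffOn ℝ ∞ (fun p : ℝ × Model n => g p.1 p.2) N := by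
    intro p hp
    refine (contMDiffAt_iff_contDiffAt.1 ?_).contDiffWithinAt
    exact ContMDiffAt.comp (g := φ) p (hφs.smooth.contMDiffAt (φ.open_source.mem_nhds hp.2))
      (hact p hp.1)
  have hyN : ∀ t, (t, y₀) ∈ N := fun t => ⟨hy₀t, by
    change f t (φ.symm y₀) ∈ φ.source
    rw [hsymm₀, hfix]; exact hz₀⟩
  have hgfix : ∀ t, g t y₀ = y₀ := fun t => by
    change φ (f t (φ.symm y₀)) = y₀
    rw [hsymm₀, hfix]
  have hNper : ∀ t y, (t + 1, y) ∈ N ↔ (t, y) ∈ N := fun t y => by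
    simp only [hNdef, mem_ofPred_eq, hf.add_one]
  have hper : ∀ t y, g (t + 1) y = g t y := fun t y => by
    simp only [hg, hf.add_one]
  have hadd : ∀ s t y, (t, y) ∈ N → (s + t, y) ∈ N →
      (s, g t y) ∈ N ∧ g (s + t) y = g s (g t y) := by
    intro s t y h1 h2
    have h3 : φ.symm (g t y) = f t (φ.symm y) := φ.left_inv h1.2
    refine ⟨⟨φ.map_source h1.2, ?_⟩, ?_⟩
    · change f s (φ.symm (g t y)) ∈ φ.source
      rw [h3, ← hf.add]
      exact h2.2
    · change _ = φ (f s (φ.symm (g t y)))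
      rw [h3, ← hf.add]
  have hev : ∀ t, ∀ᶠ y in nhds y₀, (t, y) ∈ N := fun t =>
    (Continuous.prodMk_right t).continuousAt.eventually (hN.mem_nhds (hyN t))
  have hgat : ∀ t, ContDiffAt ℝ ∞ (fun p : ℝ × Model n => g p.1 p.2) (t, y₀) := fun t =>
    hgs.contDiffAt (hN.mem_nhds (hyN t))
  have hi : ∀ t : ℝ, HasFDerivAt (fun y : Model n => (t, y)) (ContinuousLinearMap.inr ℝ ℝ _) y₀ :=
    fun t => hasFDerivAt_prodMk_right t y₀
  have hgd' : ∀ t, HasFDerivAt (g t) ((fderiv ℝ (fun p : ℝ × Model n => g p.1 p.2) (t, y₀)).comp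
      (ContinuousLinearMap.inr ℝ ℝ _)) y₀ := fun t =>
    HasFDerivAt.comp y₀ (f := fun y : Model n => (t, y))
      ((hgat t).differentiableAt (by simp)).hasFDerivAt (hi t)
  have hgd : ∀ t, DifferentiableAt ℝ (g t) y₀ := fun t => (hgd' t).differentiableAt
  have hBadd : ∀ s t v, fderiv ℝ (g (s + t)) y₀ v = fderiv ℝ (g s) y₀ (fderiv ℝ (g t) y₀ v) := by
    intro s t v
    have h1 : g (s + t) =ᶠ[nhds y₀] g s ∘ g t := by
      filter_upwards [hev t, hev (s + t)] with y h1 h2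
      exact (hadd s t y h1 h2).2
    rw [h1.fderiv_eq, fderiv_comp y₀ (by rw [hgfix]; exact hgd s) (hgd t), hgfix]
    rfl
  have hid : ∀ t, (∀ x, f t x = x) → ∀ v, fderiv ℝ (g t) y₀ v = v := by
    intro t ht v
    have h1 : g t =ᶠ[nhds y₀] id := by
      filter_upwards [φ.open_target.mem_nhds hy₀t] with y hy
      change φ (f t (φ.symm y)) = y
      rw [ht, φ.right_inv hy]
    rw [h1.fderiv_eq, fderiv_id]
    rfl
  have hBd : ∀ v, DifferentiableAt ℝ (fun t => fderiv ℝ (g t) y₀ v) 0 := by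
    intro v
    have h1 : (fun t => fderiv ℝ (g t) y₀ v) =
        fun t => fderiv ℝ (fun p : ℝ × Model n => g p.1 p.2) (t, y₀) (0, v) := by
      funext t
      rw [(hgd' t).fderiv]
      rfl
    rw [h1]
    have h2 : DifferentiableAt ℝ (fderiv ℝ fun p : ℝ × Model n => g p.1 p.2) (0, y₀) :=
      ((hgat 0).fderiv_right (m := ∞) (by simp)).differentiableAt (by simp)
    exact (DifferentiableAt.comp (f := fun t : ℝ => (t, y₀)) (0 : ℝ) h2
      (differentiableAt_id.prodMk (differentiableAt_const _))).clm_apply (differentiableAt_const _)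
  have hmd : ∀ t, MDifferentiableAt (𝓡 (2 * n)) (𝓡 (2 * n)) (f t) z₀ := fun t =>
    (ContMDiffAt.comp (g := fun q : ℝ × X => f q.1 q.2) (f := fun x : X => (t, x)) z₀
      hf.smooth.contMDiffAt (contMDiff_const.prodMk contMDiff_id).contMDiffAt).mdifferentiableAt
        (by simp)
  have hBeq : ∀ t, (differentialAtFixedPoint (n := n) (f t) z₀ (hfix t) : Model n →L[ℝ] Model n) =
      fderiv ℝ (g t) y₀ := by
    intro t
    ext1 v
    exact (differentialAtFixedPoint_apply (hfix t) v).trans (mfderiv_fixedPoint (hfix t) (hmd t) v)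
  set ηz : Model n →L[ℝ] Model n →L[ℝ] ℝ := toBilin (V := Model n) (Ω.form z₀) with hηz
  have hηb : ∀ k l, ηz (b k) (b l) = -J (Fin n) ℝ k l := by
    have hsk : ∀ u v : Model n, ηz u v = -ηz v u := fun u v => toBilin_skew (V := Model n) _ u v
    obtain ⟨h1, h2, h3⟩ := hb
    rintro (i | i) (j | j)
    · refine (h1 i j).trans ?_
      simp [J]
    · refine (h3 i j).trans ?_
      simp [J, Matrix.one_apply]
    · refine (hsk _ _).trans ?_
      refine (congrArg Neg.neg (h3 j i)).trans ?_
      simp [J, Matrix.one_apply, eq_comm]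
    · refine (h2 i j).trans ?_
      simp [J]
  set b' : Module.Basis (Fin n ⊕ Fin n) ℝ (Model n) := b with hb'
  have hmat : (fun t => LinearMap.toMatrix b b
      (differentialAtFixedPoint (f t) z₀ (hfix t)).toLinearMap) =
      fun t => LinearMap.toMatrix b' b' (fderiv ℝ (g t) y₀).toLinearMap := by
    funext t
    ext i j
    rw [LinearMap.toMatrix_apply, LinearMap.toMatrix_apply]
    exact congrArg (fun L : Model n →L[ℝ] Model n => b'.repr (L (b' j)) i) (hBeq t)
  obtain ⟨a, T, ha, hT, hTη⟩ := exists_linear_normal_form (V := Model n) b' (η := ηz) hηb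
    (B := fun t => fderiv ℝ (g t) y₀) hBadd (hid 0 hf.flow.start) (hid 1 hf.period) hBd
    (hmat ▸ hm)
  obtain ⟨e₁, hye, he0, hes, hess, heT, R, hR, hRt, hequi⟩ :=
    exists_equivariant_linearization (isUnitaryFlow_rotation a) (rotation_one a) hN hgs hyN hgfix
      hNper hper hadd T hT
  have htarget : Metric.ball 0 R ⊆ (φ.trans e₁).target := by
    intro x hx
    rw [OpenPartialHomeomorph.trans_target]
    exact ⟨hRt hx, (hequi x hx 0).1.1⟩
  refine ⟨a, φ.trans e₁, R, ha, hR, hφs.trans hes hess, ?_, htarget, ?_, he0, fun u v => ?_,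
    fun t y hy => ?_⟩
  · rw [OpenPartialHomeomorph.trans_source]
    exact inter_subset_left
  · rw [OpenPartialHomeomorph.trans_source]
    exact ⟨hz₀, hye⟩
  · have h0 : (0 : EuclideanSpace ℂ (Fin n)) ∈ (φ.trans e₁).target :=
      htarget (Metric.mem_ball_self hR)
    have hs0 : e₁.symm 0 = y₀ := by rw [← he0, e₁.left_inv hye]
    have h0t : (0 : EuclideanSpace ℂ (Fin n)) ∈ e₁.target := hRt (Metric.mem_ball_self hR)
    have hd : HasFDerivAt e₁.symm (T : EuclideanSpace ℂ (Fin n) →L[ℝ] Model n) 0 := by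
      have := e₁.hasFDerivAt_symm (f' := T.symm) h0t (by rw [hs0]; exact heT)
      exact this
    rw [hφs.formIn_trans Ω hes hess h0, hs0, hd.fderiv, ← hTη]
    exact formIn_chartAt_self Ω z₀ _ _
  · obtain ⟨h1, h2⟩ := hequi y hy t
    change f t (φ.symm (e₁.symm y)) = φ.symm (e₁.symm (rotation a t y))
    rw [← h2]
    exact (φ.left_inv h1.2).symm

end LocalAction

section NormalChart

variable {n : ℕ} {X : Type*} [TopologicalSpace X] [ChartedSpace (Model n) X]
  {Ω : SymplecticForm n X} {F : X → ℝ} {f : ℝ → X → X} [IsManifold (𝓡 (2 * n)) ∞ X]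

/-- Near a Maslov-zero fixed point, a Hamiltonian circle action is linear in suitable Darboux
coordinates. -/
theorem exists_normal_chart (hf : IsHamiltonianCircleAction Ω F f) {z₀ : X}
    (hz : IsMaslovZeroFixedPoint Ω f z₀) :
    ∃ (a : Fin n → ℤ) (e : OpenPartialHomeomorph X (EuclideanSpace ℂ (Fin n))) (r : ℝ),
      ∑ j, a j = 0 ∧ 0 < r ∧ IsSmoothChart n e ∧ e.source ⊆ (chartAt (Model n) z₀).source ∧
      e.target = Metric.ball 0 r ∧ z₀ ∈ e.source ∧ e z₀ = 0 ∧
      (∀ y ∈ Metric.ball 0 r, ∀ u v, formIn Ω e y ![u, v] = stdForm _ u v) ∧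
      ∀ t, ∀ y ∈ Metric.ball 0 r, f t (e.symm y) = e.symm (rotation a t y) := by
  obtain ⟨a, e, R, ha, hR, he, hes, het, hze, he0, hform, hact⟩ := exists_linearizing_chart hf hz
  have hρ := isUnitaryFlow_rotation a
  have hball : IsOpen (Metric.ball (0 : EuclideanSpace ℂ (Fin n)) R) := Metric.isOpen_ball
  set η := fun y => toBilin (formIn Ω e y) with hη
  set H := fun y => F (e.symm y) with hH
  have hηs : ContDiffOn ℝ ∞ η (Metric.ball 0 R) := fun y hy =>
    (contDiffAt_bilinIn Ω he hes (het hy)).contDiffWithinAt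
  have hHs : ContDiffOn ℝ ∞ H (Metric.ball 0 R) := fun y hy =>
    (contDiffAt_in_chart he hf.contMDiff_ham (het hy)).contDiffWithinAt
  have hskew : ∀ x ∈ Metric.ball (0 : EuclideanSpace ℂ (Fin n)) R, ∀ u v,
      η x u v = - η x v u := fun x _ u v => toBilin_skew _ u v
  have hclosed := fun x (hx : x ∈ Metric.ball (0 : EuclideanSpace ℂ (Fin n)) R) a b c =>
    cyclic_fderiv_bilinIn Ω he hes (het hx) a b c
  have hη0 : η 0 = stdForm _ := by
    ext u v
    exact hform u v
  have hcon : ∀ x ∈ Metric.ball (0 : EuclideanSpace ℂ (Fin n)) R,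
      η x (rotationGen a x) = -fderiv ℝ H x := by
    intro x hx
    have h0 : (0 : ℝ) ∈ Icc (0 : ℝ) 1 := ⟨le_rfl, zero_le_one⟩
    have hx0 : rotation a 0 x = x := hρ.zero x
    have hd := (hρ.deriv 0 x).hasDerivWithinAt (s := Icc 0 1)
    rw [hρ.zero] at hd
    have h1 := (flow_iff_in_chart Ω he (h := f) (x := e.symm x) (c := fun τ => rotation a τ x)
      (H := F) h0 (fun τ _ => hact τ x hx) (by simp only [hx0]; exact het hx) hd
      (hf.contMDiff_ham.mdifferentiableAt (by simp))).1 (hf.flow.flow 0 h0 (e.symm x))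
    simp only [hx0] at h1
    ext w
    exact h1 w
  obtain ⟨E, hE⟩ := exists_stdForm_equiv (W := EuclideanSpace ℂ (Fin n))
  obtain ⟨ψ, hψ0, hψs, hψss, hψt, hψη, r, hr, hrs, hψD⟩ := exists_equivariant_darboux hηs hR
    (e := E) (hE.trans hη0.symm) hskew hclosed (D := hρ.isometryEquiv) fun t x hx u v =>
      form_invariant_of_hamiltonian hρ hηs hHs hskew hclosed hcon t hx u v
  set B := OpenPartialHomeomorph.ofSet (Metric.ball (0 : EuclideanSpace ℂ (Fin n)) r)
    Metric.isOpen_ball with hB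
  set χ := ψ.symm.trans B with hχ
  have hχc : ContDiffOn ℝ ∞ χ χ.source := by
    refine ContDiffOn.mono (s := ψ.target) hψss fun x hx => ?_
    rw [OpenPartialHomeomorph.trans_source] at hx
    exact hx.1
  have hχs : ContDiffOn ℝ ∞ χ.symm χ.target := by
    refine ContDiffOn.mono (s := ψ.source) hψs fun x hx => ?_
    rw [OpenPartialHomeomorph.trans_target] at hx
    exact hx.2
  have htar : (e.trans χ).target = Metric.ball 0 r := by
    rw [OpenPartialHomeomorph.trans_target, hχ, OpenPartialHomeomorph.trans_target]
    ext x
    constructor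
    · exact fun hx => hx.1.1
    · exact fun hx => ⟨⟨hx, hrs hx⟩, het (hψt (ψ.map_source (hrs hx)))⟩
  have hψ0s : (0 : EuclideanSpace ℂ (Fin n)) ∈ ψ.source := hrs (Metric.mem_ball_self hr)
  have hψs0 : ψ.symm 0 = 0 := by
    conv_lhs => rw [← hψ0]
    exact ψ.left_inv hψ0s
  have hψ0t : (0 : EuclideanSpace ℂ (Fin n)) ∈ ψ.target := by
    rw [← hψ0]
    exact ψ.map_source hψ0s
  refine ⟨a, e.trans χ, r, ha, hr, he.trans hχc hχs, ?_, htar, ?_, ?_, fun y hy u v => ?_, fun t y hy => ?_⟩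
  · rw [OpenPartialHomeomorph.trans_source]
    exact inter_subset_left.trans hes
  · have hmem : (0 : EuclideanSpace ℂ (Fin n)) ∈ χ.source := by
      rw [hχ, OpenPartialHomeomorph.trans_source, hB, OpenPartialHomeomorph.ofSet_source]
      refine ⟨hψ0t, ?_⟩
      rw [mem_preimage, hψs0]
      exact Metric.mem_ball_self hr
    rw [OpenPartialHomeomorph.trans_source]
    refine ⟨hze, ?_⟩
    rw [mem_preimage, he0]
    exact hmem
  · change ψ.symm (e z₀) = 0
    rw [he0, hψs0]
  · rw [he.formIn_trans Ω hχc hχs (by rw [htar]; exact hy)]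
    have := hψη y (hrs hy) u v
    rw [hη0] at this
    exact this
  · change f t (e.symm (ψ y)) = e.symm (ψ (rotation a t y))
    rw [hact t _ (hψt (ψ.map_source (hrs hy)))]
    exact congrArg e.symm (hψD t y hy).symm

end NormalChart

section Gluing

variable {X Z : Type*}

open Classical in
/-- The value `u` over `O` and `g` elsewhere. -/
def glue (O : Set X) (x : X) (u g : Z) : Z := if x ∈ O then u else g

lemma glue_of_mem {O : Set X} {x : X} (h : x ∈ O) (u g : Z) : glue O x u g = u := if_pos h

lemma glue_of_notMem {O : Set X} {x : X} (h : x ∉ O) (u g : Z) : glue O x u g = g := if_neg h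

lemma glue_of_imp_eq {O : Set X} {x : X} {u g : Z} (h : x ∈ O → u = g) : glue O x u g = g := by
  by_cases hx : x ∈ O
  · rw [glue_of_mem hx, h hx]
  · rw [glue_of_notMem hx]

lemma contMDiff_glue [TopologicalSpace X] {E E' H H' M N : Type*} [NormedAddCommGroup E]
    [NormedSpace ℝ E] [NormedAddCommGroup E'] [NormedSpace ℝ E'] [TopologicalSpace H]
    [TopologicalSpace H'] {I : ModelWithCorners ℝ E H} {I' : ModelWithCorners ℝ E' H'}
    [TopologicalSpace M] [ChartedSpace H M] [TopologicalSpace N] [ChartedSpace H' N] {π : M → X}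
    (hπ : Continuous π) {O C : Set X} (hO : IsOpen O) (hC : IsClosed C) (hCO : C ⊆ O) {u g : M → N}
    (hu : ∀ m, π m ∈ O → ContMDiffAt I I' ∞ u m) (hg : ContMDiff I I' ∞ g)
    (hug : ∀ m, π m ∈ O → π m ∉ C → u m = g m) :
    ContMDiff I I' ∞ fun m => glue O (π m) (u m) (g m) := by
  intro m
  by_cases hm : π m ∈ O
  · refine (hu m hm).congr_of_eventuallyEq ?_
    filter_upwards [(hO.preimage hπ).mem_nhds hm] with z hz
    exact glue_of_mem hz _ _
  · refine hg.contMDiffAt.congr_of_eventuallyEq ?_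
    filter_upwards [(hC.isOpen_compl.preimage hπ).mem_nhds fun h => hm (hCO h)] with z hz
    exact glue_of_imp_eq fun h => hug z h hz

end Gluing

section NormalizedHamiltonian

variable {n : ℕ} {X : Type*} [TopologicalSpace X] [ChartedSpace (Model n) X]
  {Ω : SymplecticForm n X} {F : X → ℝ} {f : ℝ → X → X}

lemma IsHamiltonianCircleAction.sub_const (hf : IsHamiltonianCircleAction Ω F f) (c : ℝ) :
    IsHamiltonianCircleAction Ω (fun x => F x - c) f where
  smooth := hf.smooth
  add := hf.add
  period := hf.period
  flow :=
    { smooth_ham := by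
        have h1 : ContMDiff (𝓡 (2 * n)) 𝓘(ℝ, ℝ) ∞ fun x => F x - c :=
          hf.contMDiff_ham.sub contMDiff_const
        exact (h1.comp (f := fun p : ℝ × X => p.2) contMDiff_snd).contMDiffOn
      smooth_flow := hf.flow.smooth_flow
      start := hf.flow.start
      flow := fun t ht x w => by
        have h1 : mfderiv (𝓡 (2 * n)) 𝓘(ℝ, ℝ) (F - fun _ => c) (f t x) =
            mfderiv (𝓡 (2 * n)) 𝓘(ℝ, ℝ) F (f t x) := by
          rw [mfderiv_sub (hf.contMDiff_ham.mdifferentiableAt (by simp)) mdifferentiableAt_const,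
            mfderiv_const]
          exact sub_zero (_ : Model n →L[ℝ] ℝ)
        have h2 := congrArg (fun L : Model n →L[ℝ] ℝ => -(L w)) h1
        exact (hf.flow.flow t ht x w).trans h2.symm }

lemma IsHamiltonianCircleAction.neg_apply_apply (hf : IsHamiltonianCircleAction Ω F f) (t : ℝ)
    (x : X) : f (-t) (f t x) = x := by
  rw [← hf.add, neg_add_cancel, hf.flow.start]

/-- The moment map of a linear Hamiltonian circle action in Darboux coordinates. -/
lemma ham_eq_quadHam (hf : IsHamiltonianCircleAction Ω F f)
    {e : OpenPartialHomeomorph X (EuclideanSpace ℂ (Fin n))} (he : IsSmoothChart n e) {r : ℝ}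
    (hr : 0 < r) (het : e.target = Metric.ball 0 r)
    (hform : ∀ y ∈ Metric.ball 0 r, ∀ u v, formIn Ω e y ![u, v] = stdForm _ u v) {a : Fin n → ℤ}
    (hact : ∀ t, ∀ y ∈ Metric.ball 0 r, f t (e.symm y) = e.symm (rotation a t y))
    {y : EuclideanSpace ℂ (Fin n)} (hy : y ∈ Metric.ball 0 r) :
    F (e.symm y) = F (e.symm 0) + quadHam (rotationGen a) y := by
  have hρ := isUnitaryFlow_rotation a
  have hF : ∀ x ∈ Metric.ball (0 : EuclideanSpace ℂ (Fin n)) r,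
      DifferentiableAt ℝ (fun y => F (e.symm y)) x := fun x hx =>
    (contDiffAt_in_chart he hf.contMDiff_ham (by rw [het]; exact hx)).differentiableAt (by simp)
  have hQ : ∀ x, HasFDerivAt (fun y => F (e.symm 0) + quadHam (rotationGen a) y)
      (-stdForm _ (rotationGen a x)) x := fun x => (hasFDerivAt_quadHam hρ.skew x).const_add _
  refine Metric.isOpen_ball.eqOn_of_fderiv_eq (𝕜 := ℝ) (f := fun y => F (e.symm y))
    (convex_ball (0 : EuclideanSpace ℂ (Fin n)) r).isPreconnected
    (fun x hx => (hF x hx).differentiableWithinAt)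
    (fun x _ => (hQ x).differentiableAt.differentiableWithinAt) (fun x hx => ?_)
    (Metric.mem_ball_self hr) ?_ hy
  · rw [(hQ x).fderiv]
    have h0 : (0 : ℝ) ∈ Icc (0 : ℝ) 1 := ⟨le_rfl, zero_le_one⟩
    have hx0 : rotation a 0 x = x := hρ.zero x
    have hd := (hρ.deriv 0 x).hasDerivWithinAt (s := Icc 0 1)
    rw [hρ.zero] at hd
    have h1 := (flow_iff_in_chart Ω he (h := f) (x := e.symm x) (c := fun τ => rotation a τ x)
      (H := F) h0 (fun τ _ => hact τ x hx) (by simp only [hx0, het]; exact hx) hd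
      (hf.contMDiff_ham.mdifferentiableAt (by simp))).1 (hf.flow.flow 0 h0 (e.symm x))
    simp only [hx0] at h1
    ext w
    have h2 := h1 w
    rw [hform x hx] at h2
    rw [_root_.neg_apply, h2, neg_neg]
  · simp [quadHam]

end NormalizedHamiltonian

section Modification

variable {n : ℕ} {X : Type*} [TopologicalSpace X] [T2Space X] [CompactSpace X]
  [ChartedSpace (Model n) X] [IsManifold (𝓡 (2 * n)) ∞ X] [MeasurableSpace X] [BorelSpace X]
  {Ω : SymplecticForm n X} {F : X → ℝ} {f : ℝ → X → X}

lemma isClosed_image_closedBall {e : OpenPartialHomeomorph X (EuclideanSpace ℂ (Fin n))} {r s : ℝ}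
    (het : e.target = Metric.ball 0 r) (hs : s < r) :
    IsClosed (e.symm '' Metric.closedBall 0 s) := by
  refine ((isCompact_closedBall _ _).image_of_continuousOn
    (e.continuousOn_symm.mono ?_)).isClosed
  rw [het]
  exact Metric.closedBall_subset_ball hs

/-- A Hamiltonian circle action with a Maslov-zero fixed point, at which the moment map vanishes,
is homotopic through Hamiltonian loops to one whose Hamiltonian vanishes near the fixed point and
has the same integral. -/
theorem exists_hamiltonian_homotopy (hf : IsHamiltonianCircleAction Ω F f) {z₀ : X}
    (hz : IsMaslovZeroFixedPoint Ω f z₀) (hF₀ : F z₀ = 0) :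
    ∃ (B U : Set X) (k : ℝ → ℝ → X → X) (H : ℝ → ℝ → X → ℝ), IsOpen B ∧ z₀ ∈ B ∧ IsOpen U ∧
      closure B ⊆ U ∧ (∀ t, ∀ x ∈ U, H 1 t x = 0) ∧
      ContMDiff (𝓘(ℝ, ℝ).prod (𝓘(ℝ, ℝ).prod (𝓡 (2 * n)))) (𝓡 (2 * n)) ∞
        (fun p : ℝ × ℝ × X => k p.1 p.2.1 p.2.2) ∧
      (∀ s, IsHamiltonianFlow Ω (H s) (k s)) ∧ (∀ s x, k s 1 x = x) ∧ (∀ t x, k 0 t x = f t x) ∧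
      ∀ t, ∫ x, H 1 t x ∂symplecticVolume Ω = ∫ x, F x ∂symplecticVolume Ω := by
  obtain ⟨a, e, r, ha, hr, he, hes, het, hze, he0, hform, hact⟩ := exists_normal_chart hf hz
  have hquad : ∀ y ∈ Metric.ball (0 : EuclideanSpace ℂ (Fin n)) r,
      F (e.symm y) = quadHam (rotationGen a) y := fun y hy => by
    have h0 : e.symm 0 = z₀ := by rw [← he0, e.left_inv hze]
    rw [ham_eq_quadHam hf he hr het hform hact hy, h0, hF₀, zero_add]
  obtain ⟨κ, K, hκs, hKs, hκn, hκd, hκ0, hκ1, hκ0', hκr, hKr, hK0, hKi⟩ :=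
    exists_model_homotopy ha (r₀ := r / 4) (r₁ := r / 2) (by linarith) (by linarith)
  set C : Set X := e.symm '' Metric.closedBall 0 (r / 2) with hCdef
  have hC : IsClosed C := isClosed_image_closedBall het (by linarith)
  have hball : ∀ x ∈ e.source, e x ∈ Metric.ball (0 : EuclideanSpace ℂ (Fin n)) r := fun x hx => by
    rw [← het]; exact e.map_source hx
  have hCO : C ⊆ e.source := by
    rintro _ ⟨y, hy, rfl⟩
    exact e.map_target (by rw [het]; exact Metric.closedBall_subset_ball (by linarith) hy)
  have hCn : ∀ x ∈ e.source, x ∉ C → r / 2 < ‖e x‖ := by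
    intro x hx hxC
    by_contra! h
    exact hxC ⟨e x, mem_closedBall_zero_iff.2 h, e.left_inv hx⟩
  have hκball : ∀ s t, ∀ y ∈ Metric.ball (0 : EuclideanSpace ℂ (Fin n)) r,
      κ s t y ∈ Metric.ball (0 : EuclideanSpace ℂ (Fin n)) r := fun s t y hy => by
    rw [mem_ball_zero_iff, hκn]; exact mem_ball_zero_iff.1 hy
  have hact' : ∀ t, ∀ x ∈ e.source, f t x = e.symm (rotation a t (e x)) := fun t x hx => by
    rw [← hact t _ (hball x hx), e.left_inv hx]
  have hFe : ∀ x ∈ e.source, F x = quadHam (rotationGen a) (e x) := fun x hx => by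
    rw [← hquad _ (hball x hx), e.left_inv hx]
  set k : ℝ → ℝ → X → X := fun s t x => glue e.source x (e.symm (κ s t (e x))) (f t x) with hk
  set H : ℝ → ℝ → X → ℝ := fun s t x => glue e.source x (K s t (e x)) (F x) with hH
  have hks : ∀ s t, ∀ x ∈ e.source, k s t x = e.symm (κ s t (e x)) := fun s t x hx =>
    glue_of_mem hx _ _
  have hkn : ∀ s t, ∀ x ∉ e.source, k s t x = f t x := fun s t x hx => glue_of_notMem hx _ _
  have hHs : ∀ s t, ∀ x ∈ e.source, H s t x = K s t (e x) := fun s t x hx => glue_of_mem hx _ _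
  have hHn : ∀ s t, ∀ x ∉ C, H s t x = F x := fun s t x hx => glue_of_imp_eq fun h => by
    rw [hKr _ _ _ (hCn x h hx), hFe x h]
  have heat : ∀ x ∈ e.source, ContMDiffAt (𝓡 (2 * n)) 𝓘(ℝ, EuclideanSpace ℂ (Fin n)) ∞ e x :=
    fun x hx => he.smooth.contMDiffAt (e.open_source.mem_nhds hx)
  have hkC : ContMDiff (𝓘(ℝ, ℝ).prod (𝓘(ℝ, ℝ).prod (𝓡 (2 * n)))) (𝓡 (2 * n)) ∞
      (fun p : ℝ × ℝ × X => k p.1 p.2.1 p.2.2) := by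
    refine contMDiff_glue (π := fun p : ℝ × ℝ × X => p.2.2)
      (u := fun p : ℝ × ℝ × X => e.symm (κ p.1 p.2.1 (e p.2.2)))
      (g := fun p : ℝ × ℝ × X => f p.2.1 p.2.2) (by fun_prop) e.open_source hC hCO ?_ ?_ ?_
    · intro p hp
      have h2 : ContMDiffAt (𝓘(ℝ, ℝ).prod (𝓘(ℝ, ℝ).prod (𝓡 (2 * n))))
          𝓘(ℝ, ℝ × ℝ × EuclideanSpace ℂ (Fin n)) ∞
          (fun p : ℝ × ℝ × X => (p.1, p.2.1, e p.2.2)) p :=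
        contMDiffAt_fst.prodMk_space ((contMDiffAt_fst.comp p contMDiffAt_snd).prodMk_space
          (ContMDiffAt.comp (g := e) (f := fun p : ℝ × ℝ × X => p.2.2) p (heat _ hp)
            (contMDiffAt_snd.comp p contMDiffAt_snd)))
      have h3 : ContMDiffAt (𝓘(ℝ, ℝ).prod (𝓘(ℝ, ℝ).prod (𝓡 (2 * n))))
          𝓘(ℝ, EuclideanSpace ℂ (Fin n)) ∞
          (fun p : ℝ × ℝ × X => κ p.1 p.2.1 (e p.2.2)) p :=
        ContMDiffAt.comp (g := fun q : ℝ × ℝ × EuclideanSpace ℂ (Fin n) => κ q.1 q.2.1 q.2.2) p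
          hκs.contMDiff.contMDiffAt h2
      refine ContMDiffAt.comp (g := e.symm) p (he.smooth_symm.contMDiffAt
        (e.open_target.mem_nhds ?_)) h3
      rw [het]
      exact hκball _ _ _ (hball _ hp)
    · exact hf.smooth.comp (f := fun p : ℝ × ℝ × X => p.2) contMDiff_snd
    · intro p hp hpC
      rw [hκr _ _ _ (hCn _ hp hpC), hact' _ _ hp]
  have hHC : ∀ s, ContMDiff (𝓘(ℝ, ℝ).prod (𝓡 (2 * n))) 𝓘(ℝ, ℝ) ∞
      (fun p : ℝ × X => H s p.1 p.2) := by
    intro s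
    refine contMDiff_glue (π := fun p : ℝ × X => p.2)
      (u := fun p : ℝ × X => K s p.1 (e p.2))
      (g := fun p : ℝ × X => F p.2) (by fun_prop) e.open_source hC hCO ?_ ?_ ?_
    · intro p hp
      have h2 : ContMDiffAt (𝓘(ℝ, ℝ).prod (𝓡 (2 * n)))
          𝓘(ℝ, ℝ × EuclideanSpace ℂ (Fin n)) ∞ (fun p : ℝ × X => (p.1, e p.2)) p :=
        contMDiffAt_fst.prodMk_space (ContMDiffAt.comp (g := e) (f := fun p : ℝ × X => p.2) p
          (heat _ hp) contMDiffAt_snd)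
      exact ContMDiffAt.comp (g := fun q : ℝ × EuclideanSpace ℂ (Fin n) => K s q.1 q.2) p
        (hKs s).contMDiff.contMDiffAt h2
    · exact hf.contMDiff_ham.comp (f := fun p : ℝ × X => p.2) contMDiff_snd
    · intro p hp hpC
      rw [hKr _ _ _ (hCn _ hp hpC), hFe _ hp]
  have hHt : ∀ s t, ContMDiff (𝓡 (2 * n)) 𝓘(ℝ, ℝ) ∞ (H s t) := fun s t =>
    (hHC s).comp (f := fun x : X => (t, x)) (contMDiff_const.prodMk contMDiff_id)
  have hflow : ∀ s, IsHamiltonianFlow Ω (H s) (k s) := by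
    intro s
    refine ⟨(hHC s).contMDiffOn, (hkC.comp (f := fun p : ℝ × X => (s, p))
      (contMDiff_const.prodMk contMDiff_id)).contMDiffOn, fun x => ?_, fun t ht x => ?_⟩
    · by_cases hx : x ∈ e.source
      · rw [hks _ _ _ hx, hκ0, e.left_inv hx]
      · rw [hkn _ _ _ hx, hf.flow.start]
    · by_cases hx : x ∈ e.source
      · obtain ⟨v, hv, hvK⟩ := hκd s t (e x)
        have hct : κ s t (e x) ∈ e.target := by rw [het]; exact hκball _ _ _ (hball x hx)
        refine (flow_iff_in_chart Ω he (h := k s) (x := x) (c := fun τ => κ s τ (e x))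
          (H := H s t) ht (fun τ _ => hks s τ x hx) hct hv.hasDerivWithinAt
          ((hHt s t).mdifferentiableAt (by simp))).2 fun w => ?_
        have hev : (fun y => H s t (e.symm y)) =ᶠ[nhds (κ s t (e x))] K s t := by
          filter_upwards [e.open_target.mem_nhds hct] with y hy
          rw [hHs _ _ _ (e.map_target hy), e.right_inv hy]
        rw [hev.fderiv_eq, ← hvK]
        exact hform _ (het ▸ hct) _ _
      · intro w
        have h1 : (fun τ => k s τ x) = fun τ => f τ x := funext fun τ => hkn s τ x hx
        have h2 : (velocity (n := n) (k s) t x : Model n) = velocity (n := n) f t x := by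
          have key : ∀ c : ℝ → X, (fun τ => k s τ x) = c →
              (mfderivWithin 𝓘(ℝ, ℝ) (𝓡 (2 * n)) (fun τ => k s τ x) (Icc (0 : ℝ) 1) t (1 : ℝ) :
                Model n) = mfderivWithin 𝓘(ℝ, ℝ) (𝓡 (2 * n)) c (Icc (0 : ℝ) 1) t (1 : ℝ) := by
            rintro _ rfl
            rfl
          exact key _ h1
        have h3 : f t x ∉ C := by
          rintro ⟨y, hy, hyx⟩
          apply hx
          have hy' : y ∈ Metric.ball (0 : EuclideanSpace ℂ (Fin n)) r :=
            Metric.closedBall_subset_ball (by linarith) hy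
          rw [← hf.neg_apply_apply t x, ← hyx, hact _ _ hy']
          refine e.map_target ?_
          rw [het, mem_ball_zero_iff, (isUnitaryFlow_rotation a).norm]
          exact mem_ball_zero_iff.1 hy'
        have h4 : H s t =ᶠ[nhds (f t x)] F := by
          filter_upwards [hC.isOpen_compl.mem_nhds h3] with z hz
          exact hHn s t z hz
        have h5 := congrArg (fun L : Model n →L[ℝ] ℝ => L w)
          (h4.mfderiv_eq (I := 𝓡 (2 * n)) (I' := 𝓘(ℝ, ℝ)))
        have h6 : ∀ p : X, p = f t x → (mfderiv (𝓡 (2 * n)) 𝓘(ℝ, ℝ) (H s t) p w : ℝ) =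
            mfderiv (𝓡 (2 * n)) 𝓘(ℝ, ℝ) (H s t) (f t x) w := by
          rintro _ rfl
          rfl
        refine ((congrArg (fun v : Model n => Ω.form (k s t x) ![v, (w : Model n)]) h2).trans
          (form_congr Ω (hkn s t x hx) _ _)).trans ?_
        refine (hf.flow.flow t ht x w).trans ?_
        exact (congrArg Neg.neg ((h6 _ (hkn s t x hx)).trans h5)).symm
  refine ⟨e.source ∩ e ⁻¹' Metric.ball 0 (r / 8), e.source ∩ e ⁻¹' Metric.ball 0 (r / 6), k, H,
    e.isOpen_inter_preimage Metric.isOpen_ball, ⟨hze, ?_⟩,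
    e.isOpen_inter_preimage Metric.isOpen_ball, ?_, fun t x hx => ?_, hkC, hflow, fun s x => ?_,
    fun t x => ?_, fun t => ?_⟩
  · rw [mem_preimage, he0]
    exact Metric.mem_ball_self (by linarith)
  · refine (closure_minimal (t := e.symm '' Metric.closedBall 0 (r / 8)) ?_
      (isClosed_image_closedBall het (by linarith))).trans ?_
    · exact fun x hx => ⟨e x, Metric.ball_subset_closedBall hx.2, e.left_inv hx.1⟩
    · rintro _ ⟨y, hy, rfl⟩
      have hyt : y ∈ e.target := by
        rw [het]; exact Metric.closedBall_subset_ball (by linarith) hy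
      refine ⟨e.map_target hyt, ?_⟩
      rw [mem_preimage, e.right_inv hyt]
      exact Metric.closedBall_subset_ball (by linarith) hy
  · rw [hHs _ _ _ hx.1]
    refine hK0 _ _ ((mem_ball_zero_iff.1 hx.2).trans (by linarith))
  · by_cases hx : x ∈ e.source
    · rw [hks _ _ _ hx, hκ1, e.left_inv hx]
    · rw [hkn _ _ _ hx, hf.period]
  · by_cases hx : x ∈ e.source
    · rw [hks _ _ _ hx, hκ0', hact' t x hx]
    · rw [hkn _ _ _ hx]
  · have := isFiniteMeasure_symplecticVolume Ω
    have hint : ∀ {g : X → ℝ}, Continuous g → Integrable g (symplecticVolume Ω) := fun hg =>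
      hg.integrable_of_hasCompactSupport (HasCompactSupport.of_compactSpace _)
    have hq : Continuous fun y => K 1 t y - quadHam (rotationGen a) y :=
      ((hKs 1).continuous.comp (Continuous.prodMk_right t)).sub (contDiff_quadHam _).continuous
    have hKc : Continuous (K 1 t) := (hKs 1).continuous.comp (Continuous.prodMk_right t)
    have hib : ∀ {g : EuclideanSpace ℂ (Fin n) → ℝ}, Continuous g →
        IntegrableOn g (Metric.ball 0 r) := fun hg =>
      (hg.continuousOn.integrableOn_compact (isCompact_closedBall _ _)).mono_set
        Metric.ball_subset_closedBall
    have h0 := setIntegral_symplecticVolume_eq_zero Ω he hes (η := formIn Ω e 0)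
      (fun y hy => ext_two fun u v => by
        rw [hform y (het ▸ hy), hform 0 (Metric.mem_ball_self hr)]) hq (by
        rw [het, integral_sub (hib hKc) (hib (contDiff_quadHam _).continuous), hKi, sub_self])
    rw [← sub_eq_zero, ← integral_sub (hint (hHt 1 t).continuous)
      (hint hf.contMDiff_ham.continuous), ← setIntegral_eq_integral_of_forall_compl_eq_zero
      (s := e.source), ← h0]
    · refine setIntegral_congr_fun e.open_source.measurableSet fun x hx => ?_
      rw [hHs _ _ _ hx, hFe x hx]
    · intro x hx
      rw [hHn _ _ _ fun h => hx (hCO h), sub_self]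

end Modification

end HamLoop

end

theorem theorem1 (n : ℕ) {X : Type*} [TopologicalSpace X] [T2Space X] [CompactSpace X]
    [ChartedSpace (HamLoop.Model n) X] [IsManifold (𝓡 (2 * n)) ∞ X]
    [MeasurableSpace X] [BorelSpace X]
    (Ω : HamLoop.SymplecticForm n X) (F : X → ℝ) (f : ℝ → X → X)
    (hf : HamLoop.IsHamiltonianCircleAction Ω F f)
    (z₀ : X) (hz : HamLoop.IsMaslovZeroFixedPoint Ω f z₀)
    (hF : ∫ x, F x ∂(HamLoop.symplecticVolume Ω) ≠
      (HamLoop.symplecticVolume Ω).real univ * F z₀) :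
    ∃ B : Set X, IsOpen B ∧ z₀ ∈ B ∧
      ∃ (H : ℝ → X → ℝ) (h : ℝ → X → X),
        HamLoop.IsHamiltonianLoopIn Ω (closure B)ᶜ H h ∧
        HamLoop.calabi Ω (closure B)ᶜ H ≠ 0 ∧
        HamLoop.HomotopicInHam Ω f h := by
  obtain ⟨B, U, k, H, hB, hzB, hU, hBU, hH0, hkC, hflow, hloop, hk0, hint⟩ :=
    HamLoop.exists_hamiltonian_homotopy (hf.sub_const (F z₀)) hz (sub_self _)
  have hfin := HamLoop.isFiniteMeasure_symplecticVolume Ω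
  refine ⟨B, hB, hzB, H 1, k 1, ⟨⟨Uᶜ, hU.isClosed_compl.isCompact, compl_subset_compl.2 hBU,
    fun t _ x hx => hH0 t x (not_not.1 hx)⟩, hflow 1, hloop 1⟩, ?_, k, hkC.contMDiffOn,
    fun s _ => ⟨H s, ⟨univ, isCompact_univ, Subset.rfl, fun t _ x hx => absurd (mem_univ x) hx⟩,
      hflow s, hloop s⟩, fun t _ x => hk0 t x, fun _ _ _ => rfl⟩
  have h1 : ∀ t, ∫ x in (closure B)ᶜ, H 1 t x ∂HamLoop.symplecticVolume Ω =
      ∫ x, F x ∂HamLoop.symplecticVolume Ω - (HamLoop.symplecticVolume Ω).real univ * F z₀ := by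
    intro t
    rw [setIntegral_eq_integral_of_forall_compl_eq_zero (s := (closure B)ᶜ)
      fun x hx => hH0 t x (hBU (not_not.1 hx)), hint,
      integral_sub (hf.contMDiff_ham.continuous.integrable_of_hasCompactSupport
        (HasCompactSupport.of_compactSpace _)) (integrable_const _), integral_const, smul_eq_mul]
  rw [HamLoop.calabi]
  simp only [h1, intervalIntegral.integral_const, sub_zero, one_smul]
  exact sub_ne_zero.2 hF
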